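/- **Model.** Let $X_1,X_2,\dots$ be i.i.d. with distribution function $F_0$ and, independently of them, $T_1,T_2,\dots$ i.i.d. with distribution function $G$. Observe $(T_j,\Delta_j)$, $\Delta_j=1_{\{X_j\le T_j\}}$, $1\le j\le n$. Assume: (F.1) $F_0$ has bounded support $\mathcal S_0=[0,M_0]$ and is strictly increasing on $\mathcal S_0$, with a density $f_0$ bounded away from zero on $\mathcal S_0$; (G.1) $G$ has support $[0,\infty)$ and is strictly increasing on $\mathcal S_0$, with a density $g$ which on $\mathcal S_0$ is bounded away from zero and differentiable with bounded derivative $g'$ (one-sided at the end points); (K.1) $k$ is a symmetric probability density with support $[-1,1]$, twice continuously differentiable on $\mathbb R$. Put $m_2(k)=\int u^2k(u)\,du$. **Estimators.** For $h>0$, $i\in\{0,1\}$ and $t>h$ let $\hat g_{n,i}(t)=\frac1n\sum_{j\le n,\,\Delta_j=i}\frac1hk\!\left(\frac{t-T_j}h\right)$; for $0\le t\le h$ replace $k$ in this formula by the boundary kernel $k^\beta$ with $\beta=t/h$, where $$k^\beta(u)=\frac{\nu_{2,\beta}-\nu_{1,\beta}u}{\nu_{0,\beta}\nu_{2,\beta}-\nu_{1,\beta}^2}\,k(u)1_{(-1,\beta)}(u),\qquad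 \nu_{i,\beta}=\int_{-1}^\beta u^ik(u)\,du .$$ Let $\hat g_n=\hat g_{n,0}+\hat g_{n,1}$, $\hat G_{n,i}(t)=\int_0^t\hat g_{n,i}(u)\,du$, $\hat G_n=\hat G_{n,0}+\hat G_{n,1}$ and $\tau=\sup\{t\ge0:\hat g_n(t)>0\}$. Let $\hat F_n^{\rm MS}(t)$ be the right-continuous slope (right derivative), at the point with abscissa $\hat G_n(t)$, of the lower convex hull of the curve $u\mapsto(\hat G_n(u),\hat G_{n,1}(u))$, $u\in[0,\tau]$. Let $$\hat f_n^{\rm MS}(t)=\frac{d}{du}\hat F_n^{\rm MS}(u)\Big|_{u=t},\qquad \hat f_n^{\rm naive}(t)=\frac{\hat g_n(t)\hat g_{n,1}'(t)-\hat g_n'(t)\hat g_{n,1}(t)}{\hat g_n(t)^2}.$$ **Theorem.** Fix $t>0$ such that $f_0^{(3)}$ and $g^{(3)}$ exist in a neighbourhood of $t$ and are continuous at $t$, and such that $q(t)\ne0$, where $$q(t)=f_0''(t)+2\,\frac{g''(t)f_0(t)+g'(t)f_0'(t)}{g(t)}-2\,\frac{g'(t)^2f_0(t)}{g(t)^2}.$$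 Let $h=cn^{-1/7}$ with $c>0$. Then $\hat F_n^{\rm MS}$ is differentiable at $t$ with probability tending to one, and $$n^{2/7}\bigl(\hat f_n^{\rm MS}(t)-f_0(t)\bigr)\rightsquigarrow\mathcal N(\mu_c,\sigma_c^2),\qquad \mu_c=\tfrac12c^2m_2(k)q(t),\qquad \sigma_c^2=\frac{F_0(t)(1-F_0(t))}{c^3g(t)}\int k'(u)^2\,du .$$ The same convergence holds with $\hat f_n^{\rm MS}$ replaced by $\hat f_n^{\rm naive}$. Moreover, among the bandwidths $h=cn^{-1/7}$, $c>0$, the one that is optimal for the asymptotic mean squared error is $h=c_{f,{\rm MS}}n^{-1/7}$, where $$c_{f,{\rm MS}}=\Bigl\{3\,\frac{F_0(t)(1-F_0(t))}{g(t)}\int k'(u)^2\,du\Bigr\}^{1/7}\bigl\{m_2(k)^2q(t)^2\bigr\}^{-1/7};$$ that is, $c_{f,{\rm MS}}>0$ is the unique minimizer of $c\mapsto\mu_c^2+\sigma_c^2$ over $c>0$. -/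

import Mathlib

open MeasureTheory ProbabilityTheory Set Filter Topology

noncomputable section

namespace CurrentStatus

/-! ### Assumptions on the distributions and on the kernel -/

/-- `f` is a (nonnegative, measurable) Lebesgue density of the measure `P` on the line. -/
structure IsDensity (P : Measure ℝ) (f : ℝ → ℝ) : Prop where
  measurable : Measurable f
  nonneg : ∀ x, 0 ≤ f x
  eq_withDensity : P = volume.withDensity (fun x => ENNReal.ofReal (f x))

/-- The condition on the law `P` of `X`, with distribution function `F₀ = cdf P` and density `f`:
bounded support `[0, M]`, `F₀` strictly increasing on `[0, M]`, and `f` bounded away from `0`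
on `[0, M]`. -/
structure ConditionF (P : Measure ℝ) (f : ℝ → ℝ) (M : ℝ) : Prop where
  support_eq : P.support = Icc 0 M
  strictMono : StrictMonoOn (cdf P) (Icc 0 M)
  density : IsDensity P f
  away : ∃ ε > 0, ∀ x ∈ Icc 0 M, ε ≤ f x

/-- The condition on the law `Q` of `T`, with distribution function `G = cdf Q` and density `g`:
support `[0, ∞)`, `G` strictly increasing on `[0, M]`, and on `[0, M]` the density `g` is bounded
away from `0` and has a bounded derivative (one-sided at the end points, since `g` vanishes
to the left of `0`). -/
structure ConditionG (Q : Measure ℝ) (g : ℝ → ℝ) (M : ℝ) : Prop where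
  support_eq : Q.support = Ici 0
  strictMono : StrictMonoOn (cdf Q) (Icc 0 M)
  density : IsDensity Q g
  away : ∃ ε > 0, ∀ x ∈ Icc 0 M, ε ≤ g x
  differentiable : DifferentiableOn ℝ g (Icc 0 M)
  deriv_bounded : ∃ C, ∀ x ∈ Icc 0 M, |derivWithin g (Icc 0 M) x| ≤ C

/-- The condition on the kernel: a symmetric probability density with support `[-1, 1]`,
twice continuously differentiable on the line. -/
structure ConditionK (k : ℝ → ℝ) : Prop where
  nonneg : ∀ u, 0 ≤ k u
  integral_eq_one : ∫ u, k u = 1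
  support_eq : tsupport k = Icc (-1) 1
  symm : ∀ u, k (-u) = k u
  smooth : ContDiff ℝ 2 k

/-- The third derivative of `f` exists (in a neighbourhood of `t`) and is continuous at `t`. -/
def HasContThirdDerivAt (f : ℝ → ℝ) (t : ℝ) : Prop :=
  (∀ᶠ x in 𝓝 t, ∀ j < 3, DifferentiableAt ℝ (iteratedDeriv j f) x) ∧
    ContinuousAt (iteratedDeriv 3 f) t

/-! ### The data -/

/-- The current status observation `(T, Δ)`, `Δ = 1` if `X ≤ T` and `Δ = 0` otherwise. -/
def observe (x t : ℝ) : ℝ × Fin 2 := (t, if x ≤ t then 1 else 0)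

/-! ### Kernel estimators of the observation densities

A sample is a sequence `z` of observations, of which only `z 0, …, z (n - 1)` are used. -/

/-- `ν_{i,β}(k) = ∫_{-1}^β u^i k(u) du`. -/
def nu (k : ℝ → ℝ) (i : ℕ) (β : ℝ) : ℝ := ∫ u in (-1)..β, u ^ i * k u

/-- The boundary kernel `k^β`. -/
def boundaryKernel (k : ℝ → ℝ) (β u : ℝ) : ℝ :=
  (Ioo (-1) β).indicator
    (fun u => (nu k 2 β - nu k 1 β * u) / (nu k 0 β * nu k 2 β - nu k 1 β ^ 2) * k u) u

/-- The contribution of an observation time `u` to the kernel estimate at `t`: the rescaled kernel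
`k_h (t - u)`, replaced by the rescaled boundary kernel with `β = t / h` when `0 ≤ t ≤ h`. -/
def smoothingWeight (k : ℝ → ℝ) (h t u : ℝ) : ℝ :=
  if 0 ≤ t ∧ t ≤ h then h⁻¹ * boundaryKernel k (t / h) ((t - u) / h)
  else h⁻¹ * k ((t - u) / h)

/-- `ĝ_{n,i}(t)`: the integral of the smoothing weight against the empirical subdistribution
of the `T_j` with `Δ_j = i`, which puts mass `1 / n` at each of these points. -/
def gHat (k : ℝ → ℝ) (h : ℝ) (n : ℕ) (z : ℕ → ℝ × Fin 2) (i : Fin 2) (t : ℝ) : ℝ :=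
  (n : ℝ)⁻¹ * ∑ j ∈ Finset.range n, if (z j).2 = i then smoothingWeight k h t (z j).1 else 0

/-- `ĝ_n = ĝ_{n,0} + ĝ_{n,1}`. -/
def gHatSum (k : ℝ → ℝ) (h : ℝ) (n : ℕ) (z : ℕ → ℝ × Fin 2) (t : ℝ) : ℝ :=
  gHat k h n z 0 t + gHat k h n z 1 t

/-- `Ĝ_{n,i}(t) = ∫_{[0,t]} ĝ_{n,i}(u) du`, for `t ≥ 0`. -/
def GHat (k : ℝ → ℝ) (h : ℝ) (n : ℕ) (z : ℕ → ℝ × Fin 2) (i : Fin 2) (t : ℝ) : ℝ :=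
  ∫ u in (0)..t, gHat k h n z i u

/-- `Ĝ_n = Ĝ_{n,0} + Ĝ_{n,1}`. -/
def GHatSum (k : ℝ → ℝ) (h : ℝ) (n : ℕ) (z : ℕ → ℝ × Fin 2) (t : ℝ) : ℝ :=
  GHat k h n z 0 t + GHat k h n z 1 t

/-! ### The maximum smoothed likelihood estimator -/

/-- `τ = sup {t ≥ 0 : ĝ_{n,0}(t) + ĝ_{n,1}(t) > 0}`. -/
def tau (k : ℝ → ℝ) (h : ℝ) (n : ℕ) (z : ℕ → ℝ × Fin 2) : ℝ :=
  sSup {t | 0 ≤ t ∧ 0 < gHatSum k h n z t}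

/-- The continuous cumulative sum diagram `t ↦ (Ĝ_n(t), Ĝ_{n,1}(t))`, `t ∈ [0, τ]`,
as a subset of the plane. -/
def ccsd (k : ℝ → ℝ) (h : ℝ) (n : ℕ) (z : ℕ → ℝ × Fin 2) : Set (ℝ × ℝ) :=
  (fun t => (GHatSum k h n z t, GHat k h n z 1 t)) '' Icc 0 (tau k h n z)

/-- The lower boundary of the convex hull of a planar set, as a function of the abscissa. -/
def lowerHull (S : Set (ℝ × ℝ)) (x : ℝ) : ℝ := sInf {y | (x, y) ∈ convexHull ℝ S}

/-- The MSLE `F̂_n^MS(t)`: the right-continuous slope (that is, the right derivative) of the lower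
convex hull of the cumulative sum diagram at the point with abscissa `Ĝ_n(t)`. -/
def FMS (k : ℝ → ℝ) (h : ℝ) (n : ℕ) (z : ℕ → ℝ × Fin 2) (t : ℝ) : ℝ :=
  derivWithin (lowerHull (ccsd k h n z)) (Ioi (GHatSum k h n z t)) (GHatSum k h n z t)

/-- The density estimator `f̂_n^MS(t)`, the derivative of `F̂_n^MS` at `t`. -/
def fMS (k : ℝ → ℝ) (h : ℝ) (n : ℕ) (z : ℕ → ℝ × Fin 2) (t : ℝ) : ℝ :=
  deriv (FMS k h n z) t

/-- The naive density estimator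
`f̂_n^naive(t) = (ĝ_n(t) ĝ'_{n,1}(t) - ĝ'_n(t) ĝ_{n,1}(t)) / ĝ_n(t)²`,
with `ĝ'_n = ĝ'_{n,0} + ĝ'_{n,1}`. -/
def fNaive (k : ℝ → ℝ) (h : ℝ) (n : ℕ) (z : ℕ → ℝ × Fin 2) (t : ℝ) : ℝ :=
  (gHatSum k h n z t * deriv (gHat k h n z 1) t
      - (deriv (gHat k h n z 0) t + deriv (gHat k h n z 1) t) * gHat k h n z 1 t)
    / gHatSum k h n z t ^ 2

/-- The bandwidth `h = c n^{-1/7}`. -/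
def bandwidth (c : ℝ) (n : ℕ) : ℝ := c * (n : ℝ) ^ (-(1 / 7) : ℝ)

/-! ### The limit -/

/-- `m₂(k) = ∫ u² k(u) du`. -/
def m2 (k : ℝ → ℝ) : ℝ := ∫ u, u ^ 2 * k u

/-- `q(t) = f''(t) + 2 (g''(t) f(t) + g'(t) f'(t)) / g(t) - 2 g'(t)² f(t) / g(t)²`. -/
def q (f g : ℝ → ℝ) (t : ℝ) : ℝ :=
  iteratedDeriv 2 f t + 2 * ((iteratedDeriv 2 g t * f t + deriv g t * deriv f t) / g t)
    - 2 * (deriv g t ^ 2 * f t / g t ^ 2)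

/-- The asymptotic mean `½ c² m₂(k) q(t)`. -/
def asympMean (k f g : ℝ → ℝ) (t c : ℝ) : ℝ := 1 / 2 * c ^ 2 * m2 k * q f g t

/-- The asymptotic variance `F(t) (1 - F(t)) / (c³ g(t)) ∫ k'(u)² du`. -/
def asympVar (k F g : ℝ → ℝ) (t c : ℝ) : ℝ :=
  F t * (1 - F t) / (c ^ 3 * g t) * ∫ u, deriv k u ^ 2

/-- The asymptotic mean squared error, squared asymptotic mean plus asymptotic variance, as
a function of the constant `c` in the bandwidth. -/
def aMSE (k F f g : ℝ → ℝ) (t c : ℝ) : ℝ := asympMean k f g t c ^ 2 + asympVar k F g t c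

/-- `c_{f,MS} = {3 F(t) (1 - F(t)) / g(t) ∫ k'(u)² du}^{1/7} {m₂(k)² q(t)²}^{-1/7}`. -/
def cOpt (k F f g : ℝ → ℝ) (t : ℝ) : ℝ :=
  (3 * (F t * (1 - F t) / g t) * ∫ u, deriv k u ^ 2) ^ (1 / 7 : ℝ)
    * (m2 k ^ 2 * q f g t ^ 2) ^ (-(1 / 7) : ℝ)

/-- Convergence in distribution of real random quantities `Z n` to the law `ν`: convergence of
distribution functions at all continuity points of the limit. The second half is the first one for
the complementary event: it is redundant when the `Z n` are measurable, and without measurability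
it makes outer and inner probabilities converge to the same limit. -/
def ConvergesInLaw {Ω : Type*} [MeasurableSpace Ω] (μ : Measure Ω) (Z : ℕ → Ω → ℝ)
    (ν : Measure ℝ) : Prop :=
  ∀ x, ν {x} = 0 →
    Tendsto (fun n => μ {ω | Z n ω ≤ x}) atTop (𝓝 (ν (Iic x))) ∧
    Tendsto (fun n => μ {ω | x < Z n ω}) atTop (𝓝 (ν (Ioi x)))

end CurrentStatus

end

open CurrentStatus

/-! Where the smoothed cumulative sum diagram is parametrized by `u`, its slope is the ratio of
`ĝ_{n,1}` to `ĝ_n`. The proof shows that near `t` the convex hull does not touch this slope, so that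
the maximum smoothed likelihood estimator is that ratio and its derivative is the naive estimator.
The limit law is then a statement about kernel averages.

Coincidence near `t` has a local and a global half. Locally, with `h` of order `n^{-1/7}` one has `n
h^6 → ∞`, so a grid argument with Chebyshev's inequality makes the kernel estimates and their first
derivatives uniformly consistent around `t` (`exists_uniform`). The limit of the Wronskian `ĝ₀ ĝ₁' -
ĝ₀' ĝ₁` at `t` is `f₀ g² > 0`, so the slope is increasing there. Globally, the height of the true
curve above its tangent at `t` is `∫_t^u (F₀ - F₀(t)) g`, which exceeds a fixed positive constant
off any window around `t` (`exists_separation`). Since `Ĝ_{n,0}` and `Ĝ_{n,1}` are uniformly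
consistent on `[0, ∞)` (`eventually_abs_GHat_sub_lt`), the empirical curve keeps that gap. Hence
tangents at points close to `t` support the whole curve, and the hull equals the curve there
(`eventually_derivWithin_lowerHull_eq`).

For the limit law, subtract `F₀(t)` from the ratio: the numerator becomes a kernel average with
weights `Δ - F₀(t)`, estimating `(F₀ - F₀(t)) g`, which vanishes at `t`. At scale `n^{2/7}` the
values of the kernel estimates contribute only their bias, because their standard deviation is of
order `n^{-3/7}`. Only the derivative of the new numerator fluctuates at that scale; the triangular
central limit theorem `convergesInLaw_sum` gives it the variance factor `F₀ (1 - F₀) g ∫ k'²`. The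
biases come from Taylor expansions and add up to the multiple of `q(t)`. Slutsky's lemma combines
these, and agreement with probability tending to one transfers the limit to the derivative of the
hull slope.

The condition `q(t) ≠ 0` is used twice: it makes the optimal bandwidth constant well defined, and it
forces `t` to lie inside the support of `X`. -/

namespace CurrentStatus

/-! ### Convergence in probability as convergence along a filter -/

section InProb

variable {Ω : Type*} [MeasurableSpace Ω] {μ : Measure Ω}

/-- The filter on `ℕ × Ω` of the sets whose sections have outer probability tending to one.
Convergence in probability is convergence along this filter. -/
def inProb (μ : Measure Ω) : Filter (ℕ × Ω) where
  sets := {S | Tendsto (fun n => μ {ω | (n, ω) ∉ S}) atTop (𝓝 0)}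
  univ_sets := by simp
  sets_of_superset {S R} hS hSR := by
    refine tendsto_of_tendsto_of_tendsto_of_le_of_le tendsto_const_nhds hS (fun _ => zero_le) ?_
    exact fun n => measure_mono fun ω hω h => hω (hSR h)
  inter_sets {S R} hS hR := by
    have h := Tendsto.add hS hR
    rw [add_zero] at h
    refine tendsto_of_tendsto_of_tendsto_of_le_of_le tendsto_const_nhds h (fun _ => zero_le) ?_
    intro n
    refine (measure_mono ?_).trans (measure_union_le _ _)
    intro ω hω
    by_contra hcon
    simp only [mem_union, mem_ofPred_eq, not_or, not_not] at hcon
    exact hω hcon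

theorem eventually_inProb {p : ℕ × Ω → Prop} :
    (∀ᶠ x in inProb μ, p x) ↔ Tendsto (fun n => μ {ω | ¬ p (n, ω)}) atTop (𝓝 0) := Iff.rfl

/-- Lets any deterministic limit in `n` be used along `inProb`. -/
theorem tendsto_fst_inProb : Tendsto (Prod.fst : ℕ × Ω → ℕ) (inProb μ) atTop := by
  refine tendsto_atTop.2 fun N => eventually_inProb.2 ?_
  refine tendsto_const_nhds.congr' ?_
  filter_upwards [eventually_ge_atTop N] with n hn
  simp [hn]

/-- The events `A n` are trapped between `B (-ε) n` and `B ε n` up to exceptional events of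
vanishing probability, and continuity of `ψ` at `0` lets `ε` shrink. Only monotonicity and
subadditivity of the outer measure enter, so the sets need not be measurable. This is the common
core of Slutsky's lemma and of `ConvergesInLaw.congr_inProb`. -/
theorem tendsto_measure_of_sandwich {A : ℕ → Set Ω} {B : ℝ → ℕ → Set Ω}
    {D : ℝ → ℕ → Set Ω} {ψ : ℝ → ENNReal} (hψ : ContinuousAt ψ 0)
    (hB : ∀ ε, Tendsto (fun n => μ (B ε n)) atTop (𝓝 (ψ ε)))
    (hD : ∀ ε > 0, Tendsto (fun n => μ (D ε n)) atTop (𝓝 0))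
    (hlow : ∀ ε > 0, ∀ n, B (-ε) n ⊆ A n ∪ D ε n)
    (hup : ∀ ε > 0, ∀ n, A n ⊆ B ε n ∪ D ε n) :
    Tendsto (fun n => μ (A n)) atTop (𝓝 (ψ 0)) := by
  refine tendsto_order.2 ⟨fun a ha => ?_, fun a ha => ?_⟩
  · obtain ⟨ε, hε, hl⟩ : ∃ ε > 0, a < ψ (-ε) := by
      have h1 : ∀ᶠ x in 𝓝 (0 : ℝ), a < ψ (-x) := by
        have : ContinuousAt (fun x : ℝ => ψ (-x)) 0 := by
          refine ContinuousAt.comp (f := fun x : ℝ => -x) (by simpa using hψ) (by fun_prop)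
        exact this.eventually (by simpa using lt_mem_nhds ha)
      obtain ⟨ε, h1, h2⟩ := ((h1.filter_mono nhdsWithin_le_nhds).and
        (self_mem_nhdsWithin : Ioi (0 : ℝ) ∈ 𝓝[>] 0)).exists
      exact ⟨ε, h2, h1⟩
    have h3 := ENNReal.Tendsto.sub (hB (-ε)) (hD ε hε) (Or.inr (by simp))
    rw [tsub_zero] at h3
    filter_upwards [h3.eventually (lt_mem_nhds hl)] with n hn
    refine hn.trans_le (tsub_le_iff_right.2 ?_)
    exact (measure_mono (hlow ε hε n)).trans (measure_union_le _ _)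
  · obtain ⟨ε, hε, hl⟩ : ∃ ε > 0, ψ ε < a := by
      have h1 : ∀ᶠ x in 𝓝 (0 : ℝ), ψ x < a := hψ.eventually (gt_mem_nhds ha)
      obtain ⟨ε, h1, h2⟩ := ((h1.filter_mono nhdsWithin_le_nhds).and
        (self_mem_nhdsWithin : Ioi (0 : ℝ) ∈ 𝓝[>] 0)).exists
      exact ⟨ε, h2, h1⟩
    have h3 := (hB ε).add (hD ε hε)
    rw [add_zero] at h3
    filter_upwards [h3.eventually (gt_mem_nhds hl)] with n hn
    exact ((measure_mono (hup ε hε n)).trans (measure_union_le _ _)).trans_lt hn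

theorem gaussianReal_Iic_add (m : ℝ) (v : NNReal) (x : ℝ) :
    gaussianReal m v (Iic x) = gaussianReal 0 v (Iic (x - m)) := by
  have h := gaussianReal_map_add_const (μ := 0) (v := v) m
  rw [zero_add] at h
  rw [← h, Measure.map_apply (by fun_prop) measurableSet_Iic]
  congr 1
  ext y
  simp [le_sub_iff_add_le]

theorem gaussianReal_Ioi_add (m : ℝ) (v : NNReal) (x : ℝ) :
    gaussianReal m v (Ioi x) = gaussianReal 0 v (Ioi (x - m)) := by
  have h := gaussianReal_map_add_const (μ := 0) (v := v) m
  rw [zero_add] at h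
  rw [← h, Measure.map_apply (by fun_prop) measurableSet_Ioi]
  congr 1
  ext y
  simp [sub_lt_iff_lt_add]

theorem continuous_measure_Iic (P : Measure ℝ) [IsProbabilityMeasure P] [NullSingletonClass P] :
    Continuous fun x => P (Iic x) := by
  have h : Continuous (cdf P) := by
    rw [continuous_iff_continuousAt]
    intro x
    rw [(monotone_cdf P).continuousAt_iff_leftLim_eq_rightLim]
    have h1 := (cdf P).measure_singleton x
    rw [measure_cdf, measure_singleton, (cdf P).rightLim_eq] at *
    have h2 := ENNReal.ofReal_eq_zero.1 h1.symm
    have h3 := (monotone_cdf P).leftLim_le (le_refl x)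
    linarith
  simp_rw [← ofReal_cdf]
  exact ENNReal.continuous_ofReal.comp h

/-- Slutsky's lemma for a centered normal limit. -/
theorem ConvergesInLaw.of_sub_tendsto {S Z : ℕ → Ω → ℝ} {v : NNReal} (hv : v ≠ 0) {m : ℝ}
    (hS : ConvergesInLaw μ S (gaussianReal 0 v))
    (hZ : Tendsto (fun p : ℕ × Ω => Z p.1 p.2 - S p.1 p.2) (inProb μ) (𝓝 m)) :
    ConvergesInLaw μ Z (gaussianReal m v) := by
  have hna : NullSingletonClass (gaussianReal 0 v) := nullSingletonClass_gaussianReal hv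
  have hbad : ∀ ε > 0, Tendsto (fun n => μ {ω | ¬ |Z n ω - S n ω - m| < ε}) atTop (𝓝 0) := by
    intro ε hε
    have := hZ.eventually (Metric.ball_mem_nhds m hε)
    exact eventually_inProb.1 this
  have hc := continuous_measure_Iic (gaussianReal 0 v)
  have hc' : Continuous fun x => gaussianReal 0 v (Ioi x) := by
    have : (fun x => gaussianReal 0 v (Ioi x)) = fun x => 1 - gaussianReal 0 v (Iic x) := by
      ext x
      rw [← compl_Iic, prob_compl_eq_one_sub measurableSet_Iic]
    rw [this]
    exact ENNReal.continuous_sub_left (by simp) |>.comp hc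
  intro x _
  constructor
  · rw [gaussianReal_Iic_add]
    have key := tendsto_measure_of_sandwich (μ := μ) (A := fun n => {ω | Z n ω ≤ x})
      (B := fun ε n => {ω | S n ω ≤ x - m + ε})
      (D := fun ε n => {ω | ¬ |Z n ω - S n ω - m| < ε})
      (ψ := fun ε => gaussianReal 0 v (Iic (x - m + ε)))
      (by exact (hc.comp (by fun_prop)).continuousAt)
      (fun ε => (hS _ (measure_singleton _)).1) hbad ?_ ?_
    · simpa using key
    · intro ε hε n ω hω
      by_contra hcon
      simp only [mem_union, mem_ofPred_eq, not_or, not_not, not_le, abs_lt] at hcon hω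
      linarith [hcon.2.1, hcon.2.2]
    · intro ε hε n ω hω
      by_contra hcon
      simp only [mem_union, mem_ofPred_eq, not_or, not_not, not_le, abs_lt] at hcon hω
      linarith [hcon.2.1, hcon.2.2]
  · rw [gaussianReal_Ioi_add]
    have key := tendsto_measure_of_sandwich (μ := μ) (A := fun n => {ω | x < Z n ω})
      (B := fun ε n => {ω | x - m - ε < S n ω})
      (D := fun ε n => {ω | ¬ |Z n ω - S n ω - m| < ε})
      (ψ := fun ε => gaussianReal 0 v (Ioi (x - m - ε)))
      (by exact (hc'.comp (by fun_prop)).continuousAt)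
      (fun ε => (hS _ (measure_singleton _)).2) hbad ?_ ?_
    · simpa using key
    · intro ε hε n ω hω
      by_contra hcon
      simp only [mem_union, mem_ofPred_eq, not_or, not_not, not_lt, abs_lt] at hcon hω
      linarith [hcon.2.1, hcon.2.2]
    · intro ε hε n ω hω
      by_contra hcon
      simp only [mem_union, mem_ofPred_eq, not_or, not_not, not_lt, abs_lt] at hcon hω
      linarith [hcon.2.1, hcon.2.2]

/-- A sequence that agrees with probability tending to one with one that converges in law. -/
theorem ConvergesInLaw.congr_inProb {Z Z' : ℕ → Ω → ℝ} {ν : Measure ℝ}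
    (hZ : ConvergesInLaw μ Z ν) (h : ∀ᶠ p in inProb μ, Z p.1 p.2 = Z' p.1 p.2) :
    ConvergesInLaw μ Z' ν := by
  intro x hx
  have hD := eventually_inProb.1 h
  constructor
  · exact tendsto_measure_of_sandwich (A := fun n => {ω | Z' n ω ≤ x})
      (B := fun _ n => {ω | Z n ω ≤ x})
      (D := fun _ n => {ω | ¬ Z n ω = Z' n ω}) (ψ := fun _ => ν (Iic x)) continuousAt_const
      (fun _ => (hZ x hx).1) (fun _ _ => hD)
      (fun ε _ n ω hω => by
        by_contra hcon
        simp only [mem_union, mem_ofPred_eq, not_or, not_not] at hcon hω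
        exact hcon.1 (hcon.2 ▸ hω))
      (fun ε _ n ω hω => by
        by_contra hcon
        simp only [mem_union, mem_ofPred_eq, not_or, not_not] at hcon hω
        exact hcon.1 (hcon.2 ▸ hω))
  · exact tendsto_measure_of_sandwich (A := fun n => {ω | x < Z' n ω})
      (B := fun _ n => {ω | x < Z n ω})
      (D := fun _ n => {ω | ¬ Z n ω = Z' n ω}) (ψ := fun _ => ν (Ioi x)) continuousAt_const
      (fun _ => (hZ x hx).2) (fun _ _ => hD)
      (fun ε _ n ω hω => by
        by_contra hcon
        simp only [mem_union, mem_ofPred_eq, not_or, not_not] at hcon hω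
        exact hcon.1 (hcon.2 ▸ hω))
      (fun ε _ n ω hω => by
        by_contra hcon
        simp only [mem_union, mem_ofPred_eq, not_or, not_not] at hcon hω
        exact hcon.1 (hcon.2 ▸ hω))

end InProb

/-! ### Averages over independent and identically distributed observations -/

section Averages

variable {Ω E : Type*} [MeasurableSpace Ω] [MeasurableSpace E] {μ : Measure Ω}
  {Z : ℕ → Ω → E}

/-- The average of `φ` over the first `n` observations. -/
noncomputable def avg (Z : ℕ → Ω → E) (φ : E → ℝ) (n : ℕ) (ω : Ω) : ℝ :=
  (n : ℝ)⁻¹ * ∑ j ∈ Finset.range n, φ (Z j ω)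

/-- A sequence of independent random variables with the same law. -/
structure IsIID (μ : Measure Ω) (Z : ℕ → Ω → E) : Prop where
  measurable : ∀ i, Measurable (Z i)
  indep : iIndepFun Z μ
  map_eq : ∀ i, μ.map (Z i) = μ.map (Z 0)

theorem IsIID.integral_comp (hZ : IsIID μ Z) {φ : E → ℝ} (hφ : Measurable φ) (i : ℕ) :
    ∫ ω, φ (Z i ω) ∂μ = ∫ ω, φ (Z 0 ω) ∂μ := by
  rw [← integral_map (φ := Z i) (hZ.measurable i).aemeasurable hφ.aestronglyMeasurable,
    hZ.map_eq, integral_map (hZ.measurable 0).aemeasurable hφ.aestronglyMeasurable]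

variable [IsProbabilityMeasure μ]

theorem IsIID.memLp_comp (hZ : IsIID μ Z) {φ : E → ℝ} (hφ : Measurable φ) {B : ℝ}
    (hB : ∀ x, |φ x| ≤ B) (i : ℕ) : MemLp (fun ω => φ (Z i ω)) 2 μ :=
  MemLp.of_bound (hφ.comp (hZ.measurable i)).aestronglyMeasurable B (ae_of_all _ fun _ => hB _)

theorem IsIID.integrable_comp (hZ : IsIID μ Z) {φ : E → ℝ} (hφ : Measurable φ) {B : ℝ}
    (hB : ∀ x, |φ x| ≤ B) (i : ℕ) : Integrable (fun ω => φ (Z i ω)) μ :=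
  (hZ.memLp_comp hφ hB i).integrable (by norm_num)

/-- Chebyshev's inequality. The variance of one summand is replaced by its second moment, which for
kernel terms is directly of order `h`. -/
theorem IsIID.measure_avg_sub_ge_le (hZ : IsIID μ Z) {φ : E → ℝ} (hφ : Measurable φ) {B : ℝ}
    (hB : ∀ x, |φ x| ≤ B) {n : ℕ} (hn : 0 < n) {ε : ℝ} (hε : 0 < ε) :
    μ {ω | ε ≤ |avg Z φ n ω - ∫ ω, φ (Z 0 ω) ∂μ|} ≤
      ENNReal.ofReal ((∫ ω, φ (Z 0 ω) ^ 2 ∂μ) / (n * ε ^ 2)) := by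
  have hn' : (0 : ℝ) < n := by exact_mod_cast hn
  have hL := hZ.memLp_comp hφ hB
  have hLs : MemLp (fun ω => avg Z φ n ω) 2 μ := by
    unfold avg
    exact (memLp_finsetSum _ fun i _ => hL i).const_mul _
  have hmean : ∫ ω, avg Z φ n ω ∂μ = ∫ ω, φ (Z 0 ω) ∂μ := by
    unfold avg
    rw [integral_const_mul, integral_finsetSum _ fun i _ => (hL i).integrable (by norm_num)]
    simp_rw [hZ.integral_comp hφ]
    simp
    field_simp
  have hvar : Var[fun ω => avg Z φ n ω; μ] ≤ (∫ ω, φ (Z 0 ω) ^ 2 ∂μ) / n := by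
    unfold avg
    rw [variance_const_mul]
    have h1 : Var[fun ω => ∑ j ∈ Finset.range n, φ (Z j ω); μ] =
        ∑ j ∈ Finset.range n, Var[fun ω => φ (Z j ω); μ] := by
      have := IndepFun.variance_sum (μ := μ) (X := fun j ω => φ (Z j ω)) (s := Finset.range n)
        (fun i _ => hL i) (fun i _ j _ hij =>
          (hZ.indep.indepFun hij).comp hφ hφ)
      rw [← this]
      congr 1
      ext ω
      simp
    rw [h1]
    have h2 : ∀ j ∈ Finset.range n, Var[fun ω => φ (Z j ω); μ] ≤ ∫ ω, φ (Z 0 ω) ^ 2 ∂μ := by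
      intro j _
      refine (variance_le_expectation_sq (hL j).aestronglyMeasurable).trans ?_
      exact (hZ.integral_comp (φ := fun x => φ x ^ 2) (hφ.pow_const 2) j).le
    calc ((n : ℝ)⁻¹) ^ 2 * _ ≤ ((n : ℝ)⁻¹) ^ 2 * (n * ∫ ω, φ (Z 0 ω) ^ 2 ∂μ) := by
          gcongr
          simpa using Finset.sum_le_sum h2
      _ = _ := by field_simp
  have h3 := meas_ge_le_variance_div_sq hLs hε
  rw [hmean] at h3
  refine h3.trans (ENNReal.ofReal_le_ofReal ?_)
  rw [← div_div]
  gcongr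

/-- The weak law of large numbers for triangular arrays. -/
theorem IsIID.tendsto_avg_sub_integral (hZ : IsIID μ Z) {φ : ℕ → E → ℝ}
    (hφ : ∀ n, Measurable (φ n)) {B : ℕ → ℝ} (hB : ∀ n x, |φ n x| ≤ B n)
    (hvar : Tendsto (fun n => (∫ ω, φ n (Z 0 ω) ^ 2 ∂μ) / n) atTop (𝓝 0)) :
    Tendsto (fun p : ℕ × Ω => avg Z (φ p.1) p.1 p.2 - ∫ ω, φ p.1 (Z 0 ω) ∂μ) (inProb μ) (𝓝 0) := by
  refine Metric.tendsto_nhds.2 fun ε hε => eventually_inProb.2 ?_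
  have h1 : Tendsto (fun n : ℕ => ENNReal.ofReal ((∫ ω, φ n (Z 0 ω) ^ 2 ∂μ) / (n * ε ^ 2)))
      atTop (𝓝 0) := by
    rw [← ENNReal.ofReal_zero]
    refine (ENNReal.continuous_ofReal.tendsto _).comp ?_
    have := hvar.div_const (ε ^ 2)
    simpa [div_div] using this
  refine tendsto_of_tendsto_of_tendsto_of_le_of_le' tendsto_const_nhds h1
    (Eventually.of_forall fun _ => zero_le) ?_
  filter_upwards [eventually_gt_atTop 0] with n hn
  refine le_trans (measure_mono ?_) (hZ.measure_avg_sub_ge_le (hφ n) (hB n) hn hε)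
  intro ω hω
  simpa [Real.dist_eq] using hω

theorem IsIID.tendsto_avg_of_bounded (hZ : IsIID μ Z) {φ : ℕ → E → ℝ}
    (hφ : ∀ n, Measurable (φ n)) {B : ℝ} (hB : ∀ n x, |φ n x| ≤ B) {m : ℝ}
    (hm : Tendsto (fun n => ∫ ω, φ n (Z 0 ω) ∂μ) atTop (𝓝 m)) :
    Tendsto (fun p : ℕ × Ω => avg Z (φ p.1) p.1 p.2) (inProb μ) (𝓝 m) := by
  suffices h0 : Tendsto (fun n => (∫ ω, φ n (Z 0 ω) ^ 2 ∂μ) / n) atTop (𝓝 0) by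
    have h2 := (hZ.tendsto_avg_sub_integral hφ (B := fun _ => B) hB h0).add
      (hm.comp tendsto_fst_inProb)
    simpa using h2
  have h1 : ∀ n, ∫ ω, φ n (Z 0 ω) ^ 2 ∂μ ≤ B ^ 2 := by
    intro n
    have hle : ∀ ω, φ n (Z 0 ω) ^ 2 ≤ B ^ 2 := fun ω =>
      sq_le_sq' (abs_le.1 (hB n _)).1 (abs_le.1 (hB n _)).2
    have := integral_mono_of_nonneg (μ := μ) (ae_of_all _ fun ω => sq_nonneg (φ n (Z 0 ω)))
      (integrable_const (B ^ 2)) (ae_of_all _ hle)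
    simpa using this
  refine tendsto_of_tendsto_of_tendsto_of_le_of_le tendsto_const_nhds
    (tendsto_const_div_atTop_nhds_zero_nat (B ^ 2)) ?_ ?_
  · intro n
    exact div_nonneg (integral_nonneg fun ω => sq_nonneg _) (Nat.cast_nonneg n)
  · intro n
    exact div_le_div_of_nonneg_right (h1 n) (Nat.cast_nonneg n)

end Averages

/-! ### A central limit theorem for triangular arrays -/

section CLT

/-- The remainder is kept as `|y| * y ^ 2` so that the first factor can be bounded uniformly while
the second integrates to a variance. -/
theorem norm_cexp_mul_I_sub_le {y : ℝ} (hy : |y| ≤ 1) :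
    ‖Complex.exp (y * Complex.I) - 1 - y * Complex.I + (y : ℂ) ^ 2 / 2‖ ≤ |y| * y ^ 2 := by
  have hn : ‖(y : ℂ) * Complex.I‖ = |y| := by simp
  have h := Complex.exp_bound (x := y * Complex.I) (by rw [hn]; exact hy) (n := 3) (by norm_num)
  rw [hn] at h
  have h1 : Complex.exp (y * Complex.I) - ∑ m ∈ Finset.range 3,
      ((y : ℂ) * Complex.I) ^ m / m.factorial =
      Complex.exp (y * Complex.I) - 1 - y * Complex.I + (y : ℂ) ^ 2 / 2 := by
    simp only [Finset.sum_range_succ, Finset.sum_range_zero, mul_pow, Complex.I_sq]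
    norm_num [Nat.factorial]
    ring
  rw [h1] at h
  refine h.trans ?_
  have h2 : |y| ^ 3 = |y| * y ^ 2 := by rw [← sq_abs y]; ring
  rw [h2]
  -- The constant of `Complex.exp_bound` with `n = 3` is `4 / 18`.
  refine mul_le_of_le_one_right (by positivity) (by norm_num [Nat.factorial])

variable {Ω E : Type*} [MeasurableSpace Ω] [MeasurableSpace E] {μ : Measure Ω}
  [IsProbabilityMeasure μ] {Z : ℕ → Ω → E}

/-- Centering removes the linear Taylor term, and boundedness by `b` reduces the cubic remainder to
`b` times the second moment. -/
theorem norm_integral_cexp_sub_le {Y : Ω → ℝ} (hY : Measurable Y) {b : ℝ}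
    (hb : ∀ ω, |Y ω| ≤ b) (h0 : ∫ ω, Y ω ∂μ = 0) {s : ℝ} (hs : |s| * b ≤ 1) :
    ‖(∫ ω, Complex.exp (s * Y ω * Complex.I) ∂μ) - 1 + (s ^ 2 / 2 * ∫ ω, Y ω ^ 2 ∂μ : ℝ)‖ ≤
      |s| ^ 3 * b * ∫ ω, Y ω ^ 2 ∂μ := by
  have hYL : MemLp Y 2 μ := MemLp.of_bound hY.aestronglyMeasurable b (ae_of_all _ fun _ => hb _)
  have hYi : Integrable Y μ := hYL.integrable (by norm_num)
  have hY2 : Integrable (fun ω => Y ω ^ 2) μ := hYL.integrable_sq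
  have hexp : Integrable (fun ω => Complex.exp (s * Y ω * Complex.I)) μ := by
    refine Integrable.of_bound (by fun_prop) 1 (ae_of_all _ fun ω => ?_)
    rw [← Complex.ofReal_mul, Complex.norm_exp_ofReal_mul_I]
  have e1 : (∫ ω, Complex.exp (s * Y ω * Complex.I) ∂μ) - 1 +
      (s ^ 2 / 2 * ∫ ω, Y ω ^ 2 ∂μ : ℝ) =
      ∫ ω, (Complex.exp (((s * Y ω : ℝ) : ℂ) * Complex.I) - 1 - ((s * Y ω : ℝ) : ℂ) * Complex.I +
        ((s * Y ω : ℝ) : ℂ) ^ 2 / 2) ∂μ := by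
    have hc : Integrable (fun ω => ((s * Y ω : ℝ) : ℂ) * Complex.I) μ :=
      ((hYi.const_mul s).ofReal (𝕜 := ℂ)).mul_const _
    have hsq : Integrable (fun ω => ((s * Y ω : ℝ) : ℂ) ^ 2 / 2) μ := by
      have := ((hY2.const_mul (s ^ 2 / 2)).ofReal (𝕜 := ℂ))
      refine this.congr (ae_of_all _ fun ω => ?_)
      push_cast
      ring_nf
      simp
    have hexp' : Integrable (fun ω => Complex.exp (((s * Y ω : ℝ) : ℂ) * Complex.I)) μ := by
      simpa using hexp
    have i1 : Integrable (fun ω => Complex.exp (((s * Y ω : ℝ) : ℂ) * Complex.I) - 1) μ :=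
      hexp'.sub (integrable_const _)
    have i2 : Integrable (fun ω => Complex.exp (((s * Y ω : ℝ) : ℂ) * Complex.I) - 1 -
        ((s * Y ω : ℝ) : ℂ) * Complex.I) μ := i1.sub hc
    rw [integral_add i2 hsq, integral_sub i1 hc, integral_sub hexp' (integrable_const _)]
    have e2 : ∫ ω, ((s * Y ω : ℝ) : ℂ) * Complex.I ∂μ = 0 := by
      rw [integral_mul_const, integral_complex_ofReal, integral_const_mul, h0]
      simp
    have e3 : ∫ ω, ((s * Y ω : ℝ) : ℂ) ^ 2 / 2 ∂μ = ((s ^ 2 / 2 * ∫ ω, Y ω ^ 2 ∂μ : ℝ) : ℂ) := by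
      rw [← integral_const_mul, ← integral_complex_ofReal]
      refine integral_congr_ae (ae_of_all _ fun ω => ?_)
      push_cast
      ring
    rw [e2, e3]
    simp
  rw [e1, ← integral_const_mul]
  refine norm_integral_le_of_norm_le (hY2.const_mul _) (ae_of_all _ fun ω => ?_)
  have hle : |s * Y ω| ≤ |s| * b := by
    rw [abs_mul]
    exact mul_le_mul_of_nonneg_left (hb ω) (abs_nonneg _)
  refine (norm_cexp_mul_I_sub_le (hle.trans hs)).trans ?_
  calc |s * Y ω| * (s * Y ω) ^ 2 ≤ (|s| * b) * (s * Y ω) ^ 2 := by gcongr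
    _ = |s| ^ 3 * b * Y ω ^ 2 := by
      rw [mul_pow, ← sq_abs s]
      ring

/-- The central limit theorem for row-wise i.i.d. arrays of uniformly small centered variables. -/
theorem IsIID.convergesInLaw_sum (hZ : IsIID μ Z) {φ : ℕ → E → ℝ} (hφ : ∀ n, Measurable (φ n))
    {b : ℕ → ℝ} (hb : ∀ n x, |φ n x| ≤ b n) (hb0 : Tendsto b atTop (𝓝 0))
    (h0 : ∀ n, ∫ ω, φ n (Z 0 ω) ∂μ = 0) {v : NNReal}
    (hvar : Tendsto (fun n : ℕ => n * ∫ ω, φ n (Z 0 ω) ^ 2 ∂μ) atTop (𝓝 v)) :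
    ConvergesInLaw μ (fun n ω => ∑ j ∈ Finset.range n, φ n (Z j ω)) (gaussianReal 0 v) := by
  have hm : ∀ n, Measurable fun ω => ∑ j ∈ Finset.range n, φ n (Z j ω) := fun n =>
    Finset.measurable_fun_sum _ fun j _ => (hφ n).comp (hZ.measurable j)
  have hmj : ∀ n j, Measurable fun ω => φ n (Z j ω) := fun n j => (hφ n).comp (hZ.measurable j)
  have hchar : ∀ n s, charFun (μ.map fun ω => ∑ j ∈ Finset.range n, φ n (Z j ω)) s =
      (1 + ((∫ ω, Complex.exp (s * φ n (Z 0 ω) * Complex.I) ∂μ) - 1)) ^ n := by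
    intro n s
    have hind : iIndepFun (fun j ω => φ n (Z j ω)) μ := hZ.indep.comp _ fun _ => hφ n
    rw [iIndepFun.charFun_map_fun_finsetSum_eq_prod
      (fun j _ => (hmj n j).aemeasurable) (hind.restrict _)]
    have hj : ∀ j, μ.map (fun ω => φ n (Z j ω)) = μ.map (fun ω => φ n (Z 0 ω)) := by
      intro j
      have e : ∀ j, μ.map (fun ω => φ n (Z j ω)) = (μ.map (Z j)).map (φ n) := fun j =>
        (Measure.map_map (hφ n) (hZ.measurable j)).symm
      rw [e, e, hZ.map_eq]
    simp only [hj, Finset.prod_const, Finset.card_range, Pi.pow_apply]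
    rw [charFun_apply_real, integral_map (hmj n 0).aemeasurable (by fun_prop)]
    simp
  have hconv : ∀ s, Tendsto (fun n => charFun (μ.map fun ω => ∑ j ∈ Finset.range n, φ n (Z j ω)) s)
      atTop (𝓝 (charFun (gaussianReal 0 v) s)) := by
    intro s
    simp_rw [hchar]
    rw [charFun_gaussianReal]
    -- It remains that `n` times the characteristic function minus one tends to `-s² v / 2`: `hA`
    -- disposes of the Taylor remainder, `hB` is the quadratic term.
    refine Complex.tendsto_one_add_pow_exp_of_tendsto ?_
    have hA : Tendsto (fun n : ℕ => (n : ℂ) * ((∫ ω, Complex.exp (s * φ n (Z 0 ω) * Complex.I) ∂μ)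
        - 1 + (s ^ 2 / 2 * ∫ ω, φ n (Z 0 ω) ^ 2 ∂μ : ℝ))) atTop (𝓝 0) := by
      have hlim : Tendsto (fun n : ℕ => |s| ^ 3 * b n * (n * ∫ ω, φ n (Z 0 ω) ^ 2 ∂μ)) atTop
          (𝓝 0) := by
        simpa using (hb0.const_mul (|s| ^ 3)).mul hvar
      refine squeeze_zero_norm' ?_ hlim
      have hsm : Tendsto (fun n => |s| * b n) atTop (𝓝 0) := by simpa using hb0.const_mul |s|
      filter_upwards [hsm.eventually (ge_mem_nhds zero_lt_one)] with n hn
      rw [norm_mul, Complex.norm_natCast]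
      have := norm_integral_cexp_sub_le (μ := μ) (hmj n 0) (fun ω => hb n _) (h0 n) hn
      calc (n : ℝ) * _ ≤ n * (|s| ^ 3 * b n * ∫ ω, φ n (Z 0 ω) ^ 2 ∂μ) := by gcongr
        _ = _ := by ring
    have hB : Tendsto (fun n : ℕ => ((s ^ 2 / 2 * (n * ∫ ω, φ n (Z 0 ω) ^ 2 ∂μ) : ℝ) : ℂ)) atTop
        (𝓝 ((s ^ 2 / 2 * v : ℝ) : ℂ)) :=
      (Complex.continuous_ofReal.tendsto _).comp (hvar.const_mul _)
    convert! hA.sub hB using 2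
    · push_cast
      ring
    · push_cast
      ring
  intro x hx
  let P : ℕ → ProbabilityMeasure ℝ := fun n =>
    ⟨μ.map fun ω => ∑ j ∈ Finset.range n, φ n (Z j ω),
      Measure.isProbabilityMeasure_map (hm n).aemeasurable⟩
  let P0 : ProbabilityMeasure ℝ := ⟨gaussianReal 0 v, inferInstance⟩
  -- Lévy's continuity theorem. The half-lines below have frontier `{x}`, which is null for the
  -- limit.
  have hP : Tendsto P atTop (𝓝 P0) := ProbabilityMeasure.tendsto_of_tendsto_charFun hconv
  constructor
  · have := ProbabilityMeasure.tendsto_measure_of_null_frontier_of_tendsto' hP (E := Iic x)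
      (by rw [frontier_Iic]; exact hx)
    refine this.congr fun n => ?_
    exact Measure.map_apply (hm n) measurableSet_Iic
  · have := ProbabilityMeasure.tendsto_measure_of_null_frontier_of_tendsto' hP (E := Ioi x)
      (by rw [frontier_Ioi]; exact hx)
    refine this.congr fun n => ?_
    exact Measure.map_apply (hm n) measurableSet_Ioi

end CLT

/-! ### Independence of pairs -/

/-- Measurable rectangles form a π-system generating the product σ-algebra. A finite intersection of
rectangle events splits into an `X`-event and a `T`-event, which factor first by independence of the
two sequences and then by independence within each. -/
theorem iIndepFun_prodMk {Ω α β : Type*} [MeasurableSpace Ω] [MeasurableSpace α]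
    [MeasurableSpace β] {μ : Measure Ω} {X : ℕ → Ω → α} {T : ℕ → Ω → β}
    (hXm : ∀ i, Measurable (X i)) (hTm : ∀ i, Measurable (T i))
    (hX : iIndepFun X μ) (hT : iIndepFun T μ)
    (hXT : IndepFun (fun ω i => X i ω) (fun ω i => T i ω) μ) :
    iIndepFun (fun i ω => (X i ω, T i ω)) μ := by
  rw [iIndepFun_iff_iIndep]
  let R : Set (Set (α × β)) := image2 (· ×ˢ ·) {s | MeasurableSet s} {t | MeasurableSet t}
  refine iIndepSets.iIndep (fun i => ((hXm i).prodMk (hTm i)).comap_le)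
    (fun i => preimage (fun ω => (X i ω, T i ω)) '' R) (fun i => ?_) (fun i => ?_) ?_
  · exact isPiSystem_prod.comap _
  · rw [← generateFrom_prod, MeasurableSpace.comap_generateFrom]
  · rw [iIndepSets_iff]
    intro s f hf
    have hf' : ∀ i, ∃ A : Set α, ∃ B : Set β, MeasurableSet A ∧ MeasurableSet B ∧
        (i ∈ s → f i = X i ⁻¹' A ∩ T i ⁻¹' B) := by
      intro i
      by_cases hi : i ∈ s
      · obtain ⟨_, ⟨A, hA, B, hB, rfl⟩, h⟩ := hf i hi
        refine ⟨A, B, hA, hB, fun _ => ?_⟩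
        rw [← h]
        rfl
      · exact ⟨∅, ∅, MeasurableSet.empty, MeasurableSet.empty, fun h => absurd h hi⟩
    choose A B hA hB hfAB using hf'
    have hcross : ∀ u : Finset ℕ, μ ((⋂ i ∈ u, X i ⁻¹' A i) ∩ (⋂ i ∈ u, T i ⁻¹' B i)) =
        μ (⋂ i ∈ u, X i ⁻¹' A i) * μ (⋂ i ∈ u, T i ⁻¹' B i) := by
      intro u
      have h := hXT.measure_inter_preimage_eq_mul (⋂ i ∈ u, (fun x => x i) ⁻¹' A i)
        (⋂ i ∈ u, (fun x => x i) ⁻¹' B i)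
        (Finset.measurableSet_biInter _ fun i _ => measurable_pi_apply i (hA i))
        (Finset.measurableSet_biInter _ fun i _ => measurable_pi_apply i (hB i))
      simp only [preimage_iInter₂] at h
      exact h
    have e1 : (⋂ i ∈ s, f i) = (⋂ i ∈ s, X i ⁻¹' A i) ∩ (⋂ i ∈ s, T i ⁻¹' B i) := by
      ext ω
      simp only [mem_iInter, mem_inter_iff]
      constructor
      · intro h
        exact ⟨fun i hi => ((hfAB i hi) ▸ h i hi).1, fun i hi => ((hfAB i hi) ▸ h i hi).2⟩
      · intro h i hi
        rw [hfAB i hi]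
        exact ⟨h.1 i hi, h.2 i hi⟩
    rw [e1, hcross, hX.measure_inter_preimage_eq_mul _ (fun i _ => hA i),
      hT.measure_inter_preimage_eq_mul _ (fun i _ => hB i), ← Finset.prod_mul_distrib]
    refine Finset.prod_congr rfl fun i hi => ?_
    rw [hfAB i hi]
    -- The singleton case recombines the two factors that belong to index `i`.
    have := hcross {i}
    simpa using this.symm

/-! ### Minimization of the asymptotic mean squared error -/

/-- With `V` and `b` as below, the error is `b c⁴ / 4 + V / c³`, whose stationary point satisfies
`c0 ^ 7 * b = 3 * V`. -/
theorem aMSE_minimizer {k F f g : ℝ → ℝ} {t : ℝ} (hF0 : 0 < F t) (hF1 : F t < 1) (hg : 0 < g t)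
    (hk : 0 < ∫ u, deriv k u ^ 2) (hm : 0 < m2 k) (hq : q f g t ≠ 0) :
    0 < cOpt k F f g t ∧ ∀ c : ℝ, 0 < c → c ≠ cOpt k F f g t →
      aMSE k F f g t (cOpt k F f g t) < aMSE k F f g t c := by
  have hV : 0 < F t * (1 - F t) / g t * ∫ u, deriv k u ^ 2 :=
    mul_pos (div_pos (mul_pos hF0 (by linarith)) hg) hk
  have hb : 0 < m2 k ^ 2 * q f g t ^ 2 := by positivity
  obtain ⟨V, hVdef⟩ : ∃ V, V = F t * (1 - F t) / g t * ∫ u, deriv k u ^ 2 := ⟨_, rfl⟩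
  obtain ⟨b, hbdef⟩ : ∃ b, b = m2 k ^ 2 * q f g t ^ 2 := ⟨_, rfl⟩
  rw [← hVdef] at hV
  rw [← hbdef] at hb
  have hc0 : cOpt k F f g t = (3 * V) ^ (1 / 7 : ℝ) * b ^ (-(1 / 7) : ℝ) := by
    rw [cOpt, ← hbdef, hVdef]
    ring_nf
  have hpos : 0 < cOpt k F f g t := by
    rw [hc0]
    positivity
  obtain ⟨c0, hc0def⟩ : ∃ c0, c0 = cOpt k F f g t := ⟨_, rfl⟩
  have hpow : c0 ^ 7 * b = 3 * V := by
    rw [hc0def, hc0, mul_pow, ← Real.rpow_natCast, ← Real.rpow_natCast, ← Real.rpow_mul (by positivity),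
      ← Real.rpow_mul hb.le]
    norm_num
    rw [Real.rpow_neg_one]
    field_simp
  have hA : ∀ c, 0 < c → aMSE k F f g t c = (3 * b * c ^ 7 + 4 * (c0 ^ 7 * b)) / (12 * c ^ 3) := by
    intro c hc
    rw [hpow, hVdef, hbdef, aMSE, asympMean, asympVar]
    field_simp
    ring
  rw [← hc0def] at hpos ⊢
  refine ⟨hpos, fun c hc hne => ?_⟩
  rw [hA c hc, hA c0 hpos, div_lt_div_iff₀ (by positivity) (by positivity)]
  have hsq : 0 < (c - c0) ^ 2 := by
    have := sub_ne_zero.2 hne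
    positivity
  -- The difference of the cleared fractions is governed by `3 c⁷ - 7 c³ c0⁴ + 4 c0⁷`, which is `(c
  -- - c0)²` times the displayed form with positive coefficients.
  have hkey : 0 < 12 * b * c0 ^ 3 * ((c - c0) ^ 2 * (3 * c ^ 5 + 6 * c ^ 4 * c0 + 9 * c ^ 3 * c0 ^ 2 +
      12 * c ^ 2 * c0 ^ 3 + 8 * c * c0 ^ 4 + 4 * c0 ^ 5)) := by positivity
  nlinarith [hkey]

/-! ### Uniform convergence of monotone functions -/

/-- Pointwise convergence of uniformly bounded monotone functions to a continuous limit is uniform,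
if the total masses converge as well. -/
theorem eventually_abs_sub_lt_of_monotone {ι : Type*} {l : Filter ι} {Y : ι → ℝ → ℝ} {c : ι → ℝ}
    {G : ℝ → ℝ} {m : ℝ} (hY : ∀ i, Monotone (Y i)) (h0 : ∀ i x, 0 ≤ Y i x)
    (h1 : ∀ i x, Y i x ≤ c i) (hG : Continuous G) (hGm : Monotone G)
    (hbot : Tendsto G atBot (𝓝 0)) (htop : Tendsto G atTop (𝓝 m)) (hc : Tendsto c l (𝓝 m))
    (hpt : ∀ x, Tendsto (fun i => Y i x) l (𝓝 (G x))) {ε : ℝ} (hε : 0 < ε) :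
    ∀ᶠ i in l, ∀ x, |Y i x - G x| < ε := by
  have hG0 : ∀ x, 0 ≤ G x := fun x =>
    le_of_tendsto hbot ((eventually_le_atBot x).mono fun y hy => hGm hy)
  have hGle : ∀ x, G x ≤ m := fun x =>
    ge_of_tendsto htop ((eventually_ge_atTop x).mono fun y hy => hGm hy)
  obtain ⟨a, ha⟩ : ∃ a, G a < ε / 2 := (hbot.eventually (gt_mem_nhds (half_pos hε))).exists
  obtain ⟨b, hb⟩ : ∃ b, m - ε / 2 < G b :=
    (htop.eventually (lt_mem_nhds (by linarith : m - ε / 2 < m))).exists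
  -- By monotonicity, the values at `x ± d / 2` trap both functions on the interval between.
  have hloc : TendstoLocallyUniformlyOn Y G l (Icc a b) := by
    rw [Metric.tendstoLocallyUniformlyOn_iff]
    intro e he x _
    have hcx := hG.tendsto x
    obtain ⟨d, hd, hball⟩ := Metric.continuous_iff.1 hG x (e / 4) (by positivity)
    have hp : |G (x + d / 2) - G x| < e / 4 := by
      have := hball (x + d / 2) (by simp [abs_of_pos hd]; linarith)
      simpa [Real.dist_eq] using this
    have hm' : |G (x - d / 2) - G x| < e / 4 := by
      have := hball (x - d / 2) (by simp [abs_of_pos hd]; linarith)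
      simpa [Real.dist_eq] using this
    refine ⟨Ioo (x - d / 2) (x + d / 2), mem_nhdsWithin_of_mem_nhds (Ioo_mem_nhds (by linarith)
      (by linarith)), ?_⟩
    filter_upwards [(hpt (x + d / 2)).eventually (Metric.ball_mem_nhds _ (by positivity : 0 < e / 4)),
      (hpt (x - d / 2)).eventually (Metric.ball_mem_nhds _ (by positivity : 0 < e / 4))]
      with i hi1 hi2 y hy
    rw [Real.dist_eq, abs_lt] at hi1 hi2
    rw [abs_lt] at hp hm'
    rw [Real.dist_eq, abs_lt]
    have y1 := hY i hy.1.le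
    have y2 := hY i hy.2.le
    have g1 := hGm hy.1.le
    have g2 := hGm hy.2.le
    constructor <;> linarith
  have hunif := (tendstoLocallyUniformlyOn_iff_tendstoUniformlyOn_of_compact isCompact_Icc).1 hloc
  filter_upwards [Metric.tendstoUniformlyOn_iff.1 hunif ε hε,
    (hpt a).eventually (gt_mem_nhds ha), (hpt b).eventually (lt_mem_nhds hb),
    hc.eventually (gt_mem_nhds (by linarith : m < m + ε / 2))] with i hi hia hib hic x
  -- Left of `a` both functions lie in `[0, ε / 2)`. Right of `b` both lie within `ε / 2` of `m`,
  -- where the upper bound for `Y` comes from the total mass `c`.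
  rcases lt_or_ge x a with hxa | hxa
  · have := hY i hxa.le
    have := hGm hxa.le
    have := hG0 x
    have := h0 i x
    rw [abs_lt]
    constructor <;> linarith
  rcases le_or_gt x b with hxb | hxb
  · have := hi x ⟨hxa, hxb⟩
    rwa [Real.dist_eq, abs_sub_comm] at this
  · have := hY i hxb.le
    have := hGm hxb.le
    have := hGle x
    have := h1 i x
    rw [abs_lt]
    constructor <;> linarith

/-! ### Slopes of the convex hull of a planar curve -/

/-- The half-plane above the line is convex and contains `S`, hence contains its hull; the line
touches `S` at `(x, y)`. -/
theorem lowerHull_eq_of_support {S : Set (ℝ × ℝ)} {x y r : ℝ} (hmem : (x, y) ∈ S)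
    (h : ∀ p ∈ S, y + r * (p.1 - x) ≤ p.2) : lowerHull S x = y := by
  have hconv : Convex ℝ {p : ℝ × ℝ | y + r * (p.1 - x) ≤ p.2} := by
    intro p hp p' hp' a b ha hb hab
    simp only [mem_ofPred_eq, Prod.fst_add, Prod.snd_add, Prod.smul_fst, Prod.smul_snd,
      smul_eq_mul] at *
    have h1 := mul_le_mul_of_nonneg_left hp ha
    have h2 := mul_le_mul_of_nonneg_left hp' hb
    have h3 : b = 1 - a := by linarith
    subst h3
    nlinarith
  have hsub := convexHull_min h hconv
  refine IsLeast.csInf_eq ⟨subset_convexHull ℝ S hmem, fun z hz => ?_⟩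
  have h1 : y + r * (x - x) ≤ z := hsub hz
  linarith [mul_eq_zero_of_right r (sub_self x)]

/-- Subtracting from `B` the multiple of `A` with the slope at `s` leaves a function whose
derivative at `w` is `a w` times the increment of the slope from `s` to `w`. It is nonpositive
before `s` and nonnegative after, so the minimum is at `s`. -/
theorem slope_support_of_monotoneOn {A B a b : ℝ → ℝ} {l u : ℝ}
    (hA : ∀ s ∈ Icc l u, HasDerivAt A (a s) s) (hB : ∀ s ∈ Icc l u, HasDerivAt B (b s) s)
    (ha : ∀ s ∈ Icc l u, 0 < a s) (hr : MonotoneOn (fun s => b s / a s) (Icc l u))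
    {s v : ℝ} (hs : s ∈ Icc l u) (hv : v ∈ Icc l u) :
    B s + b s / a s * (A v - A s) ≤ B v := by
  have hd : ∀ w ∈ Icc l u, HasDerivAt (fun w => B w - b s / a s * A w)
      (a w * (b w / a w - b s / a s)) w := by
    intro w hw
    convert! (hB w hw).sub ((hA w hw).const_mul (b s / a s)) using 1
    have := (ha w hw).ne'
    field_simp
  rcases le_total s v with hsv | hsv
  · have hsub : Icc s v ⊆ Icc l u := Icc_subset_Icc hs.1 hv.2
    have hm : MonotoneOn (fun w => B w - b s / a s * A w) (Icc s v) := by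
      refine monotoneOn_of_deriv_nonneg (convex_Icc _ _)
        (fun w hw => (hd w (hsub hw)).continuousAt.continuousWithinAt)
        (fun w hw => (hd w (hsub (interior_subset hw))).differentiableAt.differentiableWithinAt) ?_
      intro w hw
      have hw' := interior_subset hw
      rw [(hd w (hsub hw')).deriv]
      exact mul_nonneg (ha w (hsub hw')).le (sub_nonneg.2 (hr hs (hsub hw') hw'.1))
    have := hm (left_mem_Icc.2 hsv) (right_mem_Icc.2 hsv) hsv
    simp only at this
    linarith
  · have hsub : Icc v s ⊆ Icc l u := Icc_subset_Icc hv.1 hs.2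
    have hm : AntitoneOn (fun w => B w - b s / a s * A w) (Icc v s) := by
      refine antitoneOn_of_deriv_nonpos (convex_Icc _ _)
        (fun w hw => (hd w (hsub hw)).continuousAt.continuousWithinAt)
        (fun w hw => (hd w (hsub (interior_subset hw))).differentiableAt.differentiableWithinAt) ?_
      intro w hw
      have hw' := interior_subset hw
      rw [(hd w (hsub hw')).deriv]
      exact mul_nonpos_of_nonneg_of_nonpos (ha w (hsub hw')).le
        (sub_nonpos.2 (hr (hsub hw') hs hw'.2))
    have := hm (left_mem_Icc.2 hsv) (right_mem_Icc.2 hsv) hsv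
    simp only at this
    linarith

/-- If the slope of a planar curve is increasing near `t`, and the curve stays strictly above its
tangent line at `t` away from `t`, then near `t` the right derivative of the lower convex hull is
the slope of the curve. -/
theorem eventually_derivWithin_lowerHull_eq {A B a b : ℝ → ℝ} {t δ τ η C : ℝ}
    (hδ : 0 < δ) (hη : 0 < η) (h0 : 0 ≤ t - δ) (hτ : t + δ ≤ τ)
    (hA : ∀ s ∈ Icc (t - δ) (t + δ), HasDerivAt A (a s) s)
    (hB : ∀ s ∈ Icc (t - δ) (t + δ), HasDerivAt B (b s) s)
    (hac : ContinuousOn a (Icc (t - δ) (t + δ))) (hbc : ContinuousOn b (Icc (t - δ) (t + δ)))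
    (ha : ∀ s ∈ Icc (t - δ) (t + δ), 0 < a s)
    (hr : MonotoneOn (fun s => b s / a s) (Icc (t - δ) (t + δ)))
    (hC : ∀ u ∈ Icc 0 τ, |A u| ≤ C)
    (hsep : ∀ u ∈ Icc 0 τ, u ∉ Icc (t - δ) (t + δ) → η ≤ B u - B t - b t / a t * (A u - A t)) :
    ∀ᶠ s in 𝓝 t, derivWithin (lowerHull ((fun u => (A u, B u)) '' Icc 0 τ)) (Ioi (A s)) (A s) =
      b s / a s := by
  have htm : t ∈ Icc (t - δ) (t + δ) := ⟨by linarith, by linarith⟩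
  have hnt : Icc (t - δ) (t + δ) ∈ 𝓝 t := Icc_mem_nhds (by linarith) (by linarith)
  have hcr : ContinuousAt (fun s => b s / a s) t :=
    (hbc.continuousAt hnt).div (hac.continuousAt hnt) (ha t htm).ne'
  have hC0 : 0 ≤ C := (abs_nonneg _).trans (hC t ⟨by linarith, by linarith⟩)
  -- Inside the window the monotone slope suffices. Outside, the line at `s` differs from the line
  -- at `t` by at most `C` times the change of slope plus the change of intercept; both vanish as `s
  -- → t`, so the gap `η` absorbs them.
  have hsupp : ∀ᶠ s in 𝓝 t, ∀ u ∈ Icc 0 τ, B s + b s / a s * (A u - A s) ≤ B u := by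
    have e1 : Tendsto (fun s => |b s / a s - b t / a t| * C + |(B s - b s / a s * A s) -
        (B t - b t / a t * A t)|) (𝓝 t) (𝓝 0) := by
      have c1 : ContinuousAt (fun s => |b s / a s - b t / a t| * C + |(B s - b s / a s * A s) -
        (B t - b t / a t * A t)|) t :=
        ((hcr.sub continuousAt_const).abs.mul continuousAt_const).add
          ((((hB t htm).continuousAt.sub (hcr.mul (hA t htm).continuousAt)).sub
            continuousAt_const).abs)
      simpa [ContinuousAt] using c1
    filter_upwards [e1.eventually (gt_mem_nhds hη), hnt] with s hs hsm u hu
    by_cases hum : u ∈ Icc (t - δ) (t + δ)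
    · exact slope_support_of_monotoneOn hA hB ha hr hsm hum
    · have h1 := hsep u hu hum
      have h2 := neg_abs_le ((B s - b s / a s * A s) - (B t - b t / a t * A t))
      have h2' := le_abs_self ((B s - b s / a s * A s) - (B t - b t / a t * A t))
      have h3 : (b s / a s - b t / a t) * A u ≤ |b s / a s - b t / a t| * C := by
        refine (le_abs_self _).trans ?_
        rw [abs_mul]
        exact mul_le_mul_of_nonneg_left (hC u hu) (abs_nonneg _)
      linarith
  have hL : ∀ᶠ s in 𝓝 t, lowerHull ((fun u => (A u, B u)) '' Icc 0 τ) (A s) = B s := by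
    filter_upwards [hsupp, hnt] with s hs hsm
    refine lowerHull_eq_of_support (r := b s / a s) (mem_image_of_mem _ ⟨by linarith [hsm.1], by linarith [hsm.2]⟩) ?_
    rintro _ ⟨u, hu, rfl⟩
    exact hs u hu
  have hint : Ioo (t - δ) (t + δ) ∈ 𝓝 t := Ioo_mem_nhds (by linarith) (by linarith)
  filter_upwards [hL.eventually_nhds, hint] with s hs hsm
  have hns : Icc (t - δ) (t + δ) ∈ 𝓝 s := Icc_mem_nhds hsm.1 hsm.2
  have hsm' := Ioo_subset_Icc_self hsm
  -- Around `A s` the hull is `B` composed with the local inverse of `A`, so it even has a two-sided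
  -- derivative.
  have hstrict : HasStrictDerivAt A (a s) s :=
    hasStrictDerivAt_of_hasDerivAt_of_continuousAt
      (by filter_upwards [hns] with w hw using hA w hw) (hac.continuousAt hns)
  have hne := (ha s hsm').ne'
  have hinv := hstrict.to_localInverse hne
  have himg : hstrict.localInverse A (a s) s hne (A s) = s :=
    (hstrict.eventually_left_inverse hne).self_of_nhds
  have hlim : Tendsto (hstrict.localInverse A (a s) s hne) (𝓝 (A s)) (𝓝 s) := by
    have := hinv.hasDerivAt.continuousAt.tendsto
    rwa [himg] at this
  have hBs : HasDerivAt (B ∘ hstrict.localInverse A (a s) s hne) (b s * (a s)⁻¹) (A s) := by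
    refine HasDerivAt.comp (A s) ?_ hinv.hasDerivAt
    rw [himg]
    exact hB s hsm'
  have hfin : HasDerivAt (lowerHull ((fun u => (A u, B u)) '' Icc 0 τ)) (b s * (a s)⁻¹) (A s) := by
    refine hBs.congr_of_eventuallyEq ?_
    have hright := hstrict.eventually_right_inverse hne
    filter_upwards [hright, hlim.eventually hs] with y hy1 hy2
    rw [hy1] at hy2
    exact hy2
  rw [hfin.hasDerivWithinAt.derivWithin (uniqueDiffWithinAt_Ioi _), div_eq_mul_inv]

/-! ### Kernels and their moments -/

/-- A continuously differentiable function vanishing outside `[-1, 1]`. -/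
structure Weight (w : ℝ → ℝ) : Prop where
  contDiff : ContDiff ℝ 1 w
  zero : ∀ v, 1 < |v| → w v = 0

theorem integral_kernel_comp (w φ : ℝ → ℝ) (s : ℝ) {h : ℝ} (hh : 0 < h) :
    ∫ u, w ((s - u) / h) * φ u = h * ∫ v, w v * φ (s - h * v) := by
  have h1 := integral_sub_left_eq_self (fun u => w (u / h) * φ (s - u)) volume s
  simp only [sub_sub_cancel] at h1
  rw [h1]
  have h2 := Measure.integral_comp_mul_left (fun u => w (u / h) * φ (s - u)) h
  have h3 : (fun v => w (h * v / h) * φ (s - h * v)) = fun v => w v * φ (s - h * v) := by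
    ext v
    rw [mul_div_cancel_left₀ _ hh.ne']
  rw [h3, abs_of_pos (inv_pos.2 hh), smul_eq_mul] at h2
  rw [h2]
  field_simp

namespace Weight

variable {w : ℝ → ℝ} (hw : Weight w)
include hw

theorem continuous : Continuous w := hw.contDiff.continuous

theorem hasCompactSupport : HasCompactSupport w := by
  refine HasCompactSupport.intro (isCompact_Icc (a := -1) (b := 1)) fun v hv => hw.zero v ?_
  by_contra h
  exact hv (abs_le.1 (not_lt.1 h))

theorem exists_bound : ∃ B, 0 < B ∧ ∀ v, |w v| ≤ B := by
  obtain ⟨C, hC⟩ := hw.hasCompactSupport.exists_bound_of_continuous hw.continuous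
  exact ⟨|C| + 1, by positivity, fun v => (hC v).trans (by linarith [le_abs_self C])⟩

theorem exists_lipschitz : ∃ L, 0 < L ∧ ∀ v v', |w v - w v'| ≤ L * |v - v'| := by
  obtain ⟨C, hC⟩ := hw.contDiff.lipschitzWith_of_hasCompactSupport hw.hasCompactSupport one_ne_zero
  refine ⟨C + 1, by positivity, fun v v' => ?_⟩
  have := hC.dist_le_mul v v'
  rw [Real.dist_eq, Real.dist_eq] at this
  nlinarith [abs_nonneg (v - v')]

theorem mul_continuous_integrable {p : ℝ → ℝ} (hp : Continuous p) :
    Integrable fun v => w v * p v :=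
  (hw.continuous.mul hp).integrable_of_hasCompactSupport hw.hasCompactSupport.mul_right

theorem integrable : Integrable w :=
  hw.continuous.integrable_of_hasCompactSupport hw.hasCompactSupport

theorem mul_integrable {φ : ℝ → ℝ} (hφ : Integrable φ) : Integrable fun v => w v * φ v := by
  obtain ⟨B, _, hB⟩ := hw.exists_bound
  exact hφ.bdd_mul hw.continuous.aestronglyMeasurable (ae_of_all _ hB)

theorem integrable_shift {φ : ℝ → ℝ} (hφ : Integrable φ) (s : ℝ) {h : ℝ} (hh : h ≠ 0) :
    Integrable fun v => w v * φ (s - h * v) := by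
  refine hw.mul_integrable ?_
  have h1 : Integrable fun u => φ (s - u) := hφ.comp_sub_left s
  exact h1.comp_mul_left' hh

/-- Smoothing a function which is close to `p` on the range of the kernel. -/
theorem abs_integral_sub_le {φ p : ℝ → ℝ} (hφ : Integrable φ) {s h e : ℝ} (hh : h ≠ 0)
    (hp : Continuous p) (hφp : ∀ v, |v| ≤ 1 → |φ (s - h * v) - p v| ≤ e) :
    |(∫ v, w v * φ (s - h * v)) - ∫ v, w v * p v| ≤ e * ∫ v, |w v| := by
  rw [← integral_sub (hw.integrable_shift hφ s hh) (hw.mul_continuous_integrable hp),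
    ← integral_const_mul, ← Real.norm_eq_abs]
  refine norm_integral_le_of_norm_le (hw.integrable.abs.const_mul e) (ae_of_all _ fun v => ?_)
  rw [← mul_sub, norm_mul, mul_comm, Real.norm_eq_abs, Real.norm_eq_abs]
  rcases le_or_gt |v| 1 with hv | hv
  · exact mul_le_mul_of_nonneg_right (hφp v hv) (abs_nonneg _)
  · rw [hw.zero v hv]
    simp

end Weight

theorem integral_mul_sq (k : ℝ → ℝ) : ∫ v, k v * v ^ 2 = m2 k := by
  rw [m2]
  simp_rw [mul_comm]

namespace ConditionK

variable {k : ℝ → ℝ} (hk : ConditionK k)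
include hk

theorem eq_zero {v : ℝ} (hv : 1 < |v|) : k v = 0 := by
  refine image_eq_zero_of_notMem_tsupport ?_
  rw [hk.support_eq]
  exact fun h => absurd (abs_le.2 h) (not_le.2 hv)

theorem weight : Weight k := ⟨hk.smooth.of_le (by norm_num), fun _ hv => hk.eq_zero hv⟩

/-- Second-order smoothness of `k` makes `deriv k` a `Weight`, hence Lipschitz, as the grid argument
for derivative estimates requires. -/
theorem weight_deriv : Weight (deriv k) := by
  refine ⟨?_, fun v hv => ?_⟩
  · have h2 : ContDiff ℝ (1 + 1) k := by
      have := hk.smooth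
      norm_num
      exact this
    exact (contDiff_succ_iff_deriv.1 h2).2.2
  · have : k =ᶠ[𝓝 v] fun _ => 0 := by
      filter_upwards [(isOpen_lt continuous_const continuous_abs).mem_nhds hv] with u hu
      exact hk.eq_zero hu
    rw [this.deriv_eq]
    simp

theorem hasDerivAt (v : ℝ) : HasDerivAt k (deriv k v) v :=
  (hk.smooth.differentiable (by norm_num)).differentiableAt.hasDerivAt

theorem integral_mul_id : ∫ v, k v * v = 0 := by
  have h := integral_neg_eq_self (fun v => k v * v) volume
  simp only [hk.symm, mul_neg] at h
  rw [integral_neg] at h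
  linarith

/-- Integration by parts without boundary terms. At `j = 0` the truncated exponent `j - 1` is
harmless, being multiplied by zero. -/
theorem integral_deriv_mul_pow (j : ℕ) :
    ∫ v, deriv k v * v ^ j = -(j * ∫ v, k v * v ^ (j - 1)) := by
  have hd : ∀ v, HasDerivAt (fun v => k v * v ^ j)
      (deriv k v * v ^ j + k v * (j * v ^ (j - 1))) v := fun v =>
    (hk.hasDerivAt v).mul (hasDerivAt_pow j v)
  have i1 : Integrable fun v => deriv k v * v ^ j :=
    hk.weight_deriv.mul_continuous_integrable (by fun_prop)
  have i2 : Integrable fun v => k v * (j * v ^ (j - 1)) :=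
    hk.weight.mul_continuous_integrable (by fun_prop)
  have h := integral_eq_zero_of_hasDerivAt_of_integrable hd (i1.add i2)
    (hk.weight.mul_continuous_integrable (by fun_prop))
  rw [integral_add i1 i2] at h
  rw [eq_neg_of_add_eq_zero_left h, ← integral_const_mul]
  congr 2
  ext v
  ring

theorem integral_deriv : ∫ v, deriv k v = 0 := by
  simpa using hk.integral_deriv_mul_pow 0

theorem integral_deriv_mul_id : ∫ v, deriv k v * v = -1 := by
  simpa [hk.integral_eq_one] using hk.integral_deriv_mul_pow 1

theorem integral_deriv_mul_sq : ∫ v, deriv k v * v ^ 2 = 0 := by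
  simpa [hk.integral_mul_id] using hk.integral_deriv_mul_pow 2

theorem integral_deriv_mul_cube : ∫ v, deriv k v * v ^ 3 = -(3 * m2 k) := by
  simpa [integral_mul_sq] using hk.integral_deriv_mul_pow 3

theorem exists_pos : ∃ v, v ≠ 0 ∧ 0 < k v := by
  by_contra! h
  have h0 : ∀ v, v ≠ 0 → k v = 0 := fun v hv => le_antisymm (h v hv) (hk.nonneg v)
  have : ∫ u, k u = 0 := by
    refine integral_eq_zero_of_ae ?_
    have h1 : ∀ᵐ u : ℝ, u ≠ 0 := by simp [ae_iff]
    filter_upwards [h1] with u hu using h0 u hu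
  rw [hk.integral_eq_one] at this
  exact one_ne_zero this

theorem m2_pos : 0 < m2 k := by
  rw [← integral_mul_sq]
  obtain ⟨v, hv, hkv⟩ := hk.exists_pos
  exact Continuous.integral_pos_of_hasCompactSupport_nonneg_nonzero
    (x := v) (hk.weight.continuous.mul (by fun_prop)) hk.weight.hasCompactSupport.mul_right
    (fun u => mul_nonneg (hk.nonneg u) (sq_nonneg u)) (by positivity)

theorem integral_deriv_sq_pos : 0 < ∫ u, deriv k u ^ 2 := by
  have hne : ∃ v, deriv k v ≠ 0 := by
    by_contra! h
    have := hk.integral_deriv_mul_id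
    simp [h] at this
  obtain ⟨v, hv⟩ := hne
  have hc := hk.weight_deriv.continuous
  refine Continuous.integral_pos_of_hasCompactSupport_nonneg_nonzero
    (x := v) (hc.pow 2) ?_ (fun u => sq_nonneg _) (by positivity)
  simp only [sq]
  exact hk.weight_deriv.hasCompactSupport.mul_right

end ConditionK

/-! ### Taylor expansions with Peano remainder -/

/-- The mean value inequality on the segment from `t` to `x` integrates a Peano remainder and raises
its order by one. -/
theorem isLittleO_of_hasDerivAt {R R' : ℝ → ℝ} {t : ℝ} {n : ℕ}
    (hR : ∀ᶠ x in 𝓝 t, HasDerivAt R (R' x) x) (h0 : R t = 0)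
    (hR' : R' =o[𝓝 t] fun x => (x - t) ^ n) : R =o[𝓝 t] fun x => (x - t) ^ (n + 1) := by
  rw [Asymptotics.isLittleO_iff] at hR' ⊢
  intro e he
  obtain ⟨r, hr, hball⟩ := Metric.eventually_nhds_iff_ball.1 (hR.and (hR' he))
  filter_upwards [Metric.ball_mem_nhds t hr] with x hx
  have hsub : ∀ y ∈ uIcc t x, y ∈ Metric.ball t r := by
    intro y hy
    rw [Metric.mem_ball, Real.dist_eq] at hx ⊢
    exact (abs_sub_left_of_mem_uIcc hy).trans_lt hx
  have h := (convex_uIcc t x).norm_image_sub_le_of_norm_hasDerivWithin_le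
    (fun y hy => (hball y (hsub y hy)).1.hasDerivWithinAt) (C := e * |x - t| ^ n)
    (fun y hy => ?_) left_mem_uIcc right_mem_uIcc
  · rw [h0, sub_zero] at h
    refine h.trans (le_of_eq ?_)
    rw [norm_pow, Real.norm_eq_abs]
    ring
  · refine (hball y (hsub y hy)).2.trans ?_
    rw [norm_pow, Real.norm_eq_abs]
    exact mul_le_mul_of_nonneg_left
      (pow_le_pow_left₀ (abs_nonneg _) (abs_sub_left_of_mem_uIcc hy) n) he.le

/-- `φ₁` and `φ₂` are the first two derivatives of `φ` near `t`, and `c₃` is the third one at `t`. -/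
structure Jet (φ φ₁ φ₂ : ℝ → ℝ) (c₃ t : ℝ) : Prop where
  one : ∀ᶠ x in 𝓝 t, HasDerivAt φ (φ₁ x) x
  two : ∀ᶠ x in 𝓝 t, HasDerivAt φ₁ (φ₂ x) x
  three : HasDerivAt φ₂ c₃ t

namespace Jet

variable {φ φ₁ φ₂ ψ ψ₁ ψ₂ : ℝ → ℝ} {c₃ d₃ t : ℝ}

theorem mul (h : Jet φ φ₁ φ₂ c₃ t) (h' : Jet ψ ψ₁ ψ₂ d₃ t) :
    Jet (fun x => φ x * ψ x) (fun x => φ₁ x * ψ x + φ x * ψ₁ x)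
      (fun x => φ₂ x * ψ x + 2 * (φ₁ x * ψ₁ x) + φ x * ψ₂ x)
      (c₃ * ψ t + 3 * (φ₂ t * ψ₁ t) + 3 * (φ₁ t * ψ₂ t) + φ t * d₃) t where
  one := by
    filter_upwards [h.one, h'.one] with x h1 h1' using h1.mul h1'
  two := by
    filter_upwards [h.one, h'.one, h.two, h'.two] with x h1 h1' h2 h2'
    convert! (h2.mul h1').add (h1.mul h2') using 1
    ring
  three := by
    have h1 := h.one.self_of_nhds
    have h2 := h.two.self_of_nhds
    have h1' := h'.one.self_of_nhds
    have h2' := h'.two.self_of_nhds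
    convert! ((h.three.mul h1').add ((h2.mul h2').const_mul 2)).add (h1.mul h'.three) using 1
    ring

theorem const_add_mul (h : Jet φ φ₁ φ₂ c₃ t) (a d : ℝ) :
    Jet (fun x => a + d * φ x) (fun x => d * φ₁ x) (fun x => d * φ₂ x) (d * c₃) t where
  one := by
    filter_upwards [h.one] with x h1 using (h1.const_mul d).const_add a
  two := by
    filter_upwards [h.two] with x h1 using h1.const_mul d
  three := h.three.const_mul d

/-- Differentiability of `φ₂` at `t` is a first-order Peano expansion; integrating it twice gives
the third-order one. The signs alternate because the kernel moves the argument to `t - x`. -/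
theorem taylor_three (h : Jet φ φ₁ φ₂ c₃ t) :
    (fun x => φ (t - x) - (φ t - φ₁ t * x + φ₂ t / 2 * x ^ 2 - c₃ / 6 * x ^ 3)) =o[𝓝 0]
      fun x => x ^ 3 := by
  have h2 : (fun x => φ₂ x - φ₂ t - c₃ * (x - t)) =o[𝓝 t] fun x => (x - t) ^ 1 := by
    have := hasDerivAt_iff_isLittleO.1 h.three
    simpa [smul_eq_mul, mul_comm] using this
  have h1 := isLittleO_of_hasDerivAt (R := fun x => φ₁ x - φ₁ t - φ₂ t * (x - t) -
      c₃ / 2 * (x - t) ^ 2) (t := t) (by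
    filter_upwards [h.two] with x hx
    have e1 : HasDerivAt (fun x : ℝ => x - t) 1 x := (hasDerivAt_id x).sub_const t
    convert! ((hx.sub_const (φ₁ t)).sub (e1.const_mul (φ₂ t))).sub
      ((e1.pow 2).const_mul (c₃ / 2)) using 1
    simp
    ring) (by simp) h2
  have h0 := isLittleO_of_hasDerivAt (R := fun x => φ x - φ t - φ₁ t * (x - t) -
      φ₂ t / 2 * (x - t) ^ 2 - c₃ / 6 * (x - t) ^ 3) (t := t) (by
    filter_upwards [h.one] with x hx
    have e1 : HasDerivAt (fun x : ℝ => x - t) 1 x := (hasDerivAt_id x).sub_const t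
    convert! (((hx.sub_const (φ t)).sub (e1.const_mul (φ₁ t))).sub
      ((e1.pow 2).const_mul (φ₂ t / 2))).sub ((e1.pow 3).const_mul (c₃ / 6)) using 1
    simp
    ring) (by simp) h1
  have hlim : Tendsto (fun x : ℝ => t - x) (𝓝 0) (𝓝 t) := by
    have : ContinuousAt (fun x : ℝ => t - x) 0 := by fun_prop
    simpa [ContinuousAt] using this
  have h3 := h0.comp_tendsto hlim
  refine (h3.congr (fun x => ?_) (fun x => rfl)).trans_isBigO ?_
  · simp only [Function.comp]
    ring
  · refine Asymptotics.IsBigO.of_bound 1 (Eventually.of_forall fun x => ?_)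
    simp

theorem taylor_two (h : Jet φ φ₁ φ₂ c₃ t) :
    (fun x => φ (t - x) - (φ t - φ₁ t * x + φ₂ t / 2 * x ^ 2)) =o[𝓝 0] fun x => x ^ 2 := by
  have h32 : (fun x : ℝ => x ^ 3) =o[𝓝 0] fun x => x ^ 2 :=
    Asymptotics.isLittleO_pow_pow (by norm_num)
  have h1 := (h.taylor_three.trans h32).sub (h32.const_mul_left (c₃ / 6))
  refine h1.congr_left fun x => ?_
  ring

/-- Near `t` the linear Taylor polynomial has a uniformly quadratic error. -/
theorem exists_quadratic_bound (h : Jet φ φ₁ φ₂ c₃ t) :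
    ∃ ρ > 0, ∃ C > 0, ∀ s x, |s - t| ≤ ρ → |x| ≤ ρ →
      |φ (s - x) - (φ s - φ₁ s * x)| ≤ C * x ^ 2 := by
  have hb : ∀ᶠ x in 𝓝 t, |φ₂ x| < |φ₂ t| + 1 :=
    h.three.continuousAt.abs.eventually (gt_mem_nhds (by linarith))
  obtain ⟨r, hr, hball⟩ := Metric.eventually_nhds_iff_ball.1 ((h.one.and h.two).and hb)
  -- With `s` and the shift each within `r / 3`, the whole segment stays inside the ball of radius
  -- `r`.
  refine ⟨r / 3, by positivity, |φ₂ t| + 1, by positivity, fun s x hs hx => ?_⟩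
  have hmem : ∀ y ∈ uIcc s (s - x), y ∈ Metric.ball t r := by
    intro y hy
    have := abs_sub_left_of_mem_uIcc hy
    rw [sub_sub_cancel_left, abs_neg] at this
    rw [Metric.mem_ball, Real.dist_eq]
    calc |y - t| ≤ |y - s| + |s - t| := abs_sub_le _ _ _
      _ < r := by linarith
  have hφ₁ : ∀ y ∈ uIcc s (s - x), |φ₁ y - φ₁ s| ≤ (|φ₂ t| + 1) * |x| := by
    intro y hy
    have h1 := (convex_uIcc s (s - x)).norm_image_sub_le_of_norm_hasDerivWithin_le
      (fun z hz => (hball z (hmem z hz)).1.2.hasDerivWithinAt)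
      (fun z hz => (hball z (hmem z hz)).2.le) left_mem_uIcc hy
    refine h1.trans ?_
    have := abs_sub_left_of_mem_uIcc hy
    rw [sub_sub_cancel_left, abs_neg] at this
    gcongr
    exact this
  have h2 := (convex_uIcc s (s - x)).norm_image_sub_le_of_norm_hasDerivWithin_le
    (f := fun y => φ y - φ₁ s * y) (f' := fun y => φ₁ y - φ₁ s * 1)
    (fun z hz => ((hball z (hmem z hz)).1.1.sub
      ((hasDerivAt_id z).const_mul (φ₁ s))).hasDerivWithinAt)
    (C := (|φ₂ t| + 1) * |x|) (fun z hz => by rw [mul_one]; exact hφ₁ z hz)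
    left_mem_uIcc right_mem_uIcc
  rw [sub_sub_cancel_left, norm_neg, Real.norm_eq_abs, Real.norm_eq_abs] at h2
  rw [← sq_abs x]
  calc _ = |φ (s - x) - φ₁ s * (s - x) - (φ s - φ₁ s * s)| := by
        congr 1
        ring
    _ ≤ _ := h2
    _ = _ := by ring

end Jet

/-! ### Smoothing bias -/

namespace ConditionK

variable {k : ℝ → ℝ} (hk : ConditionK k)
include hk

theorem integral_mul_linear (a b : ℝ) : ∫ v, k v * (a - b * v) = a := by
  have i1 : Integrable fun v => k v * v := hk.weight.mul_continuous_integrable continuous_id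
  have e : ∀ v, k v * (a - b * v) = a * k v - b * (k v * v) := fun v => by ring
  simp_rw [e]
  rw [integral_sub (hk.weight.integrable.const_mul a) (i1.const_mul b), integral_const_mul,
    integral_const_mul, hk.integral_eq_one, hk.integral_mul_id]
  ring

theorem integral_mul_quadratic (a b c : ℝ) :
    ∫ v, k v * (a - b * v + c * v ^ 2) = a + c * m2 k := by
  have i1 : Integrable fun v => k v * (a - b * v) :=
    hk.weight.mul_continuous_integrable (by fun_prop)
  have i2 : Integrable fun v => k v * v ^ 2 := hk.weight.mul_continuous_integrable (by fun_prop)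
  have e : ∀ v, k v * (a - b * v + c * v ^ 2) = k v * (a - b * v) + c * (k v * v ^ 2) :=
    fun v => by ring
  simp_rw [e]
  rw [integral_add i1 (i2.const_mul c), hk.integral_mul_linear, integral_const_mul,
    CurrentStatus.integral_mul_sq]

theorem integral_deriv_mul_linear (a b : ℝ) : ∫ v, deriv k v * (a - b * v) = b := by
  have i1 : Integrable fun v => deriv k v * v :=
    hk.weight_deriv.mul_continuous_integrable continuous_id
  have e : ∀ v, deriv k v * (a - b * v) = a * deriv k v - b * (deriv k v * v) := fun v => by ring
  simp_rw [e]
  rw [integral_sub (hk.weight_deriv.integrable.const_mul a) (i1.const_mul b), integral_const_mul,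
    integral_const_mul, hk.integral_deriv, hk.integral_deriv_mul_id]
  ring

theorem integral_deriv_mul_cubic (a b c d : ℝ) :
    ∫ v, deriv k v * (a - b * v + c * v ^ 2 - d * v ^ 3) = b + 3 * d * m2 k := by
  have i1 : Integrable fun v => deriv k v * (a - b * v) :=
    hk.weight_deriv.mul_continuous_integrable (by fun_prop)
  have i2 : Integrable fun v => deriv k v * v ^ 2 :=
    hk.weight_deriv.mul_continuous_integrable (by fun_prop)
  have i3 : Integrable fun v => deriv k v * v ^ 3 :=
    hk.weight_deriv.mul_continuous_integrable (by fun_prop)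
  have e : ∀ v, deriv k v * (a - b * v + c * v ^ 2 - d * v ^ 3) =
      (deriv k v * (a - b * v) + c * (deriv k v * v ^ 2)) - d * (deriv k v * v ^ 3) :=
    fun v => by ring
  simp_rw [e]
  have i4 : Integrable fun v => deriv k v * (a - b * v) + c * (deriv k v * v ^ 2) :=
    i1.add (i2.const_mul c)
  rw [integral_sub i4 (i3.const_mul d), integral_add i1 (i2.const_mul c),
    hk.integral_deriv_mul_linear, integral_const_mul, integral_const_mul,
    hk.integral_deriv_mul_sq, hk.integral_deriv_mul_cube]
  ring

variable {φ φ₁ φ₂ : ℝ → ℝ} {c₃ t : ℝ}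

/-- `k` reproduces the value and `k'`, after division by `h`, the slope of the linear Taylor
polynomial at `s`. Uniformity in `s` is bought with cruder rates than the pointwise expansions
below. -/
theorem exists_uniform_bias_bound (hφ : Integrable φ) (hj : Jet φ φ₁ φ₂ c₃ t) :
    ∃ ρ > 0, ∃ C > 0, ∀ s h, |s - t| ≤ ρ → 0 < h → h ≤ ρ →
      |(∫ v, k v * φ (s - h * v)) - φ s| ≤ C * h ^ 2 ∧
      |h⁻¹ * (∫ v, deriv k v * φ (s - h * v)) - φ₁ s| ≤ C * h := by
  obtain ⟨ρ, hρ, C, hC, hb⟩ := hj.exists_quadratic_bound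
  refine ⟨ρ, hρ, C * (∫ v, |k v|) + C * (∫ v, |deriv k v|) + 1, by positivity,
    fun s h hs hh hhρ => ?_⟩
  have hx : ∀ v, |v| ≤ 1 → |φ (s - h * v) - (φ s - (φ₁ s * h) * v)| ≤ C * h ^ 2 := by
    intro v hv
    have hhv : |h * v| ≤ h := by
      rw [abs_mul, abs_of_pos hh]
      exact mul_le_of_le_one_right hh.le hv
    have := hb s (h * v) hs (hhv.trans hhρ)
    rw [mul_assoc]
    refine this.trans (mul_le_mul_of_nonneg_left ?_ hC.le)
    exact sq_le_sq' (by linarith [(abs_le.1 hhv).1]) (abs_le.1 hhv).2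
  have h1 := hk.weight.abs_integral_sub_le hφ hh.ne' (by fun_prop) hx
  have h2 := hk.weight_deriv.abs_integral_sub_le hφ hh.ne' (by fun_prop) hx
  rw [hk.integral_mul_linear] at h1
  rw [hk.integral_deriv_mul_linear] at h2
  have n1 : 0 ≤ ∫ v, |k v| := integral_nonneg fun _ => abs_nonneg _
  have n2 : 0 ≤ ∫ v, |deriv k v| := integral_nonneg fun _ => abs_nonneg _
  have n3 := mul_nonneg hC.le n1
  have n4 := mul_nonneg hC.le n2
  constructor
  · refine h1.trans ?_
    have : 0 ≤ h ^ 2 := sq_nonneg h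
    nlinarith
  · have e : h⁻¹ * (∫ v, deriv k v * φ (s - h * v)) - φ₁ s =
        h⁻¹ * ((∫ v, deriv k v * φ (s - h * v)) - φ₁ s * h) := by
      field_simp
    rw [e, abs_mul, abs_of_pos (inv_pos.2 hh)]
    calc _ ≤ h⁻¹ * (C * h ^ 2 * ∫ v, |deriv k v|) := by gcongr
      _ = (C * ∫ v, |deriv k v|) * h := by field_simp
      _ ≤ _ := by nlinarith

/-- Symmetry of `k` kills the linear term, so the quadratic one is leading. -/
theorem tendsto_bias (hφ : Integrable φ) (hj : Jet φ φ₁ φ₂ c₃ t) {h : ℕ → ℝ}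
    (hh : ∀ᶠ n in atTop, 0 < h n) (h0 : Tendsto h atTop (𝓝 0)) :
    Tendsto (fun n => (h n ^ 2)⁻¹ * ((∫ v, k v * φ (t - h n * v)) - φ t)) atTop
      (𝓝 (m2 k / 2 * φ₂ t)) := by
  rw [Metric.tendsto_nhds]
  intro ε hε
  have n1 : 0 ≤ ∫ v, |k v| := integral_nonneg fun _ => abs_nonneg _
  obtain ⟨e, he, hee⟩ : ∃ e > 0, e * (∫ v, |k v|) < ε :=
    -- The added `1` makes the denominator visibly positive and the final inequality strict.
    ⟨ε / ((∫ v, |k v|) + 1), by positivity, by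
      rw [div_mul_eq_mul_div, div_lt_iff₀ (by positivity)]
      nlinarith⟩
  have hT := (Asymptotics.isLittleO_iff.1 hj.taylor_two) he
  obtain ⟨r, hr, hball⟩ := Metric.eventually_nhds_iff_ball.1 hT
  filter_upwards [hh, h0.eventually (gt_mem_nhds hr)] with n hn hnr
  have hx : ∀ v, |v| ≤ 1 → |φ (t - h n * v) - (φ t - (φ₁ t * h n) * v +
      (φ₂ t / 2 * h n ^ 2) * v ^ 2)| ≤ e * h n ^ 2 := by
    intro v hv
    have hhv : |h n * v| ≤ h n := by
      rw [abs_mul, abs_of_pos hn]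
      exact mul_le_of_le_one_right hn.le hv
    have := hball (h n * v) (by simpa [Real.dist_eq] using hhv.trans_lt hnr)
    rw [Real.norm_eq_abs, norm_pow, Real.norm_eq_abs] at this
    calc _ = |φ (t - h n * v) - (φ t - φ₁ t * (h n * v) + φ₂ t / 2 * (h n * v) ^ 2)| := by
          congr 1
          ring
      _ ≤ e * |h n * v| ^ 2 := this
      _ ≤ _ := by gcongr
  have h1 := hk.weight.abs_integral_sub_le hφ hn.ne' (by fun_prop) hx
  rw [hk.integral_mul_quadratic] at h1
  rw [Real.dist_eq]
  have e1 : (h n ^ 2)⁻¹ * ((∫ v, k v * φ (t - h n * v)) - φ t) - m2 k / 2 * φ₂ t =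
      (h n ^ 2)⁻¹ * ((∫ v, k v * φ (t - h n * v)) - (φ t + φ₂ t / 2 * h n ^ 2 * m2 k)) := by
    field_simp
    ring
  rw [e1, abs_mul, abs_of_pos (by positivity : 0 < (h n ^ 2)⁻¹)]
  calc _ ≤ (h n ^ 2)⁻¹ * (e * h n ^ 2 * ∫ v, |k v|) := by gcongr
    _ = e * ∫ v, |k v| := by field_simp
    _ < ε := hee

/-- `k'` annihilates constants and squares; the cubic term `-c₃ / 6` meets the third moment `-3 m₂`
of `k'`. -/
theorem tendsto_bias_deriv (hφ : Integrable φ) (hj : Jet φ φ₁ φ₂ c₃ t) {h : ℕ → ℝ}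
    (hh : ∀ᶠ n in atTop, 0 < h n) (h0 : Tendsto h atTop (𝓝 0)) :
    Tendsto (fun n => (h n ^ 2)⁻¹ * ((h n)⁻¹ * (∫ v, deriv k v * φ (t - h n * v)) - φ₁ t)) atTop
      (𝓝 (m2 k / 2 * c₃)) := by
  rw [Metric.tendsto_nhds]
  intro ε hε
  have n1 : 0 ≤ ∫ v, |deriv k v| := integral_nonneg fun _ => abs_nonneg _
  obtain ⟨e, he, hee⟩ : ∃ e > 0, e * (∫ v, |deriv k v|) < ε :=
    ⟨ε / ((∫ v, |deriv k v|) + 1), by positivity, by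
      rw [div_mul_eq_mul_div, div_lt_iff₀ (by positivity)]
      nlinarith⟩
  have hT := (Asymptotics.isLittleO_iff.1 hj.taylor_three) he
  obtain ⟨r, hr, hball⟩ := Metric.eventually_nhds_iff_ball.1 hT
  filter_upwards [hh, h0.eventually (gt_mem_nhds hr)] with n hn hnr
  have hx : ∀ v, |v| ≤ 1 → |φ (t - h n * v) - (φ t - (φ₁ t * h n) * v +
      (φ₂ t / 2 * h n ^ 2) * v ^ 2 - (c₃ / 6 * h n ^ 3) * v ^ 3)| ≤ e * h n ^ 3 := by
    intro v hv
    have hhv : |h n * v| ≤ h n := by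
      rw [abs_mul, abs_of_pos hn]
      exact mul_le_of_le_one_right hn.le hv
    have := hball (h n * v) (by simpa [Real.dist_eq] using hhv.trans_lt hnr)
    rw [Real.norm_eq_abs, norm_pow, Real.norm_eq_abs] at this
    calc _ = |φ (t - h n * v) - (φ t - φ₁ t * (h n * v) + φ₂ t / 2 * (h n * v) ^ 2 -
            c₃ / 6 * (h n * v) ^ 3)| := by
          congr 1
          ring
      _ ≤ e * |h n * v| ^ 3 := this
      _ ≤ _ := by gcongr
  have h1 := hk.weight_deriv.abs_integral_sub_le hφ hn.ne' (by fun_prop) hx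
  rw [hk.integral_deriv_mul_cubic] at h1
  rw [Real.dist_eq]
  have e1 : (h n ^ 2)⁻¹ * ((h n)⁻¹ * (∫ v, deriv k v * φ (t - h n * v)) - φ₁ t) -
      m2 k / 2 * c₃ = (h n ^ 3)⁻¹ * ((∫ v, deriv k v * φ (t - h n * v)) -
        (φ₁ t * h n + 3 * (c₃ / 6 * h n ^ 3) * m2 k)) := by
    field_simp
    ring
  rw [e1, abs_mul, abs_of_pos (by positivity : 0 < (h n ^ 3)⁻¹)]
  calc _ ≤ (h n ^ 3)⁻¹ * (e * h n ^ 3 * ∫ v, |deriv k v|) := by gcongr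
    _ = e * ∫ v, |deriv k v| := by field_simp
    _ < ε := hee

end ConditionK

/-! ### The law of the observations -/

/-- The Lebesgue density of the observations `(T, Δ)` weighted by `a Δ`. -/
noncomputable def weightedDensity (F g : ℝ → ℝ) (a : Fin 2 → ℝ) (u : ℝ) : ℝ :=
  (a 0 + (a 1 - a 0) * F u) * g u

/-- The observation `(T, Δ)` weighted by `a Δ` and a kernel at `s`. -/
noncomputable def kernelTerm (a : Fin 2 → ℝ) (w : ℝ → ℝ) (s h : ℝ) (p : ℝ × Fin 2) : ℝ :=
  a p.2 * w ((s - p.1) / h)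

/-- Independent current status observations: `T` has density `g`, and `Δ = 1` has conditional
probability `F T`. -/
structure Sampling {Ω : Type*} [MeasurableSpace Ω] (μ : Measure Ω) (F g : ℝ → ℝ)
    (z : ℕ → Ω → ℝ × Fin 2) : Prop where
  iid : IsIID μ z
  F_mono : Monotone F
  F_nonneg : ∀ x, 0 ≤ F x
  F_le_one : ∀ x, F x ≤ 1
  g_nonneg : ∀ x, 0 ≤ g x
  g_integrable : Integrable g
  g_integral : ∫ x, g x = 1
  g_neg : ∀ᵐ x, x ≤ 0 → g x = 0
  law : ∀ (a : Fin 2 → ℝ) (w : ℝ → ℝ) (B : ℝ), Measurable w → (∀ x, |w x| ≤ B) →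
    ∫ ω, a (z 0 ω).2 * w (z 0 ω).1 ∂μ = ∫ u, weightedDensity F g a u * w u

section Law

theorem IsDensity.integral_eq {P : Measure ℝ} {f : ℝ → ℝ} (hf : IsDensity P f) (w : ℝ → ℝ) :
    ∫ x, w x ∂P = ∫ x, f x * w x := by
  rw [hf.eq_withDensity, integral_withDensity_eq_integral_toReal_smul
    hf.measurable.ennreal_ofReal (by simp)]
  refine integral_congr_ae (ae_of_all _ fun x => ?_)
  simp [ENNReal.toReal_ofReal (hf.nonneg x)]

theorem IsDensity.integrable {P : Measure ℝ} [IsProbabilityMeasure P] {f : ℝ → ℝ}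
    (hf : IsDensity P f) : Integrable f := by
  refine ⟨hf.measurable.aestronglyMeasurable, ?_⟩
  rw [hasFiniteIntegral_iff_ofReal (ae_of_all _ hf.nonneg)]
  have h1 : P univ = ∫⁻ x, ENNReal.ofReal (f x) := by
    conv_lhs => rw [hf.eq_withDensity]
    rw [withDensity_apply _ MeasurableSet.univ, setLIntegral_univ]
  rw [← h1, measure_univ]
  exact ENNReal.one_lt_top

theorem IsDensity.integral_eq_one {P : Measure ℝ} [IsProbabilityMeasure P] {f : ℝ → ℝ}
    (hf : IsDensity P f) : ∫ x, f x = 1 := by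
  have := hf.integral_eq fun _ => 1
  simpa using this.symm

theorem measurable_observe : Measurable fun p : ℝ × ℝ => observe p.1 p.2 := by
  unfold observe
  refine measurable_snd.prodMk (Measurable.ite ?_ measurable_const measurable_const)
  exact measurableSet_le measurable_fst measurable_snd

variable {Ω : Type*} [MeasurableSpace Ω] {μ : Measure Ω} [IsProbabilityMeasure μ]
  {P₀ Q : Measure ℝ} [IsProbabilityMeasure P₀] [IsProbabilityMeasure Q] {f₀ g : ℝ → ℝ} {M₀ : ℝ}
  {X T : ℕ → Ω → ℝ}

/-- Fubini, integrating over `X` first: given `T = v`, the mean of `a Δ` is `a 0 + (a 1 - a 0)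
F₀(v)`. -/
theorem integral_observe (hQ : IsDensity Q g) {x y : Ω → ℝ} (hx : Measurable x)
    (hy : Measurable y) (hxP : μ.map x = P₀) (hyQ : μ.map y = Q) (hxy : IndepFun x y μ)
    (a : Fin 2 → ℝ) {w : ℝ → ℝ} {B : ℝ} (hw : Measurable w) (hB : ∀ x, |w x| ≤ B) :
    ∫ ω, a (observe (x ω) (y ω)).2 * w (observe (x ω) (y ω)).1 ∂μ =
      ∫ u, weightedDensity (cdf P₀) g a u * w u := by
  have hm : Measurable fun p : ℝ × ℝ => a (observe p.1 p.2).2 * w (observe p.1 p.2).1 :=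
    ((measurable_of_finite a).comp (measurable_snd.comp measurable_observe)).mul
      (hw.comp (measurable_fst.comp measurable_observe))
  have hmap : μ.map (fun ω => (x ω, y ω)) = P₀.prod Q := by
    rw [← hxP, ← hyQ]
    exact (indepFun_iff_map_prod_eq_prod_map_map hx.aemeasurable hy.aemeasurable).1 hxy
  have ha : ∀ i, |a i| ≤ |a 0| + |a 1| := by
    intro i
    fin_cases i
    · simp
    · simp
  have hint : Integrable (fun p : ℝ × ℝ => a (observe p.1 p.2).2 * w (observe p.1 p.2).1)
      (P₀.prod Q) := by
    refine Integrable.of_bound hm.aestronglyMeasurable ((|a 0| + |a 1|) * B)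
      (ae_of_all _ fun p => ?_)
    rw [norm_mul]
    exact mul_le_mul (ha _) (hB _) (norm_nonneg _) (by positivity)
  calc ∫ ω, a (observe (x ω) (y ω)).2 * w (observe (x ω) (y ω)).1 ∂μ
      = ∫ p, a (observe p.1 p.2).2 * w (observe p.1 p.2).1 ∂(P₀.prod Q) := by
        rw [← hmap, integral_map (hx.prodMk hy).aemeasurable hm.aestronglyMeasurable]
    _ = ∫ v, ∫ u, a (observe u v).2 * w (observe u v).1 ∂P₀ ∂Q := integral_prod_symm _ hint
    _ = ∫ v, (a 0 + (a 1 - a 0) * cdf P₀ v) * w v ∂Q := by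
        refine integral_congr_ae (ae_of_all _ fun v => ?_)
        have e : ∀ u, a (observe u v).2 * w (observe u v).1 =
            (a 0 + (a 1 - a 0) * (Iic v).indicator 1 u) * w v := by
          intro u
          by_cases h : u ≤ v
          · simp [observe, h]
          · simp [observe, h]
        simp only [e]
        have hi : Integrable (fun u => (a 1 - a 0) * (Iic v).indicator (1 : ℝ → ℝ) u) P₀ :=
          ((integrable_const (1 : ℝ)).indicator measurableSet_Iic).const_mul _
        rw [integral_mul_const, integral_add (integrable_const _) hi,
          integral_const_mul, integral_indicator_one measurableSet_Iic, cdf_eq_real]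
        simp
    _ = _ := by
        rw [hQ.integral_eq]
        refine integral_congr_ae (ae_of_all _ fun v => ?_)
        simp only [weightedDensity]
        ring

theorem sampling_observe (hG : ConditionG Q g M₀) (hXm : ∀ i, Measurable (X i))
    (hTm : ∀ i, Measurable (T i)) (hXlaw : ∀ i, μ.map (X i) = P₀) (hTlaw : ∀ i, μ.map (T i) = Q)
    (hX : iIndepFun X μ) (hT : iIndepFun T μ)
    (hXT : IndepFun (fun ω i => X i ω) (fun ω i => T i ω) μ) :
    Sampling μ (cdf P₀) g (fun i ω => observe (X i ω) (T i ω)) := by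
  have hXTi : ∀ i, IndepFun (X i) (T i) μ := fun i =>
    hXT.comp (measurable_pi_apply i) (measurable_pi_apply i)
  have hpair : ∀ i, Measurable fun ω => (X i ω, T i ω) := fun i => (hXm i).prodMk (hTm i)
  have hmap : ∀ i, μ.map (fun ω => (X i ω, T i ω)) = P₀.prod Q := fun i => by
    rw [← hXlaw i, ← hTlaw i]
    exact (indepFun_iff_map_prod_eq_prod_map_map (hXm i).aemeasurable (hTm i).aemeasurable).1
      (hXTi i)
  have hobs : ∀ i, μ.map (fun ω => observe (X i ω) (T i ω)) =
      (P₀.prod Q).map fun p => observe p.1 p.2 := fun i => by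
    rw [← hmap i, Measure.map_map measurable_observe (hpair i)]
    rfl
  refine ⟨⟨fun i => measurable_observe.comp (hpair i), ?_, fun i => by rw [hobs, hobs]⟩,
    monotone_cdf P₀, cdf_nonneg P₀, cdf_le_one P₀, hG.density.nonneg, hG.density.integrable,
    hG.density.integral_eq_one, ?_, fun a w B hw hB => ?_⟩
  · exact (iIndepFun_prodMk hXm hTm hX hT hXT).comp _ fun _ => measurable_observe
  -- The support condition only controls the density almost everywhere on the open negative
  -- half-line; the point `0` is added as a null set.
  · have h0 : Q (Iio 0) = 0 := by
      have h1 := Measure.measure_compl_support (μ := Q)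
      rwa [hG.support_eq, compl_Ici] at h1
    have h2 : ∫⁻ x in Iio (0 : ℝ), ENNReal.ofReal (g x) = 0 := by
      rw [← withDensity_apply _ measurableSet_Iio, ← hG.density.eq_withDensity, h0]
    rw [lintegral_eq_zero_iff hG.density.measurable.ennreal_ofReal] at h2
    have h3 := ae_imp_of_ae_restrict h2
    have h4 : ∀ᵐ x : ℝ, x ≠ 0 := by simp [ae_iff]
    filter_upwards [h3, h4] with x hx hx0 hle
    have := hx (lt_of_le_of_ne hle hx0)
    exact le_antisymm (by simpa using this) (hG.density.nonneg x)
  · exact integral_observe hG.density (hXm 0) (hTm 0) (hXlaw 0) (hTlaw 0) (hXTi 0) a hw hB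

end Law

/-! ### Moments and uniform deviations of kernel averages -/

namespace Sampling

variable {Ω : Type*} [MeasurableSpace Ω] {μ : Measure Ω} {F g : ℝ → ℝ} {z : ℕ → Ω → ℝ × Fin 2}

theorem measurable_F (hz : Sampling μ F g z) : Measurable F := hz.F_mono.measurable

theorem weight_nonneg (hz : Sampling μ F g z) {a : Fin 2 → ℝ} (ha : ∀ i, 0 ≤ a i) (u : ℝ) :
    0 ≤ a 0 + (a 1 - a 0) * F u := by
  nlinarith [ha 0, ha 1, hz.F_nonneg u, hz.F_le_one u,
    mul_nonneg (ha 0) (sub_nonneg.2 (hz.F_le_one u)), mul_nonneg (ha 1) (hz.F_nonneg u)]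

theorem weight_le (hz : Sampling μ F g z) {a : Fin 2 → ℝ} {A : ℝ} (hA : ∀ i, a i ≤ A) (u : ℝ) :
    a 0 + (a 1 - a 0) * F u ≤ A := by
  nlinarith [mul_nonneg (sub_nonneg.2 (hA 0)) (sub_nonneg.2 (hz.F_le_one u)),
    mul_nonneg (sub_nonneg.2 (hA 1)) (hz.F_nonneg u)]

theorem integrable_weightedDensity (hz : Sampling μ F g z) (a : Fin 2 → ℝ) :
    Integrable (weightedDensity F g a) := by
  refine hz.g_integrable.bdd_mul (c := |a 0| + |a 1 - a 0|) ?_ (ae_of_all _ fun u => ?_)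
  · exact (measurable_const.add (measurable_const.mul hz.measurable_F)).aestronglyMeasurable
  · refine (abs_add_le _ _).trans (add_le_add_right ?_ _)
    rw [abs_mul, abs_of_nonneg (hz.F_nonneg u)]
    exact mul_le_of_le_one_right (abs_nonneg _) (hz.F_le_one u)

theorem integral_kernelTerm (hz : Sampling μ F g z) (a : Fin 2 → ℝ) {w : ℝ → ℝ} (hw : Weight w)
    (s : ℝ) {h : ℝ} (hh : 0 < h) :
    ∫ ω, kernelTerm a w s h (z 0 ω) ∂μ = h * ∫ v, w v * weightedDensity F g a (s - h * v) := by
  obtain ⟨B, _, hB⟩ := hw.exists_bound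
  have h1 := hz.law a (fun u => w ((s - u) / h)) B
    (hw.continuous.measurable.comp (by fun_prop)) fun x => hB _
  rw [← integral_kernel_comp w _ s hh]
  unfold kernelTerm
  rw [h1]
  simp_rw [mul_comm]

end Sampling

theorem measurable_kernelTerm (a : Fin 2 → ℝ) {w : ℝ → ℝ} (hw : Weight w) (s h : ℝ) :
    Measurable (kernelTerm a w s h) := by
  unfold kernelTerm
  exact ((measurable_of_finite a).comp measurable_snd).mul
    (hw.continuous.measurable.comp (by fun_prop))

theorem kernelTerm_sq (a : Fin 2 → ℝ) (w : ℝ → ℝ) (s h : ℝ) (p : ℝ × Fin 2) :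
    kernelTerm a w s h p ^ 2 = kernelTerm (fun i => a i ^ 2) (fun v => w v ^ 2) s h p := by
  unfold kernelTerm
  ring

theorem Weight.sq {w : ℝ → ℝ} (hw : Weight w) : Weight fun v => w v ^ 2 :=
  ⟨hw.contDiff.pow 2, fun v hv => by simp [hw.zero v hv]⟩

namespace Sampling

variable {Ω : Type*} [MeasurableSpace Ω] {μ : Measure Ω} {F g : ℝ → ℝ} {z : ℕ → Ω → ℝ × Fin 2}

/-- The square of a kernel term is a kernel term for squared weights, so its mean is `h` times a
bounded integral. -/
theorem integral_kernelTerm_sq_le (hz : Sampling μ F g z) {a : Fin 2 → ℝ} {A : ℝ}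
    (hA : ∀ i, |a i| ≤ A) {w : ℝ → ℝ} (hw : Weight w) {s h Cg : ℝ} (hh : 0 < h)
    (hg : ∀ x, |x - s| ≤ h → g x ≤ Cg) :
    ∫ ω, kernelTerm a w s h (z 0 ω) ^ 2 ∂μ ≤ A ^ 2 * Cg * (∫ v, w v ^ 2) * h := by
  simp_rw [kernelTerm_sq]
  rw [hz.integral_kernelTerm _ hw.sq s hh, mul_comm]
  refine mul_le_mul_of_nonneg_right ?_ hh.le
  rw [← integral_const_mul]
  refine integral_mono (hw.sq.integrable_shift (hz.integrable_weightedDensity _) s hh.ne')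
    (hw.sq.integrable.const_mul _) fun v => ?_
  have hsq : ∀ i, a i ^ 2 ≤ A ^ 2 := fun i => sq_le_sq' (abs_le.1 (hA i)).1 (abs_le.1 (hA i)).2
  rcases le_or_gt |v| 1 with hv | hv
  · have hgv : g (s - h * v) ≤ Cg := by
      refine hg _ ?_
      rw [sub_sub_cancel_left, abs_neg, abs_mul, abs_of_pos hh]
      exact mul_le_of_le_one_right hh.le hv
    have h1 : weightedDensity F g (fun i => a i ^ 2) (s - h * v) ≤ A ^ 2 * Cg := by
      unfold weightedDensity
      exact mul_le_mul (hz.weight_le hsq _) hgv (hz.g_nonneg _) (sq_nonneg _)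
    simp only
    rw [mul_comm]
    exact mul_le_mul_of_nonneg_right h1 (sq_nonneg _)
  · simp [hw.zero v hv]

variable [IsProbabilityMeasure μ]

/-- Uniform stochastic approximation of kernel averages by their means. -/
theorem eventually_abs_avg_sub_le (hz : Sampling μ F g z) (a : Fin 2 → ℝ) {w : ℝ → ℝ}
    (hw : Weight w) {h : ℕ → ℝ} (hh : ∀ᶠ n in atTop, 0 < h n) (h0 : Tendsto h atTop (𝓝 0))
    (h6 : Tendsto (fun n : ℕ => ((n : ℝ) * h n ^ 6)⁻¹) atTop (𝓝 0)) {l r η Cg : ℝ} (hlr : l ≤ r)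
    (hη : 0 < η) (hg : ∀ x, l - η ≤ x → x ≤ r + η → g x ≤ Cg) {ε : ℝ} (hε : 0 < ε) :
    ∀ᶠ p in inProb μ, ∀ s ∈ Icc l r,
      |avg z (kernelTerm a w s (h p.1)) p.1 p.2 - ∫ ω, kernelTerm a w s (h p.1) (z 0 ω) ∂μ| ≤
        ε * h p.1 ^ 2 := by
  obtain ⟨B, hB0, hB⟩ := hw.exists_bound
  obtain ⟨L, hL0, hL⟩ := hw.exists_lipschitz
  obtain ⟨A, hA0, hA⟩ : ∃ A, 0 < A ∧ ∀ i, |a i| ≤ A := by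
    refine ⟨|a 0| + |a 1| + 1, by positivity, fun i => ?_⟩
    fin_cases i
    · simp
      linarith [abs_nonneg (a 1)]
    · simp
      linarith [abs_nonneg (a 0)]
  have hCg : 0 ≤ Cg := (hz.g_nonneg l).trans (hg l (by linarith) (by linarith))
  obtain ⟨K, hK0, hK⟩ : ∃ K, 0 ≤ K ∧ K = A ^ 2 * Cg * ∫ v, w v ^ 2 :=
    ⟨_, mul_nonneg (mul_nonneg (sq_nonneg _) hCg) (integral_nonneg fun _ => sq_nonneg _), rfl⟩
  have hbd : ∀ s h p, |kernelTerm a w s h p| ≤ A * B := fun s h p => by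
    unfold kernelTerm
    rw [abs_mul]
    exact mul_le_mul (hA _) (hB _) (abs_nonneg _) hA0.le
  refine eventually_inProb.2 ?_
  have hlim : Tendsto (fun n : ℕ => ENNReal.ofReal
      (((r - l) * (4 * A * L / ε) + 1) * (4 * K / ε ^ 2) * ((n : ℝ) * h n ^ 6)⁻¹)) atTop (𝓝 0) := by
    rw [← ENNReal.ofReal_zero]
    refine (ENNReal.continuous_ofReal.tendsto _).comp ?_
    simpa using h6.const_mul (((r - l) * (4 * A * L / ε) + 1) * (4 * K / ε ^ 2))
  refine tendsto_of_tendsto_of_tendsto_of_le_of_le' tendsto_const_nhds hlim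
    (Eventually.of_forall fun _ => zero_le) ?_
  filter_upwards [hh, h0.eventually (gt_mem_nhds hη), h0.eventually (gt_mem_nhds one_pos),
    eventually_gt_atTop 0] with n hn hnη hn1 hn0
  have hn0' : (0 : ℝ) < n := by exact_mod_cast hn0
  -- Mesh chosen so that moving `s` by `d` changes a kernel term by at most `A L d / h = ε h² / 4`.
  obtain ⟨d, hd0, hd⟩ : ∃ d, 0 < d ∧ d = ε * h n ^ 3 / (4 * A * L) := ⟨_, by positivity, rfl⟩
  set N := ⌊(r - l) / d⌋₊ + 1 with hN
  -- Half of the allowance `ε h²` is spent at the nearest grid point to the left, and a quarter each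
  -- on moving the average and the mean to that point.
  have hcover : {ω | ¬ ∀ s ∈ Icc l r,
      |avg z (kernelTerm a w s (h n)) n ω - ∫ ω, kernelTerm a w s (h n) (z 0 ω) ∂μ| ≤ ε * h n ^ 2} ⊆
      ⋃ i ∈ Finset.range N, {ω | ε * h n ^ 2 / 2 ≤ |avg z (kernelTerm a w (l + i * d) (h n)) n ω -
        ∫ ω, kernelTerm a w (l + i * d) (h n) (z 0 ω) ∂μ|} := by
    intro ω hω
    by_contra hcon
    refine hω fun s hs => ?_
    simp only [mem_iUnion, mem_ofPred_eq, not_exists, not_le, Finset.mem_range] at hcon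
    have hdiv0 : 0 ≤ (s - l) / d := div_nonneg (by linarith [hs.1]) hd0.le
    have hi := hcon ⌊(s - l) / d⌋₊ (by
      rw [hN, Nat.lt_succ_iff]
      exact Nat.floor_le_floor (div_le_div_of_nonneg_right (by linarith [hs.2]) hd0.le))
    set s' := l + (⌊(s - l) / d⌋₊ : ℝ) * d with hs'
    have hss : |s - s'| ≤ d := by
      have e1 := Nat.floor_le hdiv0
      have e2 := (Nat.lt_floor_add_one ((s - l) / d)).le
      rw [le_div_iff₀ hd0] at e1
      rw [div_le_iff₀ hd0] at e2
      rw [abs_le]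
      constructor <;> linarith
    have hptw : ∀ p, |kernelTerm a w s (h n) p - kernelTerm a w s' (h n) p| ≤ ε * h n ^ 2 / 4 := by
      intro p
      unfold kernelTerm
      rw [← mul_sub, abs_mul]
      calc _ ≤ A * (L * |(s - p.1) / h n - (s' - p.1) / h n|) :=
            mul_le_mul (hA _) (hL _ _) (abs_nonneg _) hA0.le
        _ = A * L * (|s - s'| / h n) := by
            rw [← sub_div, sub_sub_sub_cancel_right, abs_div, abs_of_pos hn]
            ring
        _ ≤ A * L * (d / h n) := by gcongr
        _ = _ := by
            rw [hd]
            field_simp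
    have havg : |avg z (kernelTerm a w s (h n)) n ω - avg z (kernelTerm a w s' (h n)) n ω| ≤
        ε * h n ^ 2 / 4 := by
      unfold avg
      rw [← mul_sub, ← Finset.sum_sub_distrib, abs_mul, abs_of_pos (inv_pos.2 hn0')]
      calc _ ≤ (n : ℝ)⁻¹ * ∑ j ∈ Finset.range n, ε * h n ^ 2 / 4 := by
            refine mul_le_mul_of_nonneg_left ?_ (inv_pos.2 hn0').le
            exact (Finset.abs_sum_le_sum_abs _ _).trans (Finset.sum_le_sum fun j _ => hptw _)
        _ = _ := by
            rw [Finset.sum_const, Finset.card_range, nsmul_eq_mul]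
            field_simp
    have hmean : |(∫ ω, kernelTerm a w s (h n) (z 0 ω) ∂μ) -
        ∫ ω, kernelTerm a w s' (h n) (z 0 ω) ∂μ| ≤ ε * h n ^ 2 / 4 := by
      rw [← integral_sub
        (hz.iid.integrable_comp (measurable_kernelTerm a hw s _) (hbd _ _) 0)
        (hz.iid.integrable_comp (measurable_kernelTerm a hw s' _) (hbd _ _) 0)]
      have := norm_integral_le_of_norm_le_const (μ := μ)
        (f := fun ω => kernelTerm a w s (h n) (z 0 ω) - kernelTerm a w s' (h n) (z 0 ω))
        (ae_of_all _ fun ω => hptw (z 0 ω))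
      simpa using this
    rw [abs_le] at havg hmean ⊢
    rw [abs_lt] at hi
    constructor <;> linarith [hi.1, hi.2, havg.1, havg.2, hmean.1, hmean.2]
  -- Union bound: `O(h⁻³)` grid points, each with Chebyshev bound `O((n h³)⁻¹)`, in total `O((n
  -- h⁶)⁻¹)`.
  refine (measure_mono hcover).trans ((measure_biUnion_finset_le _ _).trans ?_)
  have hterm : ∀ i ∈ Finset.range N, μ {ω | ε * h n ^ 2 / 2 ≤
      |avg z (kernelTerm a w (l + i * d) (h n)) n ω -
        ∫ ω, kernelTerm a w (l + i * d) (h n) (z 0 ω) ∂μ|} ≤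
      ENNReal.ofReal (K * h n / (n * (ε * h n ^ 2 / 2) ^ 2)) := by
    intro i hi
    refine (hz.iid.measure_avg_sub_ge_le (measurable_kernelTerm a hw _ _) (hbd _ _) hn0
      (by positivity)).trans (ENNReal.ofReal_le_ofReal ?_)
    refine div_le_div_of_nonneg_right ?_ (by positivity)
    rw [hK]
    refine hz.integral_kernelTerm_sq_le hA hw hn fun x hx => hg x ?_ ?_
    · have : (0 : ℝ) ≤ i * d := by positivity
      linarith [(abs_le.1 hx).1]
    · have h1 : (i : ℝ) ≤ (r - l) / d := by
        rw [Finset.mem_range, hN, Nat.lt_succ_iff] at hi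
        exact (Nat.le_floor_iff (div_nonneg (by linarith) hd0.le)).1 hi
      rw [le_div_iff₀ hd0] at h1
      linarith [(abs_le.1 hx).2]
  refine (Finset.sum_le_sum hterm).trans ?_
  rw [Finset.sum_const, Finset.card_range, nsmul_eq_mul, ← ENNReal.ofReal_natCast,
    ← ENNReal.ofReal_mul (by positivity)]
  refine ENNReal.ofReal_le_ofReal ?_
  have hNle : (N : ℝ) ≤ ((r - l) * (4 * A * L / ε) + 1) / h n ^ 3 := by
    have h1 : (N : ℝ) ≤ (r - l) / d + 1 := by
      rw [hN]
      push_cast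
      linarith [Nat.floor_le (div_nonneg (by linarith : 0 ≤ r - l) hd0.le)]
    refine h1.trans ?_
    rw [le_div_iff₀ (by positivity), add_mul, hd]
    have h2 : (r - l) / (ε * h n ^ 3 / (4 * A * L)) * h n ^ 3 = (r - l) * (4 * A * L / ε) := by
      field_simp
    have h3 : h n ^ 3 ≤ 1 := pow_le_one₀ hn.le hn1.le
    linarith
  calc (N : ℝ) * (K * h n / (n * (ε * h n ^ 2 / 2) ^ 2))
      ≤ ((r - l) * (4 * A * L / ε) + 1) / h n ^ 3 * (K * h n / (n * (ε * h n ^ 2 / 2) ^ 2)) := by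
        gcongr
    _ = _ := by field_simp; ring

end Sampling

/-! ### The bandwidth -/

section Bandwidth

/-- The seventh root of `n`. -/
noncomputable def root (n : ℕ) : ℝ := (n : ℝ) ^ (1 / 7 : ℝ)

theorem root_pow (n : ℕ) : root n ^ 7 = n := by
  rw [root, ← Real.rpow_natCast, ← Real.rpow_mul (Nat.cast_nonneg n)]
  norm_num

theorem root_pos {n : ℕ} (hn : 0 < n) : 0 < root n :=
  Real.rpow_pos_of_pos (by exact_mod_cast hn) _

theorem root_sq (n : ℕ) : (n : ℝ) ^ (2 / 7 : ℝ) = root n ^ 2 := by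
  rw [root, ← Real.rpow_natCast, ← Real.rpow_mul (Nat.cast_nonneg n)]
  norm_num

theorem bandwidth_eq (c : ℝ) (n : ℕ) : bandwidth c n = c * (root n)⁻¹ := by
  rw [bandwidth, root, Real.rpow_neg (Nat.cast_nonneg n)]

theorem tendsto_inv_root : Tendsto (fun n => (root n)⁻¹) atTop (𝓝 0) :=
  tendsto_inv_atTop_zero.comp
    ((tendsto_rpow_atTop (by norm_num)).comp tendsto_natCast_atTop_atTop)

theorem eventually_root_pos : ∀ᶠ n in atTop, 0 < root n :=
  (eventually_gt_atTop 0).mono fun _ hn => root_pos hn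

theorem eventually_bandwidth_pos {c : ℝ} (hc : 0 < c) : ∀ᶠ n in atTop, 0 < bandwidth c n := by
  filter_upwards [eventually_root_pos] with n hn
  rw [bandwidth_eq]
  positivity

theorem tendsto_bandwidth (c : ℝ) : Tendsto (bandwidth c) atTop (𝓝 0) := by
  have := tendsto_inv_root.const_mul c
  rw [mul_zero] at this
  exact this.congr fun n => (bandwidth_eq c n).symm

theorem tendsto_inv_mul_bandwidth_pow {c : ℝ} (hc : 0 < c) :
    Tendsto (fun n : ℕ => ((n : ℝ) * bandwidth c n ^ 6)⁻¹) atTop (𝓝 0) := by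
  have := tendsto_inv_root.const_mul (c ^ 6)⁻¹
  rw [mul_zero] at this
  refine this.congr' ?_
  filter_upwards [eventually_root_pos] with n hn
  rw [bandwidth_eq, ← root_pow]
  field_simp

end Bandwidth

/-! ### Local regularity of the observation densities -/

namespace Jet

theorem weightedDensity {F f f₁ g g₁ g₂ : ℝ → ℝ} {c d t : ℝ} (hF : Jet F f f₁ c t)
    (hg : Jet g g₁ g₂ d t) (a : Fin 2 → ℝ) :
    Jet (weightedDensity F g a)
      (fun x => (a 1 - a 0) * f x * g x + (a 0 + (a 1 - a 0) * F x) * g₁ x)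
      (fun x => (a 1 - a 0) * f₁ x * g x + 2 * ((a 1 - a 0) * f x * g₁ x) +
        (a 0 + (a 1 - a 0) * F x) * g₂ x)
      ((a 1 - a 0) * c * g t + 3 * ((a 1 - a 0) * f₁ t * g₁ t) + 3 * ((a 1 - a 0) * f t * g₂ t) +
        (a 0 + (a 1 - a 0) * F t) * d) t :=
  (hF.const_add_mul (a 0) (a 1 - a 0)).mul hg

theorem continuousAt {φ φ₁ φ₂ : ℝ → ℝ} {c t : ℝ} (h : Jet φ φ₁ φ₂ c t) : ContinuousAt φ t :=
  h.one.self_of_nhds.continuousAt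

theorem exists_bound {φ φ₁ φ₂ : ℝ → ℝ} {c t : ℝ} (h : Jet φ φ₁ φ₂ c t) :
    ∃ r > 0, ∃ C, 0 ≤ C ∧ ∀ x, |x - t| ≤ r → φ x ≤ C := by
  have h1 : ∀ᶠ x in 𝓝 t, φ x < |φ t| + 1 :=
    h.continuousAt.eventually (gt_mem_nhds (by linarith [le_abs_self (φ t)]))
  obtain ⟨r, hr, hb⟩ := Metric.eventually_nhds_iff_ball.1 h1
  refine ⟨r / 2, by positivity, |φ t| + 1, by positivity, fun x hx => (hb x ?_).le⟩
  rw [Metric.mem_ball, Real.dist_eq]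
  linarith

end Jet

theorem Weight.tendsto_integral_shift {w φ : ℝ → ℝ} (hw : Weight w) (hφ : Integrable φ) {t : ℝ}
    (hc : ContinuousAt φ t) {h : ℕ → ℝ} (hh : ∀ᶠ n in atTop, 0 < h n)
    (h0 : Tendsto h atTop (𝓝 0)) :
    Tendsto (fun n => ∫ v, w v * φ (t - h n * v)) atTop (𝓝 (φ t * ∫ v, w v)) := by
  rw [Metric.tendsto_nhds]
  intro ε hε
  have n1 : 0 ≤ ∫ v, |w v| := integral_nonneg fun _ => abs_nonneg _
  obtain ⟨e, he, hee⟩ : ∃ e > 0, e * (∫ v, |w v|) < ε :=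
    ⟨ε / ((∫ v, |w v|) + 1), by positivity, by
      rw [div_mul_eq_mul_div, div_lt_iff₀ (by positivity)]
      nlinarith⟩
  obtain ⟨r, hr, hball⟩ := Metric.continuousAt_iff.1 hc e he
  filter_upwards [hh, h0.eventually (gt_mem_nhds hr)] with n hn hnr
  have h1 := hw.abs_integral_sub_le hφ (s := t) hn.ne' (p := fun _ => φ t) (e := e)
    continuous_const fun v hv => by
      refine (hball (x := t - h n * v) ?_).le
      rw [Real.dist_eq, sub_sub_cancel_left, abs_neg, abs_mul, abs_of_pos hn]
      exact (mul_le_of_le_one_right hn.le hv).trans_lt hnr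
  rw [integral_mul_const, mul_comm (∫ v, w v)] at h1
  exact h1.trans_lt hee

/-! ### Limits of kernel estimates at and near `t` -/

namespace Sampling

variable {Ω : Type*} [MeasurableSpace Ω] {μ : Measure Ω} [IsProbabilityMeasure μ]
  {F f f₁ g g₁ g₂ : ℝ → ℝ} {z : ℕ → Ω → ℝ × Fin 2} {cF cg t c : ℝ} {k : ℝ → ℝ}

theorem exists_kernelTerm_bound (a : Fin 2 → ℝ) {w : ℝ → ℝ} (hw : Weight w) :
    ∃ B, 0 < B ∧ ∀ s h p, |kernelTerm a w s h p| ≤ B := by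
  obtain ⟨B, hB0, hB⟩ := hw.exists_bound
  refine ⟨(|a 0| + |a 1| + 1) * B, by positivity, fun s h p => ?_⟩
  unfold kernelTerm
  rw [abs_mul]
  refine mul_le_mul ?_ (hB _) (abs_nonneg _) (by positivity)
  generalize p.2 = i
  fin_cases i
  · simp
    linarith [abs_nonneg (a 1)]
  · simp
    linarith [abs_nonneg (a 0)]

/-- The uniform deviation `ε h²` survives division by `h` for the density and by `h²` for its
derivative; the bias bound handles the rest. -/
theorem exists_uniform (hz : Sampling μ F g z) (hk : ConditionK k) (hF : Jet F f f₁ cF t)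
    (hg : Jet g g₁ g₂ cg t) (hc : 0 < c) (a : Fin 2 → ℝ) :
    ∃ ρ > 0, ∀ ε > 0, ∀ᶠ p in inProb μ, ∀ s ∈ Icc (t - ρ) (t + ρ),
      |(bandwidth c p.1)⁻¹ * avg z (kernelTerm a k s (bandwidth c p.1)) p.1 p.2 -
        weightedDensity F g a s| < ε ∧
      |(bandwidth c p.1 ^ 2)⁻¹ * avg z (kernelTerm a (deriv k) s (bandwidth c p.1)) p.1 p.2 -
        ((a 1 - a 0) * f s * g s + (a 0 + (a 1 - a 0) * F s) * g₁ s)| < ε := by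
  obtain ⟨ρ, hρ, C, hC, hbias⟩ := hk.exists_uniform_bias_bound
    (hz.integrable_weightedDensity a) (hF.weightedDensity hg a)
  obtain ⟨r, hr, Cg, _, hCg⟩ := hg.exists_bound
  -- Half of `r` is kept in reserve so that the bound on `g` also holds on the margin reached by the
  -- kernel.
  refine ⟨min ρ (r / 2), by positivity, fun ε hε => ?_⟩
  have hh := eventually_bandwidth_pos hc
  have h0 := tendsto_bandwidth c
  have h6 := tendsto_inv_mul_bandwidth_pow hc
  have hgb : ∀ x, t - min ρ (r / 2) - r / 2 ≤ x → x ≤ t + min ρ (r / 2) + r / 2 → g x ≤ Cg := by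
    intro x h1 h2
    refine hCg x (abs_le.2 ⟨?_, ?_⟩) <;> linarith [min_le_right ρ (r / 2)]
  have hlr : t - min ρ (r / 2) ≤ t + min ρ (r / 2) := by
    have : 0 < min ρ (r / 2) := by positivity
    linarith
  have hsmall : Tendsto (fun n => C * bandwidth c n) atTop (𝓝 0) := by simpa using h0.const_mul C
  filter_upwards [hz.eventually_abs_avg_sub_le a hk.weight hh h0 h6 hlr (half_pos hr) hgb
      (by positivity : 0 < ε / 2),
    hz.eventually_abs_avg_sub_le a hk.weight_deriv hh h0 h6 hlr (half_pos hr) hgb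
      (by positivity : 0 < ε / 2),
    tendsto_fst_inProb.eventually hh, tendsto_fst_inProb.eventually
      (h0.eventually (gt_mem_nhds hρ)), tendsto_fst_inProb.eventually
      (h0.eventually (gt_mem_nhds one_pos)), tendsto_fst_inProb.eventually
      (hsmall.eventually (gt_mem_nhds (half_pos hε)))] with p hp1 hp2 hpos hpρ hp1' hpC s hs
  have hst : |s - t| ≤ ρ := abs_le.2 ⟨by linarith [hs.1, min_le_left ρ (r / 2)],
    by linarith [hs.2, min_le_left ρ (r / 2)]⟩
  obtain ⟨hb1, hb2⟩ := hbias s (bandwidth c p.1) hst hpos hpρ.le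
  have e1 := hp1 s hs
  have e2 := hp2 s hs
  rw [hz.integral_kernelTerm a hk.weight s hpos] at e1
  rw [hz.integral_kernelTerm a hk.weight_deriv s hpos] at e2
  generalize bandwidth c p.1 = h at *
  constructor
  · set I := ∫ v, k v * weightedDensity F g a (s - h * v)
    set V := avg z (kernelTerm a k s h) p.1 p.2
    have e3 : |h⁻¹ * V - I| ≤ ε / 2 * h := by
      have : h⁻¹ * V - I = h⁻¹ * (V - h * I) := by field_simp
      rw [this, abs_mul, abs_of_pos (inv_pos.2 hpos)]
      calc _ ≤ h⁻¹ * (ε / 2 * h ^ 2) := by gcongr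
        _ = _ := by field_simp
    have e4 : ε / 2 * h ≤ ε / 2 := mul_le_of_le_one_right (by positivity) hp1'.le
    have e5 : C * h ^ 2 ≤ C * h := by
      refine mul_le_mul_of_nonneg_left ?_ hC.le
      nlinarith
    calc _ ≤ |h⁻¹ * V - I| + |I - weightedDensity F g a s| := abs_sub_le _ _ _
      _ < ε := by linarith
  · set I := ∫ v, deriv k v * weightedDensity F g a (s - h * v)
    set V := avg z (kernelTerm a (deriv k) s h) p.1 p.2
    have e3 : |(h ^ 2)⁻¹ * V - h⁻¹ * I| ≤ ε / 2 := by
      have : (h ^ 2)⁻¹ * V - h⁻¹ * I = (h ^ 2)⁻¹ * (V - h * I) := by field_simp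
      rw [this, abs_mul, abs_of_pos (by positivity : 0 < (h ^ 2)⁻¹)]
      calc _ ≤ (h ^ 2)⁻¹ * (ε / 2 * h ^ 2) := by gcongr
        _ = _ := by field_simp
    refine (abs_sub_le _ (h⁻¹ * I) _).trans_lt ?_
    linarith

/-- The value of a kernel density estimate at `t`, at the scale of its bias. -/
theorem tendsto_value (hz : Sampling μ F g z) (hk : ConditionK k) (hF : Jet F f f₁ cF t)
    (hg : Jet g g₁ g₂ cg t) (hc : 0 < c) (a : Fin 2 → ℝ) :
    Tendsto (fun p : ℕ × Ω => root p.1 ^ 2 *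
      ((bandwidth c p.1)⁻¹ * avg z (kernelTerm a k t (bandwidth c p.1)) p.1 p.2 -
        weightedDensity F g a t)) (inProb μ)
      (𝓝 (c ^ 2 * (m2 k / 2 * ((a 1 - a 0) * f₁ t * g t + 2 * ((a 1 - a 0) * f t * g₁ t) +
        (a 0 + (a 1 - a 0) * F t) * g₂ t)))) := by
  have hh := eventually_bandwidth_pos hc
  have h0 := tendsto_bandwidth c
  obtain ⟨r, hr, Cg, hCg0, hCg⟩ := hg.exists_bound
  obtain ⟨B, hB0, hB⟩ := exists_kernelTerm_bound a hk.weight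
  have hA : ∀ i, |a i| ≤ |a 0| + |a 1| := by
    intro i
    fin_cases i
    · simp
    · simp
  have hbias := (hk.tendsto_bias (hz.integrable_weightedDensity a) (hF.weightedDensity hg a)
    hh h0).const_mul (c ^ 2)
  set K := (|a 0| + |a 1|) ^ 2 * Cg * ∫ v, k v ^ 2 with hK
  have hlln := hz.iid.tendsto_avg_sub_integral (φ := fun n p => root n ^ 2 * (bandwidth c n)⁻¹ *
      kernelTerm a k t (bandwidth c n) p)
    (fun n => (measurable_kernelTerm a hk.weight _ _).const_mul _)
    (B := fun n => |root n ^ 2 * (bandwidth c n)⁻¹| * B)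
    (fun n p => by
      rw [abs_mul]
      exact mul_le_mul_of_nonneg_left (hB _ _ _) (abs_nonneg _)) (by
    -- The second moment over `n` is at most `root⁴ h⁻² · K h / root⁷`, which equals `K c⁻¹ root⁻²`:
    -- fluctuations are negligible at the scale of the bias.
    have hl : Tendsto (fun n => K * c⁻¹ * (root n)⁻¹ ^ 2) atTop (𝓝 0) := by
      simpa using (tendsto_inv_root.pow 2).const_mul (K * c⁻¹)
    refine tendsto_of_tendsto_of_tendsto_of_le_of_le' tendsto_const_nhds hl
      (Eventually.of_forall fun n => div_nonneg (integral_nonneg fun _ => sq_nonneg _)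
        (Nat.cast_nonneg n)) ?_
    filter_upwards [hh, eventually_root_pos, h0.eventually (gt_mem_nhds hr)] with n hn hrn hnr
    simp_rw [mul_pow _ (kernelTerm _ _ _ _ _)]
    rw [integral_const_mul]
    have h1 := hz.integral_kernelTerm_sq_le hA hk.weight (s := t) hn
      fun x hx => hCg x (hx.trans hnr.le)
    rw [← hK] at h1
    rw [← root_pow n]
    calc _ ≤ (root n ^ 2 * (bandwidth c n)⁻¹) ^ 2 * (K * bandwidth c n) / root n ^ 7 := by gcongr
      _ = _ := by
        rw [bandwidth_eq]
        field_simp)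
  have hsum := hlln.add (hbias.comp tendsto_fst_inProb)
  rw [zero_add] at hsum
  refine hsum.congr' ?_
  filter_upwards [tendsto_fst_inProb.eventually hh,
    tendsto_fst_inProb.eventually eventually_root_pos] with p hp hrp
  simp only [Function.comp]
  have e1 : avg z (fun q => root p.1 ^ 2 * (bandwidth c p.1)⁻¹ *
      kernelTerm a k t (bandwidth c p.1) q) p.1 p.2 = root p.1 ^ 2 * (bandwidth c p.1)⁻¹ *
        avg z (kernelTerm a k t (bandwidth c p.1)) p.1 p.2 := by
    unfold avg
    rw [← Finset.mul_sum]
    ring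
  have e2 : c ^ 2 * (bandwidth c p.1 ^ 2)⁻¹ = root p.1 ^ 2 := by
    rw [bandwidth_eq]
    field_simp
  rw [e1, integral_const_mul, hz.integral_kernelTerm a hk.weight t hp, ← mul_assoc (c ^ 2), e2]
  field_simp
  ring

/-- The centered derivative estimate at `t` is asymptotically normal. -/
theorem convergesInLaw_deriv (hz : Sampling μ F g z) (hk : ConditionK k) (hF : Jet F f f₁ cF t)
    (hg : Jet g g₁ g₂ cg t) (hc : 0 < c) (a : Fin 2 → ℝ) {b : ℝ} {v : NNReal}
    (hv : (v : ℝ) = b ^ 2 * (c ^ 3)⁻¹ *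
      (weightedDensity F g (fun i => a i ^ 2) t * ∫ u, deriv k u ^ 2)) :
    ConvergesInLaw μ (fun n ω => root n ^ 2 * (b * (bandwidth c n ^ 2)⁻¹ *
      (avg z (kernelTerm a (deriv k) t (bandwidth c n)) n ω -
        ∫ ω, kernelTerm a (deriv k) t (bandwidth c n) (z 0 ω) ∂μ))) (gaussianReal 0 v) := by
  have hh := eventually_bandwidth_pos hc
  have h0 := tendsto_bandwidth c
  have hw := hk.weight_deriv
  obtain ⟨B, hB0, hB⟩ := exists_kernelTerm_bound a hw
  have hmeas := fun n => measurable_kernelTerm a hw t (bandwidth c n)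
  have hint : ∀ n, Integrable (fun ω => kernelTerm a (deriv k) t (bandwidth c n) (z 0 ω)) μ :=
    fun n => hz.iid.integrable_comp (hmeas n) (hB _ _) 0
  have hint2 : ∀ n, Integrable (fun ω => kernelTerm a (deriv k) t (bandwidth c n) (z 0 ω) ^ 2) μ :=
    fun n => (hz.iid.memLp_comp (hmeas n) (hB _ _) 0).integrable_sq
  obtain ⟨E, hE⟩ : ∃ E : ℕ → ℝ, ∀ n, E n = ∫ ω, kernelTerm a (deriv k) t (bandwidth c n) (z 0 ω) ∂μ :=
    ⟨_, fun _ => rfl⟩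
  have hEB : ∀ n, |E n| ≤ B := fun n => by
    rw [hE]
    have := norm_integral_le_of_norm_le_const (μ := μ)
      (f := fun ω => kernelTerm a (deriv k) t (bandwidth c n) (z 0 ω))
      (ae_of_all _ fun ω => hB _ _ _)
    simpa using this
  obtain ⟨C, hC⟩ : ∃ C : ℕ → ℝ, ∀ n, C n = root n ^ 2 * (b * (bandwidth c n ^ 2)⁻¹) * (n : ℝ)⁻¹ :=
    ⟨_, fun _ => rfl⟩
  -- The normalization per observation is of order `n^{-3/7}`, so bounded kernel terms become
  -- uniformly small summands.
  have hCe : ∀ᶠ n in atTop, C n = b * (c ^ 2)⁻¹ * (root n)⁻¹ ^ 3 := by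
    filter_upwards [eventually_root_pos] with n hn
    rw [hC, bandwidth_eq, ← root_pow]
    field_simp
  have key := hz.iid.convergesInLaw_sum (v := v)
    (φ := fun n p => C n * (kernelTerm a (deriv k) t (bandwidth c n) p - E n))
    (fun n => ((hmeas n).sub_const _).const_mul _) (b := fun n => |C n| * (2 * B))
    (fun n p => by
      rw [abs_mul]
      refine mul_le_mul_of_nonneg_left ?_ (abs_nonneg _)
      refine (abs_sub _ _).trans ?_
      linarith [hB t (bandwidth c n) p, hEB n]) (by
    have hl : Tendsto (fun n => |b * (c ^ 2)⁻¹ * (root n)⁻¹ ^ 3| * (2 * B)) atTop (𝓝 0) := by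
      have e0 : |b * (c ^ 2)⁻¹ * 0 ^ 3| * (2 * B) = 0 := by simp
      rw [← e0]
      exact (((tendsto_inv_root.pow 3).const_mul (b * (c ^ 2)⁻¹)).abs).mul_const (2 * B)
    refine hl.congr' ?_
    filter_upwards [hCe] with n hn
    rw [hn]) (fun n => by
      rw [integral_const_mul, integral_sub (hint n) (integrable_const _), ← hE]
      simp) ?_
  · intro x hx
    obtain ⟨k1, k2⟩ := key x hx
    have e : ∀ n ω, ∑ j ∈ Finset.range n, C n * (kernelTerm a (deriv k) t (bandwidth c n) (z j ω) -
        E n) = root n ^ 2 * (b * (bandwidth c n ^ 2)⁻¹ *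
      (avg z (kernelTerm a (deriv k) t (bandwidth c n)) n ω -
        ∫ ω, kernelTerm a (deriv k) t (bandwidth c n) (z 0 ω) ∂μ)) := by
      intro n ω
      rcases Nat.eq_zero_or_pos n with rfl | hn
      · simp [bandwidth, root]
      rw [← hE, ← Finset.mul_sum, Finset.sum_sub_distrib, avg, hC]
      have hn' : (n : ℝ) ≠ 0 := by positivity
      simp only [Finset.sum_const, Finset.card_range, nsmul_eq_mul]
      field_simp
    simp only [e] at k1 k2
    exact ⟨k1, k2⟩
  · have hlim1 := hw.sq.tendsto_integral_shift
      (hz.integrable_weightedDensity fun i => a i ^ 2)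
      (hF.weightedDensity hg fun i => a i ^ 2).continuousAt hh h0
    -- Since `k'` integrates to zero, the mean `E n` is of order `h²`, and its square drops out of
    -- the limiting variance, while `n C² h = b² / c³` is constant.
    have hlim2 : Tendsto (fun n => (bandwidth c n ^ 2)⁻¹ * E n) atTop
        (𝓝 ((a 1 - a 0) * f t * g t + (a 0 + (a 1 - a 0) * F t) * g₁ t)) := by
      obtain ⟨ρ, hρ, D, hD, hbias⟩ := hk.exists_uniform_bias_bound
        (hz.integrable_weightedDensity a) (hF.weightedDensity hg a)
      rw [tendsto_iff_norm_sub_tendsto_zero]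
      have hs : Tendsto (fun n => D * bandwidth c n) atTop (𝓝 0) := by simpa using h0.const_mul D
      refine squeeze_zero' (Eventually.of_forall fun _ => norm_nonneg _) ?_ hs
      filter_upwards [hh, h0.eventually (gt_mem_nhds hρ)] with n hn hnρ
      have := (hbias t (bandwidth c n) (by simpa using hρ.le) hn hnρ.le).2
      rw [hE, hz.integral_kernelTerm a hw t hn, Real.norm_eq_abs]
      convert! this using 3
      field_simp
    have hlim3 := ((hlim1.const_mul (b ^ 2 * (c ^ 3)⁻¹)).sub
      (((tendsto_inv_root.pow 3).const_mul (b ^ 2)).mul (hlim2.pow 2)))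
    rw [hv]
    simp only [ne_eq, OfNat.ofNat_ne_zero, not_false_eq_true, zero_pow, mul_zero, zero_mul,
      sub_zero] at hlim3
    refine hlim3.congr' ?_
    filter_upwards [hh, eventually_root_pos, hCe] with n hn hrn hCn
    have e1 : ∫ ω, (C n * (kernelTerm a (deriv k) t (bandwidth c n) (z 0 ω) - E n)) ^ 2 ∂μ =
        C n ^ 2 * ((bandwidth c n * ∫ v, deriv k v ^ 2 *
          weightedDensity F g (fun i => a i ^ 2) (t - bandwidth c n * v)) - E n ^ 2) := by
      rw [← hz.integral_kernelTerm _ hw.sq t hn]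
      have e2 : ∀ ω, (C n * (kernelTerm a (deriv k) t (bandwidth c n) (z 0 ω) - E n)) ^ 2 =
          C n ^ 2 * (kernelTerm a (deriv k) t (bandwidth c n) (z 0 ω) ^ 2 -
            (2 * E n * kernelTerm a (deriv k) t (bandwidth c n) (z 0 ω) - E n ^ 2)) := by
        intro ω
        ring
      simp_rw [e2]
      have i1 : Integrable (fun ω => 2 * E n * kernelTerm a (deriv k) t (bandwidth c n) (z 0 ω)) μ :=
        (hint n).const_mul _
      have i2 : Integrable (fun ω => 2 * E n * kernelTerm a (deriv k) t (bandwidth c n) (z 0 ω) -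
        E n ^ 2) μ := i1.sub (integrable_const _)
      rw [integral_const_mul, integral_sub (hint2 n) i2, integral_sub i1 (integrable_const _),
        integral_const_mul, ← hE]
      simp_rw [kernelTerm_sq]
      simp
      ring_nf
      simp
    rw [e1, hCn, ← root_pow, bandwidth_eq]
    field_simp

end Sampling

/-! ### The boundary kernel -/

namespace ConditionK

variable {k : ℝ → ℝ} (hk : ConditionK k)
include hk

theorem continuous_pow_mul (i : ℕ) : Continuous fun u => u ^ i * k u :=
  (continuous_pow i).mul hk.weight.continuous

theorem continuous_nu (i : ℕ) : Continuous (nu k i) :=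
  intervalIntegral.continuous_primitive
    (fun _ _ => (hk.continuous_pow_mul i).intervalIntegrable _ _) _

/-- By symmetry `k` is positive somewhere left of `0`, and by continuity at nearby points too, so
one of them avoids `m`. Every interval `[-1, β]` with `β ≥ 0` thus carries nondegenerate mass. -/
theorem exists_pos_ne (m : ℝ) : ∃ v ∈ Icc (-1 : ℝ) 0, v ≠ m ∧ 0 < k v := by
  obtain ⟨v, hv, hkv⟩ := hk.exists_pos
  have hv1 : |v| ≤ 1 := by
    by_contra h
    rw [hk.eq_zero (not_le.1 h)] at hkv
    exact lt_irrefl _ hkv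
  have hneg : 0 < k (-|v|) := by
    rcases abs_choice v with h | h
    · rw [h, hk.symm]
      exact hkv
    · rwa [h, neg_neg]
  have hlt : -|v| < 0 := neg_lt_zero.2 (abs_pos.2 hv)
  by_cases hm : -|v| = m
  · have e1 : ∀ᶠ x in 𝓝 (-|v|), 0 < k x ∧ x < 0 :=
      (hk.weight.continuous.continuousAt.eventually (lt_mem_nhds hneg)).and (gt_mem_nhds hlt)
    obtain ⟨x, hx, hx'⟩ := ((e1.filter_mono nhdsWithin_le_nhds).and
      (self_mem_nhdsWithin : Ioi (-|v|) ∈ 𝓝[>] (-|v|))).exists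
    refine ⟨x, ⟨?_, hx.2.le⟩, ?_, hx.1⟩
    · have : -|v| < x := hx'
      linarith
    · rw [← hm]
      exact ne_of_gt hx'
  · exact ⟨-|v|, ⟨by linarith, hlt.le⟩, hm, hneg⟩

theorem nu_zero_pos {β : ℝ} (hβ : 0 ≤ β) : 0 < nu k 0 β := by
  obtain ⟨v, hv, _, hkv⟩ := hk.exists_pos_ne 1
  refine intervalIntegral.integral_pos (by linarith) (hk.continuous_pow_mul 0).continuousOn
    (fun x _ => by simpa using hk.nonneg x) ⟨v, ⟨hv.1, hv.2.trans hβ⟩, by simpa using hkv⟩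

/-- The determinant is `ν₀` times `∫ (u - m)² k` over `[-1, β]` with `m = ν₁ / ν₀`, a variance up to
normalization. -/
theorem nu_det_pos {β : ℝ} (hβ : 0 ≤ β) : 0 < nu k 0 β * nu k 2 β - nu k 1 β ^ 2 := by
  have h0 := hk.nu_zero_pos hβ
  obtain ⟨v, hv, hvm, hkv⟩ := hk.exists_pos_ne (nu k 1 β / nu k 0 β)
  have hpos : 0 < ∫ u in (-1)..β, (u - nu k 1 β / nu k 0 β) ^ 2 * k u := by
    refine intervalIntegral.integral_pos (by linarith)
      (Continuous.continuousOn (by have := hk.weight.continuous; fun_prop))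
      (fun x _ => mul_nonneg (sq_nonneg _) (hk.nonneg x)) ⟨v, ⟨hv.1, hv.2.trans hβ⟩, ?_⟩
    have := sub_ne_zero.2 hvm
    positivity
  have e : ∀ m, ∫ u in (-1)..β, (u - m) ^ 2 * k u =
      nu k 2 β - 2 * m * nu k 1 β + m ^ 2 * nu k 0 β := by
    intro m
    have i := fun j => (hk.continuous_pow_mul j).intervalIntegrable (μ := volume) (-1) β
    have e1 : ∀ u, (u - m) ^ 2 * k u =
        (u ^ 2 * k u - 2 * m * (u ^ 1 * k u)) + m ^ 2 * (u ^ 0 * k u) := fun u => by ring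
    simp_rw [e1]
    rw [intervalIntegral.integral_add ((i 2).sub ((i 1).const_mul _)) ((i 0).const_mul _),
      intervalIntegral.integral_sub (i 2) ((i 1).const_mul _),
      intervalIntegral.integral_const_mul, intervalIntegral.integral_const_mul]
    rfl
  rw [e] at hpos
  have e2 : nu k 0 β * nu k 2 β - nu k 1 β ^ 2 = nu k 0 β *
      (nu k 2 β - 2 * (nu k 1 β / nu k 0 β) * nu k 1 β +
        (nu k 1 β / nu k 0 β) ^ 2 * nu k 0 β) := by
    field_simp
    ring
  rw [e2]
  exact mul_pos h0 hpos

/-- Compactness: without its indicator the boundary kernel is continuous on `[0, 1] × [-1, 1]`,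
because the determinant does not vanish. -/
theorem exists_boundaryKernel_bound :
    ∃ C, 0 < C ∧ (∀ β ∈ Icc (0 : ℝ) 1, ∀ u, |boundaryKernel k β u| ≤ C) ∧ ∀ u, |k u| ≤ C := by
  obtain ⟨B, hB0, hB⟩ := hk.weight.exists_bound
  have hc : ContinuousOn (fun p : ℝ × ℝ => (nu k 2 p.1 - nu k 1 p.1 * p.2) /
      (nu k 0 p.1 * nu k 2 p.1 - nu k 1 p.1 ^ 2) * k p.2) (Icc 0 1 ×ˢ Icc (-1) 1) := by
    have h0 := hk.continuous_nu 0
    have h1 := hk.continuous_nu 1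
    have h2 := hk.continuous_nu 2
    have h3 := hk.weight.continuous
    refine ContinuousOn.mul (ContinuousOn.div (by fun_prop) (by fun_prop) ?_) (by fun_prop)
    intro p hp
    exact (hk.nu_det_pos hp.1.1).ne'
  obtain ⟨C, hC⟩ := (isCompact_Icc.prod isCompact_Icc).exists_bound_of_continuousOn hc
  refine ⟨|C| + B, by positivity, fun β hβ u => ?_, fun u => (hB u).trans (by
    linarith [abs_nonneg C])⟩
  unfold boundaryKernel
  by_cases hu : u ∈ Ioo (-1) β
  · rw [indicator_of_mem hu]
    have := hC (β, u) ⟨hβ, hu.1.le, hu.2.le.trans hβ.2⟩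
    rw [Real.norm_eq_abs] at this
    exact this.trans (by linarith [le_abs_self C])
  · rw [indicator_of_notMem hu]
    simp
    positivity

theorem measurable_smoothingWeight (h u : ℝ) : Measurable fun s => smoothingWeight k h s u := by
  have h0 := (hk.continuous_nu 0).measurable
  have h1 := (hk.continuous_nu 1).measurable
  have h2 := (hk.continuous_nu 2).measurable
  have h3 := hk.weight.continuous.measurable
  unfold smoothingWeight boundaryKernel
  refine Measurable.ite ?_ (Measurable.const_mul ?_ _) (by fun_prop)
  · exact measurableSet_Icc (a := (0 : ℝ)) (b := h)
  · have m1 : Measurable fun s : ℝ => (s - u) / h := by fun_prop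
    have m2 : Measurable fun s : ℝ => s / h := by fun_prop
    have hset : MeasurableSet {s : ℝ | (s - u) / h ∈ Ioo (-1) (s / h)} := by
      have e : {s : ℝ | (s - u) / h ∈ Ioo (-1) (s / h)} =
          {s | -1 < (s - u) / h} ∩ {s | (s - u) / h < s / h} := by
        ext s
        simp
      rw [e]
      exact (measurableSet_lt measurable_const m1).inter (measurableSet_lt m1 m2)
    simp only [indicator]
    exact Measurable.ite hset (by fun_prop) measurable_const

theorem intervalIntegrable_smoothingWeight {h : ℝ} (hh : 0 < h) (u a b : ℝ) :
    IntervalIntegrable (fun s => smoothingWeight k h s u) volume a b := by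
  obtain ⟨C, hC0, hC, hC'⟩ := hk.exists_boundaryKernel_bound
  refine IntervalIntegrable.mono_fun (f := fun _ => h⁻¹ * C) intervalIntegrable_const
    (hk.measurable_smoothingWeight h u).aestronglyMeasurable (ae_of_all _ fun s => ?_)
  simp only [Real.norm_eq_abs]
  rw [abs_of_pos (by positivity : 0 < h⁻¹ * C)]
  unfold smoothingWeight
  split_ifs with hs
  · rw [abs_mul, abs_of_pos (inv_pos.2 hh)]
    have : s / h ∈ Icc (0 : ℝ) 1 := ⟨div_nonneg hs.1 hh.le, (div_le_one hh).2 hs.2⟩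
    have := hC _ this ((s - u) / h)
    gcongr
  · rw [abs_mul, abs_of_pos (inv_pos.2 hh)]
    have := hC' ((s - u) / h)
    gcongr

theorem hasDerivAt_nu_zero (v : ℝ) : HasDerivAt (nu k 0) (k v) v := by
  have h := intervalIntegral.integral_hasDerivAt_right
    ((hk.continuous_pow_mul 0).intervalIntegrable (-1) v)
    ((hk.continuous_pow_mul 0).stronglyMeasurableAtFilter _ _)
    (hk.continuous_pow_mul 0).continuousAt
  rw [pow_zero, one_mul] at h
  exact h

theorem monotone_nu_zero : Monotone (nu k 0) :=
  monotone_of_deriv_nonneg (fun v => (hk.hasDerivAt_nu_zero v).differentiableAt) fun v => by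
    rw [(hk.hasDerivAt_nu_zero v).deriv]
    exact hk.nonneg v

theorem nu_zero_eq_zero {v : ℝ} (hv : v ≤ -1) : nu k 0 v = 0 := by
  unfold nu
  rw [intervalIntegral.integral_symm, neg_eq_zero]
  refine intervalIntegral.integral_zero_ae (ae_of_all _ fun u hu => ?_)
  rw [uIoc_of_le hv] at hu
  have h1 : k u = 0 := by
    rcases hu.2.lt_or_eq with h | h
    · exact hk.eq_zero (by rw [abs_of_neg (by linarith)]; linarith)
    -- At the end point itself, `k` vanishes by continuity from the left.
    · subst h
      by_contra hne
      have e1 : ∀ᶠ x in 𝓝 (-1 : ℝ), k x ≠ 0 :=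
        hk.weight.continuous.continuousAt.eventually_ne hne
      obtain ⟨x, hx, hx'⟩ := ((e1.filter_mono nhdsWithin_le_nhds).and
        (self_mem_nhdsWithin : Iio (-1 : ℝ) ∈ 𝓝[<] (-1 : ℝ))).exists
      have : x < -1 := hx'
      exact hx (hk.eq_zero (by rw [abs_of_neg (by linarith)]; linarith))
  simp [h1]

theorem nu_zero_eq_one {v : ℝ} (hv : 1 ≤ v) : nu k 0 v = 1 := by
  have h1 : nu k 0 v = ∫ u in Ioc (-1) v, k u := by
    unfold nu
    rw [intervalIntegral.integral_of_le (by linarith)]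
    simp
  refine h1.trans (Eq.trans ?_ hk.integral_eq_one)
  rw [setIntegral_eq_integral_of_ae_compl_eq_zero]
  have h2 : ∀ᵐ u : ℝ, u ≠ -1 := by simp [ae_iff]
  filter_upwards [h2] with u hu hnot
  refine hk.eq_zero ?_
  by_contra hcon
  rw [not_lt, abs_le] at hcon
  exact hnot ⟨lt_of_le_of_ne hcon.1 (Ne.symm hu), hcon.2.trans hv⟩

theorem nu_zero_nonneg (v : ℝ) : 0 ≤ nu k 0 v := by
  rw [← hk.nu_zero_eq_zero (min_le_right v (-1))]
  exact hk.monotone_nu_zero (min_le_left _ _)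

theorem nu_zero_le_one (v : ℝ) : nu k 0 v ≤ 1 := by
  rw [← hk.nu_zero_eq_one (le_max_right v 1)]
  exact hk.monotone_nu_zero (le_max_left _ _)

/-- Up to the boundary correction, integrating the smoothing weight gives the distribution function
of the rescaled kernel. -/
theorem exists_integral_smoothingWeight_bound : ∃ C, 0 < C ∧ ∀ h, 0 < h → ∀ u, 0 ≤ u → ∀ x,
    |(∫ s in (0)..u, smoothingWeight k h s x) - nu k 0 ((u - x) / h)| ≤
      C * (Iic (2 * h)).indicator 1 x := by
  obtain ⟨C, hC0, hC, hC'⟩ := hk.exists_boundaryKernel_bound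
  refine ⟨C + 1, by positivity, fun h hh u hu x => ?_⟩
  -- For `u ≤ h` the integral is at most `C` in absolute value and `ν₀` at most `1`; observations
  -- beyond `2h` contribute to neither.
  have hsmall : ∀ u, 0 ≤ u → u ≤ h →
      |(∫ s in (0)..u, smoothingWeight k h s x) - nu k 0 ((u - x) / h)| ≤
        (C + 1) * (Iic (2 * h)).indicator 1 x := by
    intro u hu huh
    by_cases hx : x ≤ 2 * h
    · rw [indicator_of_mem (mem_Iic.2 hx), Pi.one_apply, mul_one]
      have h1 : ‖∫ s in (0)..u, smoothingWeight k h s x‖ ≤ h⁻¹ * C * |u - 0| := by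
        refine intervalIntegral.norm_integral_le_of_norm_le_const fun s hs => ?_
        rw [uIoc_of_le hu] at hs
        rw [smoothingWeight, if_pos ⟨hs.1.le, hs.2.trans huh⟩, norm_mul, norm_inv,
          Real.norm_of_nonneg hh.le]
        have : s / h ∈ Icc (0 : ℝ) 1 :=
          ⟨div_nonneg hs.1.le hh.le, (div_le_one hh).2 (hs.2.trans huh)⟩
        exact mul_le_mul_of_nonneg_left (hC _ this _) (inv_pos.2 hh).le
      rw [sub_zero, abs_of_nonneg hu, Real.norm_eq_abs] at h1
      have h2 : h⁻¹ * C * u ≤ C := by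
        calc h⁻¹ * C * u ≤ h⁻¹ * C * h := by gcongr
          _ = C := by field_simp
      have h3 := hk.nu_zero_nonneg ((u - x) / h)
      have h4 := hk.nu_zero_le_one ((u - x) / h)
      refine (abs_sub _ _).trans ?_
      rw [abs_of_nonneg h3]
      linarith
    · rw [indicator_of_notMem (by simpa using hx), mul_zero]
      rw [not_le] at hx
      have h1 : ∫ s in (0)..u, smoothingWeight k h s x = 0 := by
        refine intervalIntegral.integral_zero_ae (ae_of_all _ fun s hs => ?_)
        rw [uIoc_of_le hu] at hs
        rw [smoothingWeight, if_pos ⟨hs.1.le, hs.2.trans huh⟩, boundaryKernel,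
          indicator_of_notMem, mul_zero]
        intro hmem
        have := hmem.1
        rw [lt_div_iff₀ hh] at this
        linarith [hs.2]
      rw [h1, hk.nu_zero_eq_zero, sub_zero, abs_zero]
      rw [div_le_iff₀ hh]
      linarith
  rcases le_or_gt u h with huh | huh
  · exact hsmall u hu huh
  -- Beyond `h` the weight is the exact derivative of `s ↦ ν₀((s - x) / h)`, so the discrepancy at
  -- `u` equals the one at `h`.
  · have h1 : ∫ s in h..u, smoothingWeight k h s x =
        nu k 0 ((u - x) / h) - nu k 0 ((h - x) / h) := by
      have h2 : ∫ s in h..u, smoothingWeight k h s x = ∫ s in h..u, k ((s - x) / h) * h⁻¹ := by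
        refine intervalIntegral.integral_congr_ae (ae_of_all _ fun s hs => ?_)
        rw [uIoc_of_le huh.le] at hs
        rw [smoothingWeight, if_neg (fun hcon => absurd hs.1 (not_lt.2 hcon.2)), mul_comm]
      rw [h2]
      refine intervalIntegral.integral_eq_sub_of_hasDerivAt
        (f := fun s => nu k 0 ((s - x) / h)) (fun s _ => ?_) ?_
      · have e1 : HasDerivAt (fun s : ℝ => (s - x) / h) h⁻¹ s := by
          simpa using ((hasDerivAt_id s).sub_const x).div_const h
        exact (hk.hasDerivAt_nu_zero _).comp s e1
      · have := hk.weight.continuous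
        exact Continuous.intervalIntegrable (by fun_prop) _ _
    rw [← intervalIntegral.integral_add_adjacent_intervals
      (hk.intervalIntegrable_smoothingWeight hh x 0 h)
      (hk.intervalIntegrable_smoothingWeight hh x h u), h1]
    have := hsmall h hh.le le_rfl
    rwa [show (∫ s in (0)..h, smoothingWeight k h s x) +
      (nu k 0 ((u - x) / h) - nu k 0 ((h - x) / h)) - nu k 0 ((u - x) / h) =
      (∫ s in (0)..h, smoothingWeight k h s x) - nu k 0 ((h - x) / h) by ring]

end ConditionK

/-! ### Uniform consistency of the smoothed distribution functions -/

/-- The indicator of the value `i` of `Δ`. -/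
noncomputable def ind (i j : Fin 2) : ℝ := if j = i then 1 else 0

theorem ind_nonneg (i j : Fin 2) : 0 ≤ ind i j := by
  unfold ind
  split_ifs <;> norm_num

theorem ind_le_one (i j : Fin 2) : ind i j ≤ 1 := by
  unfold ind
  split_ifs <;> norm_num

theorem gHat_eq_avg {Ω : Type*} (k : ℝ → ℝ) (h : ℝ) (n : ℕ) (z : ℕ → Ω → ℝ × Fin 2) (ω : Ω) (i : Fin 2)
    (s : ℝ) : gHat k h n (fun j => z j ω) i s =
      avg z (fun p => ind i p.2 * smoothingWeight k h s p.1) n ω := by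
  unfold gHat avg ind
  simp

theorem GHat_eq_avg {Ω : Type*} {k : ℝ → ℝ} (hk : ConditionK k) {h : ℝ} (hh : 0 < h) (n : ℕ) (z : ℕ → Ω → ℝ × Fin 2)
    (ω : Ω) (i : Fin 2) (u : ℝ) : GHat k h n (fun j => z j ω) i u =
      avg z (fun p => ind i p.2 * ∫ s in (0)..u, smoothingWeight k h s p.1) n ω := by
  unfold GHat
  simp_rw [gHat_eq_avg]
  unfold avg
  rw [intervalIntegral.integral_const_mul, intervalIntegral.integral_finsetSum]
  · simp_rw [intervalIntegral.integral_const_mul]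
  · exact fun j _ => (hk.intervalIntegrable_smoothingWeight hh _ _ _).const_mul _

namespace Sampling

variable {Ω : Type*} [MeasurableSpace Ω] {μ : Measure Ω} {F g : ℝ → ℝ} {z : ℕ → Ω → ℝ × Fin 2}
  {k : ℝ → ℝ}

theorem weightedDensity_nonneg (hz : Sampling μ F g z) (i : Fin 2) (u : ℝ) :
    0 ≤ weightedDensity F g (ind i) u :=
  mul_nonneg (hz.weight_nonneg (ind_nonneg i) u) (hz.g_nonneg u)

variable [IsProbabilityMeasure μ]

/-- The proportion of observation times in the boundary zone; its mean vanishes by dominated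
convergence because `T` has no mass on `(-∞, 0]`. It controls the boundary correction to `GHat`. -/
theorem tendsto_avg_indicator_Iic (hz : Sampling μ F g z) {h : ℕ → ℝ}
    (h0 : Tendsto h atTop (𝓝 0)) :
    Tendsto (fun p : ℕ × Ω => avg z (fun q => (Iic (2 * h p.1)).indicator 1 q.1) p.1 p.2)
      (inProb μ) (𝓝 0) := by
  have hm : ∀ n, Measurable ((Iic (2 * h n)).indicator (1 : ℝ → ℝ)) := fun n =>
    measurable_one.indicator measurableSet_Iic
  have hb : ∀ n x, |(Iic (2 * h n)).indicator (1 : ℝ → ℝ) x| ≤ 1 := fun n x => by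
    by_cases hx : x ∈ Iic (2 * h n)
    · simp [indicator_of_mem hx]
    · simp [indicator_of_notMem hx]
  refine hz.iid.tendsto_avg_of_bounded (φ := fun n q => (Iic (2 * h n)).indicator 1 q.1)
    (fun n => (hm n).comp measurable_fst) (B := 1) (fun n q => hb n q.1) ?_
  have e : ∀ n, ∫ ω, (Iic (2 * h n)).indicator (1 : ℝ → ℝ) (z 0 ω).1 ∂μ =
      ∫ u, g u * (Iic (2 * h n)).indicator 1 u := by
    intro n
    have := hz.law (fun _ => 1) _ 1 (hm n) (hb n)
    simpa [weightedDensity] using this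
  simp_rw [e]
  rw [← integral_zero ℝ ℝ (μ := volume)]
  refine tendsto_integral_of_dominated_convergence g
    (fun n => hz.g_integrable.aestronglyMeasurable.mul (hm n).aestronglyMeasurable)
    hz.g_integrable (fun n => ae_of_all _ fun u => ?_) ?_
  · rw [norm_mul, Real.norm_of_nonneg (hz.g_nonneg u)]
    exact mul_le_of_le_one_right (hz.g_nonneg u) (hb n u)
  · filter_upwards [hz.g_neg] with u hu
    rcases le_or_gt u 0 with h1 | h1
    · simp [hu h1]
    · refine tendsto_const_nhds.congr' ?_
      filter_upwards [h0.eventually (gt_mem_nhds (half_pos h1))] with n hn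
      rw [indicator_of_notMem (by simp; linarith), mul_zero]

theorem measurable_ind_mul (i : Fin 2) {w : ℝ → ℝ} (hw : Measurable w) :
    Measurable fun p : ℝ × Fin 2 => ind i p.2 * w p.1 :=
  ((measurable_of_finite (ind i)).comp measurable_snd).mul (hw.comp measurable_fst)

theorem abs_ind_mul_le (i : Fin 2) {w : ℝ → ℝ} (hw0 : ∀ x, 0 ≤ w x) (hw1 : ∀ x, w x ≤ 1)
    (p : ℝ × Fin 2) : |ind i p.2 * w p.1| ≤ 1 := by
  rw [abs_of_nonneg (mul_nonneg (ind_nonneg _ _) (hw0 _))]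
  exact mul_le_one₀ (ind_le_one _ _) (hw0 _) (hw1 _)

/-- The smoothed empirical subdistributions are monotone in `u` and converge pointwise, with their
total masses, by the weak law; monotonicity upgrades this to uniform convergence. -/
theorem eventually_abs_smoothed_sub_lt (hz : Sampling μ F g z) (hk : ConditionK k) {h : ℕ → ℝ}
    (hn : ∀ n, 0 ≤ h n) (hh : ∀ᶠ n in atTop, 0 < h n) (h0 : Tendsto h atTop (𝓝 0)) (i : Fin 2)
    {ε : ℝ} (hε : 0 < ε) :
    ∀ᶠ p in inProb μ, ∀ u,
      |avg z (fun q => ind i q.2 * nu k 0 ((u - q.1) / h p.1)) p.1 p.2 -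
        ∫ x in Iic u, weightedDensity F g (ind i) x| < ε := by
  set φ := weightedDensity F g (ind i) with hφdef
  have hφ : Integrable φ := hz.integrable_weightedDensity _
  have hφ0 : ∀ u, 0 ≤ φ u := hz.weightedDensity_nonneg i
  have hnum : ∀ u n, Measurable fun x => nu k 0 ((u - x) / h n) := fun u n =>
    (hk.continuous_nu 0).measurable.comp (by fun_prop)
  have hshift : ∀ u, ∫ x in Iic u, φ x = (∫ x in Iic 0, φ x) + ∫ x in (0)..u, φ x := fun u => by
    rw [← intervalIntegral.integral_Iic_sub_Iic hφ.integrableOn hφ.integrableOn]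
    ring
  refine eventually_abs_sub_lt_of_monotone
    (Y := fun (p : ℕ × Ω) u => avg z (fun q => ind i q.2 * nu k 0 ((u - q.1) / h p.1)) p.1 p.2)
    (c := fun p => avg z (fun q => ind i q.2 * 1) p.1 p.2) (m := ∫ x, φ x)
    ?_ ?_ ?_ ?_ ?_ ?_ ?_ ?_ ?_ hε
  · intro p u u' huu
    refine mul_le_mul_of_nonneg_left (Finset.sum_le_sum fun j _ => ?_) (by positivity)
    refine mul_le_mul_of_nonneg_left (hk.monotone_nu_zero ?_) (ind_nonneg _ _)
    exact div_le_div_of_nonneg_right (by linarith) (hn _)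
  · intro p u
    exact mul_nonneg (by positivity) (Finset.sum_nonneg fun j _ =>
      mul_nonneg (ind_nonneg _ _) (hk.nu_zero_nonneg _))
  · intro p u
    refine mul_le_mul_of_nonneg_left (Finset.sum_le_sum fun j _ => ?_) (by positivity)
    exact mul_le_mul_of_nonneg_left (hk.nu_zero_le_one _) (ind_nonneg _ _)
  · rw [funext hshift]
    exact continuous_const.add
      (intervalIntegral.continuous_primitive (fun _ _ => hφ.intervalIntegrable) 0)
  · intro u u' huu
    exact setIntegral_mono_set hφ.integrableOn (ae_of_all _ hφ0)
      (LE.le.eventuallyLE (Iic_subset_Iic.2 huu))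
  · refine tendsto_const_nhds.congr' ?_
    filter_upwards [eventually_le_atBot 0] with u hu
    symm
    refine setIntegral_eq_zero_of_ae_eq_zero ?_
    filter_upwards [hz.g_neg] with x hx hxu
    simp [hφdef, weightedDensity, hx (hxu.trans hu)]
  · exact (aecover_Iic tendsto_id).integral_tendsto_of_countably_generated hφ
  · refine hz.iid.tendsto_avg_of_bounded (φ := fun _ q => ind i q.2 * 1)
      (fun _ => measurable_ind_mul i (w := fun _ => 1) measurable_const) (B := 1)
      (fun _ q => abs_ind_mul_le i (w := fun _ => 1) (by simp) (by simp) q) ?_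
    have := hz.law (ind i) (fun _ => 1) 1 measurable_const (by simp)
    simp only [mul_one] at this ⊢
    rw [this]
    exact tendsto_const_nhds
  · intro u
    refine hz.iid.tendsto_avg_of_bounded
      (φ := fun n q => ind i q.2 * nu k 0 ((u - q.1) / h n))
      (fun n => measurable_ind_mul i (hnum u n)) (B := 1)
      (fun n q => abs_ind_mul_le i (fun _ => hk.nu_zero_nonneg _)
        (fun _ => hk.nu_zero_le_one _) q) ?_
    have e : ∀ n, ∫ ω, ind i (z 0 ω).2 * nu k 0 ((u - (z 0 ω).1) / h n) ∂μ =
        ∫ x, φ x * nu k 0 ((u - x) / h n) := fun n =>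
      hz.law (ind i) (fun x => nu k 0 ((u - x) / h n)) 1 (hnum u n) fun x => by
        rw [abs_of_nonneg (hk.nu_zero_nonneg _)]
        exact hk.nu_zero_le_one _
    simp_rw [e]
    rw [← integral_indicator measurableSet_Iic]
    refine tendsto_integral_of_dominated_convergence φ
      (fun n => hφ.aestronglyMeasurable.mul (hnum u n).aestronglyMeasurable) hφ
      (fun n => ae_of_all _ fun x => ?_) ?_
    · rw [norm_mul, Real.norm_of_nonneg (hφ0 x), Real.norm_of_nonneg (hk.nu_zero_nonneg _)]
      exact mul_le_of_le_one_right (hφ0 x) (hk.nu_zero_le_one _)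
    · have hne : ∀ᵐ x : ℝ, x ≠ u := by simp [ae_iff]
      filter_upwards [hne] with x hx
      refine tendsto_const_nhds.congr' ?_
      rcases lt_or_gt_of_ne hx with hxu | hxu
      · filter_upwards [hh, h0.eventually (gt_mem_nhds (sub_pos.2 hxu))] with n hn1 hn2
        rw [indicator_of_mem (mem_Iic.2 hxu.le), hk.nu_zero_eq_one, mul_one]
        rw [le_div_iff₀ hn1]
        linarith
      · filter_upwards [hh, h0.eventually (gt_mem_nhds (sub_pos.2 hxu))] with n hn1 hn2
        rw [indicator_of_notMem (by simpa using hxu), hk.nu_zero_eq_zero, mul_zero]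
        rw [div_le_iff₀ hn1]
        linarith

/-- The integrated kernel estimators are uniformly consistent. -/
theorem eventually_abs_GHat_sub_lt (hz : Sampling μ F g z) (hk : ConditionK k) {h : ℕ → ℝ}
    (hn : ∀ n, 0 ≤ h n) (hh : ∀ᶠ n in atTop, 0 < h n) (h0 : Tendsto h atTop (𝓝 0)) (i : Fin 2)
    {ε : ℝ} (hε : 0 < ε) :
    ∀ᶠ p in inProb μ, ∀ u, 0 ≤ u →
      |GHat k (h p.1) p.1 (fun j => z j p.2) i u -
        ∫ x in Iic u, weightedDensity F g (ind i) x| < ε := by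
  obtain ⟨C, hC0, hC⟩ := hk.exists_integral_smoothingWeight_bound
  have hsmall := (hz.tendsto_avg_indicator_Iic h0).const_mul C
  rw [mul_zero] at hsmall
  filter_upwards [hz.eventually_abs_smoothed_sub_lt hk hn hh h0 i (half_pos hε),
    tendsto_fst_inProb.eventually hh, hsmall.eventually (gt_mem_nhds (half_pos hε))]
    with p hp hpos hps u hu
  have h1 : |GHat k (h p.1) p.1 (fun j => z j p.2) i u -
      avg z (fun q => ind i q.2 * nu k 0 ((u - q.1) / h p.1)) p.1 p.2| ≤
      C * avg z (fun q => (Iic (2 * h p.1)).indicator 1 q.1) p.1 p.2 := by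
    rw [GHat_eq_avg hk hpos]
    unfold avg
    rw [← mul_sub, ← Finset.sum_sub_distrib, abs_mul, abs_of_nonneg (by positivity), mul_left_comm]
    refine mul_le_mul_of_nonneg_left ?_ (by positivity)
    rw [Finset.mul_sum]
    refine (Finset.abs_sum_le_sum_abs _ _).trans (Finset.sum_le_sum fun j _ => ?_)
    rw [← mul_sub, abs_mul, abs_of_nonneg (ind_nonneg _ _)]
    exact (mul_le_of_le_one_left (abs_nonneg _) (ind_le_one _ _)).trans (hC _ hpos u hu _)
  exact (abs_sub_le _ _ _).trans_lt (by linarith [hp u])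

end Sampling

/-! ### The kernel estimators away from the boundary -/

section Interior

variable {Ω : Type*} {k : ℝ → ℝ} {h : ℝ} {n : ℕ} {z : ℕ → Ω → ℝ × Fin 2} {ω : Ω}

theorem gHat_eq_of_lt {s : ℝ} (hs : h < s) (i : Fin 2) :
    gHat k h n (fun j => z j ω) i s = h⁻¹ * avg z (kernelTerm (ind i) k s h) n ω := by
  rw [gHat_eq_avg]
  unfold avg kernelTerm
  rw [mul_left_comm]
  congr 1
  rw [Finset.mul_sum]
  refine Finset.sum_congr rfl fun j _ => ?_
  have e : smoothingWeight k h s (z j ω).1 = h⁻¹ * k ((s - (z j ω).1) / h) :=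
    if_neg fun hcon => absurd hs (not_lt.2 hcon.2)
  simp only [e]
  ring

theorem hasDerivAt_gHat (hk : ConditionK k) {s : ℝ} (hs : h < s) (i : Fin 2) :
    HasDerivAt (gHat k h n (fun j => z j ω) i)
      ((h ^ 2)⁻¹ * avg z (kernelTerm (ind i) (deriv k) s h) n ω) s := by
  have h1 : HasDerivAt (fun s => h⁻¹ * avg z (kernelTerm (ind i) k s h) n ω)
      (h⁻¹ * ((n : ℝ)⁻¹ * ∑ j ∈ Finset.range n,
        ind i (z j ω).2 * (deriv k ((s - (z j ω).1) / h) * h⁻¹))) s := by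
    unfold avg kernelTerm
    refine ((HasDerivAt.fun_sum fun j _ => ?_).const_mul _).const_mul _
    refine HasDerivAt.const_mul _ ?_
    have e1 : HasDerivAt (fun s : ℝ => (s - (z j ω).1) / h) h⁻¹ s := by
      simpa using ((hasDerivAt_id s).sub_const (z j ω).1).div_const h
    exact (hk.hasDerivAt _).comp s e1
  have h2 : h⁻¹ * ((n : ℝ)⁻¹ * ∑ j ∈ Finset.range n,
      ind i (z j ω).2 * (deriv k ((s - (z j ω).1) / h) * h⁻¹)) =
      (h ^ 2)⁻¹ * avg z (kernelTerm (ind i) (deriv k) s h) n ω := by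
    unfold avg kernelTerm
    simp_rw [← mul_assoc]
    rw [← Finset.sum_mul, sq, mul_inv]
    ring
  rw [h2] at h1
  refine h1.congr_of_eventuallyEq ?_
  filter_upwards [lt_mem_nhds hs] with s' hs'
  exact gHat_eq_of_lt hs' i

theorem intervalIntegrable_gHat (hk : ConditionK k) (hh : 0 < h) (i : Fin 2) (a b : ℝ) :
    IntervalIntegrable (gHat k h n (fun j => z j ω) i) volume a b := by
  have e : gHat k h n (fun j => z j ω) i = fun s => (n : ℝ)⁻¹ * ∑ j ∈ Finset.range n,
      ind i (z j ω).2 * smoothingWeight k h s (z j ω).1 := by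
    ext s
    exact gHat_eq_avg k h n z ω i s
  rw [e]
  refine IntervalIntegrable.const_mul ?_ _
  have := IntervalIntegrable.sum (μ := volume) (a := a) (b := b) (Finset.range n)
    (f := fun j s => ind i (z j ω).2 * smoothingWeight k h s (z j ω).1)
    fun j _ => (hk.intervalIntegrable_smoothingWeight hh _ a b).const_mul _
  convert! this using 1
  ext s
  simp

theorem hasDerivAt_GHat (hk : ConditionK k) (hh : 0 < h) {s : ℝ} (hs : h < s) (i : Fin 2) :
    HasDerivAt (GHat k h n (fun j => z j ω) i) (gHat k h n (fun j => z j ω) i s) s := by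
  refine intervalIntegral.integral_hasDerivAt_right (intervalIntegrable_gHat hk hh i 0 s) ?_
    (hasDerivAt_gHat hk hs i).continuousAt
  refine ContinuousAt.stronglyMeasurableAtFilter (isOpen_Ioi (a := h))
    (fun x hx => (hasDerivAt_gHat hk hx i).continuousAt) s hs

/-- Beyond `h + ∑ |T_j|` all kernel terms vanish. Boundedness ensures that the `sSup` in `tau`
dominates the points of the set, instead of taking its default value. -/
theorem bddAbove_gHatSum_pos (hk : ConditionK k) (hh : 0 < h) :
    BddAbove {s | 0 ≤ s ∧ 0 < gHatSum k h n (fun j => z j ω) s} := by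
  refine ⟨h + ∑ j ∈ Finset.range n, |(z j ω).1|, fun s hs => ?_⟩
  by_contra hcon
  rw [not_le] at hcon
  have hsum : 0 ≤ ∑ j ∈ Finset.range n, |(z j ω).1| := Finset.sum_nonneg fun _ _ => abs_nonneg _
  have hz : ∀ i, gHat k h n (fun j => z j ω) i s = 0 := by
    intro i
    rw [gHat_eq_of_lt (by linarith) i]
    unfold avg kernelTerm
    rw [Finset.sum_eq_zero, mul_zero, mul_zero]
    intro j hj
    have h1 := Finset.single_le_sum (f := fun j => |(z j ω).1|) (fun _ _ => abs_nonneg _) hj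
    have h2 : 1 < (s - (z j ω).1) / h := by
      rw [lt_div_iff₀ hh]
      linarith [le_abs_self (z j ω).1]
    rw [hk.eq_zero (h2.trans_le (le_abs_self _)), mul_zero]
  have := hs.2
  rw [gHatSum, hz, hz] at this
  simp at this

end Interior

/-! ### Coincidence of the hull slope with the ratio of kernel estimates near `t` -/

namespace Sampling

variable {Ω : Type*} [MeasurableSpace Ω] {μ : Measure Ω} [IsProbabilityMeasure μ]
  {F f f₁ g g₁ g₂ : ℝ → ℝ} {z : ℕ → Ω → ℝ × Fin 2} {cF cg t c : ℝ} {k : ℝ → ℝ}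

theorem tendsto_density (hz : Sampling μ F g z) (hk : ConditionK k) (hF : Jet F f f₁ cF t)
    (hg : Jet g g₁ g₂ cg t) (hc : 0 < c) (a : Fin 2 → ℝ) :
    Tendsto (fun p : ℕ × Ω =>
      (bandwidth c p.1)⁻¹ * avg z (kernelTerm a k t (bandwidth c p.1)) p.1 p.2)
      (inProb μ) (𝓝 (weightedDensity F g a t)) := by
  obtain ⟨ρ, hρ, h⟩ := hz.exists_uniform hk hF hg hc a
  rw [Metric.tendsto_nhds]
  intro ε hε
  filter_upwards [h ε hε] with p hp
  exact (hp t ⟨by linarith, by linarith⟩).1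

theorem tendsto_density_deriv (hz : Sampling μ F g z) (hk : ConditionK k) (hF : Jet F f f₁ cF t)
    (hg : Jet g g₁ g₂ cg t) (hc : 0 < c) (a : Fin 2 → ℝ) :
    Tendsto (fun p : ℕ × Ω =>
      (bandwidth c p.1 ^ 2)⁻¹ * avg z (kernelTerm a (deriv k) t (bandwidth c p.1)) p.1 p.2)
      (inProb μ) (𝓝 ((a 1 - a 0) * f t * g t + (a 0 + (a 1 - a 0) * F t) * g₁ t)) := by
  obtain ⟨ρ, hρ, h⟩ := hz.exists_uniform hk hF hg hc a
  rw [Metric.tendsto_nhds]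
  intro ε hε
  filter_upwards [h ε hε] with p hp
  exact (hp t ⟨by linarith, by linarith⟩).2

omit [IsProbabilityMeasure μ] in
/-- The curve of the true distribution functions stays away from its tangent at `t`. -/
theorem exists_separation (hz : Sampling μ F g z) {δ : ℝ} (hδ : 0 < δ)
    (hF : StrictMonoOn F (Icc (t - δ) (t + δ))) (hg : ∀ x ∈ Icc (t - δ) (t + δ), 0 < g x) :
    ∃ η > 0, ∀ u, u ∉ Icc (t - δ) (t + δ) → η ≤
      ((∫ x in Iic u, weightedDensity F g (ind 1) x) - ∫ x in Iic t, weightedDensity F g (ind 1) x) -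
      F t * (((∫ x in Iic u, weightedDensity F g (ind 0) x) +
        ∫ x in Iic u, weightedDensity F g (ind 1) x) -
        ((∫ x in Iic t, weightedDensity F g (ind 0) x) +
        ∫ x in Iic t, weightedDensity F g (ind 1) x)) := by
  have hint := fun i => hz.integrable_weightedDensity (ind i)
  have hI : Integrable fun x => (F x - F t) * g x := by
    have := (hint 1).sub (hz.g_integrable.const_mul (F t))
    refine this.congr (ae_of_all _ fun x => ?_)
    simp [weightedDensity, ind]
    ring
  -- The height above the tangent is `∫_t^u (F - F t) g`, to which both sides of `t` contribute with
  -- nonnegative sign.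
  have hE : ∀ u, ((∫ x in Iic u, weightedDensity F g (ind 1) x) -
      ∫ x in Iic t, weightedDensity F g (ind 1) x) -
      F t * (((∫ x in Iic u, weightedDensity F g (ind 0) x) +
        ∫ x in Iic u, weightedDensity F g (ind 1) x) -
        ((∫ x in Iic t, weightedDensity F g (ind 0) x) +
        ∫ x in Iic t, weightedDensity F g (ind 1) x)) = ∫ x in t..u, (F x - F t) * g x := by
    intro u
    have e := fun i => intervalIntegral.integral_Iic_sub_Iic (a := t) (b := u)
      (hint i).integrableOn (hint i).integrableOn
    have e1 : ∀ x, (F x - F t) * g x = weightedDensity F g (ind 1) x -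
        F t * (weightedDensity F g (ind 0) x + weightedDensity F g (ind 1) x) := by
      intro x
      simp [weightedDensity, ind]
      ring
    have i01 : IntervalIntegrable (fun x => weightedDensity F g (ind 0) x +
        weightedDensity F g (ind 1) x) volume t u :=
      (hint 0).intervalIntegrable.add (hint 1).intervalIntegrable
    simp_rw [e1]
    rw [intervalIntegral.integral_sub (hint 1).intervalIntegrable (i01.const_mul _),
      intervalIntegral.integral_const_mul,
      intervalIntegral.integral_add (hint 0).intervalIntegrable (hint 1).intervalIntegrable,
      ← e 0, ← e 1]
    ring
  have htm : t ∈ Icc (t - δ) (t + δ) := ⟨by linarith, by linarith⟩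
  have hp1 : 0 < ∫ x in t..(t + δ), (F x - F t) * g x := by
    refine intervalIntegral.intervalIntegral_pos_of_pos_on hI.intervalIntegrable
      (fun x hx => ?_) (by linarith)
    have hxm : x ∈ Icc (t - δ) (t + δ) := ⟨by linarith [hx.1], hx.2.le⟩
    exact mul_pos (sub_pos.2 (hF htm hxm hx.1)) (hg x hxm)
  have hp2 : 0 < ∫ x in (t - δ)..t, -((F x - F t) * g x) := by
    refine intervalIntegral.intervalIntegral_pos_of_pos_on hI.neg.intervalIntegrable
      (fun x hx => ?_) (by linarith)
    have hxm : x ∈ Icc (t - δ) (t + δ) := ⟨hx.1.le, by linarith [hx.2]⟩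
    have := mul_pos (sub_pos.2 (hF hxm htm hx.2)) (hg x hxm)
    linarith
  -- The gap is the smaller of the heights at the two ends of the window.
  refine ⟨_, lt_min hp1 hp2, fun u hu => ?_⟩
  rw [hE]
  have hadd : ∀ a b c : ℝ, (∫ x in a..b, (F x - F t) * g x) + (∫ x in b..c, (F x - F t) * g x) =
      ∫ x in a..c, (F x - F t) * g x := fun a b c =>
    intervalIntegral.integral_add_adjacent_intervals hI.intervalIntegrable hI.intervalIntegrable
  rcases lt_or_ge u (t - δ) with h1 | h1
  · refine (min_le_right _ _).trans ?_
    rw [intervalIntegral.integral_neg, ← intervalIntegral.integral_symm, ← hadd t (t - δ) u,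
      le_add_iff_nonneg_right, intervalIntegral.integral_symm,
      ← intervalIntegral.integral_neg]
    refine intervalIntegral.integral_nonneg h1.le fun x hx => ?_
    have := mul_nonneg (sub_nonneg.2 (hz.F_mono (by linarith [hx.2] : x ≤ t))) (hz.g_nonneg x)
    linarith
  · have h2 : t + δ < u := by
      by_contra hcon
      exact hu ⟨h1, not_lt.1 hcon⟩
    refine (min_le_left _ _).trans ?_
    rw [← hadd t (t + δ) u, le_add_iff_nonneg_right]
    refine intervalIntegral.integral_nonneg h2.le fun x hx => ?_
    exact mul_nonneg (sub_nonneg.2 (hz.F_mono (by linarith [hx.1] : t ≤ x))) (hz.g_nonneg x)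

/-- Near `t` the estimators of the observation densities have a positive sum and an increasing
ratio, with probability tending to one. -/
theorem exists_eventually_wronskian_pos (hz : Sampling μ F g z) (hk : ConditionK k)
    (hF : Jet F f f₁ cF t) (hg : Jet g g₁ g₂ cg t) (hc : 0 < c) (hf0 : 0 < f t) (hg0 : 0 < g t) :
    ∃ ρ > 0, ∀ᶠ p in inProb μ, ∀ s ∈ Icc (t - ρ) (t + ρ),
      0 < (bandwidth c p.1)⁻¹ * avg z (kernelTerm (ind 0) k s (bandwidth c p.1)) p.1 p.2 +
        (bandwidth c p.1)⁻¹ * avg z (kernelTerm (ind 1) k s (bandwidth c p.1)) p.1 p.2 ∧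
      0 < ((bandwidth c p.1)⁻¹ * avg z (kernelTerm (ind 0) k s (bandwidth c p.1)) p.1 p.2) *
        ((bandwidth c p.1 ^ 2)⁻¹ *
          avg z (kernelTerm (ind 1) (deriv k) s (bandwidth c p.1)) p.1 p.2) -
        ((bandwidth c p.1 ^ 2)⁻¹ *
          avg z (kernelTerm (ind 0) (deriv k) s (bandwidth c p.1)) p.1 p.2) *
        ((bandwidth c p.1)⁻¹ * avg z (kernelTerm (ind 1) k s (bandwidth c p.1)) p.1 p.2) := by
  obtain ⟨ρ₀, hρ₀, h0⟩ := hz.exists_uniform hk hF hg hc (ind 0)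
  obtain ⟨ρ₁, hρ₁, h1⟩ := hz.exists_uniform hk hF hg hc (ind 1)
  set V := fun (i : Fin 2) s => weightedDensity F g (ind i) s with hV
  set D := fun (i : Fin 2) s =>
    (ind i 1 - ind i 0) * f s * g s + (ind i 0 + (ind i 1 - ind i 0) * F s) * g₁ s with hD
  have hVc : ∀ i, ContinuousAt (V i) t := fun i => (hF.weightedDensity hg (ind i)).continuousAt
  have hDc : ∀ i, ContinuousAt (D i) t := fun i =>
    (hF.weightedDensity hg (ind i)).two.self_of_nhds.continuousAt
  -- An open condition on the limits, whose values there are `g t` for the sum and `f t * g t ^ 2`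
  -- for the Wronskian.
  have hU : ∀ᶠ x : (ℝ × ℝ) × (ℝ × ℝ) in 𝓝 ((V 0 t, V 1 t), (D 0 t, D 1 t)),
      0 < x.1.1 + x.1.2 ∧ 0 < x.1.1 * x.2.2 - x.2.1 * x.1.2 := by
    have c1 : Continuous fun x : (ℝ × ℝ) × (ℝ × ℝ) => x.1.1 + x.1.2 := by fun_prop
    have c2 : Continuous fun x : (ℝ × ℝ) × (ℝ × ℝ) => x.1.1 * x.2.2 - x.2.1 * x.1.2 := by fun_prop
    refine (c1.continuousAt.eventually (lt_mem_nhds ?_)).and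
      (c2.continuousAt.eventually (lt_mem_nhds ?_))
    · simp only [hV, weightedDensity, ind]
      norm_num
      linarith
    · simp only [hV, hD, weightedDensity, ind]
      norm_num
      have : 0 < f t * g t ^ 2 := by positivity
      linarith
  obtain ⟨ε, hε, hball⟩ := Metric.eventually_nhds_iff_ball.1 hU
  have hcont : ∀ᶠ s in 𝓝 t, ∀ i, |V i s - V i t| < ε / 2 ∧ |D i s - D i t| < ε / 2 := by
    rw [eventually_all]
    exact fun i => ((hVc i).eventually (Metric.ball_mem_nhds _ (half_pos hε))).and
      ((hDc i).eventually (Metric.ball_mem_nhds _ (half_pos hε)))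
  obtain ⟨r, hr, hcr⟩ := Metric.eventually_nhds_iff_ball.1 hcont
  refine ⟨min (min ρ₀ ρ₁) (r / 2), by positivity, ?_⟩
  filter_upwards [h0 (ε / 2) (half_pos hε), h1 (ε / 2) (half_pos hε)] with p hp0 hp1 s hs
  have m1 := min_le_left (min ρ₀ ρ₁) (r / 2)
  have m2 := min_le_right (min ρ₀ ρ₁) (r / 2)
  have m3 := min_le_left ρ₀ ρ₁
  have m4 := min_le_right ρ₀ ρ₁
  obtain ⟨a0, b0⟩ := hp0 s ⟨by linarith [hs.1], by linarith [hs.2]⟩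
  obtain ⟨a1, b1⟩ := hp1 s ⟨by linarith [hs.1], by linarith [hs.2]⟩
  have hsr := hcr s (by
    rw [Metric.mem_ball, Real.dist_eq, abs_lt]
    constructor <;> linarith [hs.1, hs.2])
  have key : ∀ {x y w : ℝ}, |x - y| < ε / 2 → |y - w| < ε / 2 → dist x w < ε := by
    intro x y w hxy hyw
    rw [Real.dist_eq]
    exact (abs_sub_le _ _ _).trans_lt (by linarith)
  exact hball ((_, _), (_, _)) (by
    rw [Metric.mem_ball, Prod.dist_eq, Prod.dist_eq, Prod.dist_eq]
    exact max_lt (max_lt (key a0 (hsr 0).1) (key a1 (hsr 1).1))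
      (max_lt (key b0 (hsr 0).2) (key b1 (hsr 1).2)))

/-- With probability tending to one, the maximum smoothed likelihood estimator coincides with the
naive estimator `ĝ₁ / ĝ` near `t`. -/
theorem eventually_FMS_eq (hz : Sampling μ F g z) (hk : ConditionK k)
    (hF : Jet F f f₁ cF t) (hg : Jet g g₁ g₂ cg t) (hc : 0 < c) (ht : 0 < t) (hf0 : 0 < f t)
    (hg0 : 0 < g t) {r : ℝ} (hr : 0 < r) (hFr : StrictMonoOn F (Icc (t - r) (t + r))) :
    ∀ᶠ p in inProb μ, 0 < gHatSum k (bandwidth c p.1) p.1 (fun j => z j p.2) t ∧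
      FMS k (bandwidth c p.1) p.1 (fun j => z j p.2) =ᶠ[𝓝 t]
      fun s => gHat k (bandwidth c p.1) p.1 (fun j => z j p.2) 1 s /
        gHatSum k (bandwidth c p.1) p.1 (fun j => z j p.2) s := by
  obtain ⟨ρ, hρ, hW⟩ := hz.exists_eventually_wronskian_pos hk hF hg hc hf0 hg0
  have hgp : ∀ᶠ x in 𝓝 t, 0 < g x := hg.continuousAt.eventually (lt_mem_nhds hg0)
  obtain ⟨r', hr', hgr⟩ := Metric.eventually_nhds_iff_ball.1 hgp
  obtain ⟨δ, hδ, hδρ, hδr, hδr', hδt⟩ : ∃ δ > 0, δ ≤ ρ ∧ δ ≤ r ∧ δ < r' ∧ δ < t := by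
    refine ⟨min (min ρ r) (min (r' / 2) (t / 2)), by positivity, ?_, ?_, ?_, ?_⟩
    · exact (min_le_left _ _).trans (min_le_left _ _)
    · exact (min_le_left _ _).trans (min_le_right _ _)
    · have := (min_le_right (min ρ r) (min (r' / 2) (t / 2))).trans (min_le_left _ _)
      linarith
    · have := (min_le_right (min ρ r) (min (r' / 2) (t / 2))).trans (min_le_right _ _)
      linarith
  obtain ⟨η, hη, hsep⟩ := hz.exists_separation (t := t) hδ
    (hFr.mono (Icc_subset_Icc (by linarith) (by linarith))) (fun x hx => hgr x (by
      rw [Metric.mem_ball, Real.dist_eq, abs_lt]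
      constructor <;> linarith [hx.1, hx.2]))
  -- Error budget: `2e` for the increment of `GHat … 1`, `8e` for that of `GHatSum` (at most `4e`)
  -- times a slope of size at most `2`, and `e` for the error of the slope itself.
  obtain ⟨e, he, he1, heη⟩ : ∃ e > 0, e ≤ 1 ∧ 11 * e ≤ η / 2 := by
    refine ⟨min 1 (η / 22), by positivity, min_le_left _ _, ?_⟩
    linarith [min_le_right 1 (η / 22)]
  have hh := eventually_bandwidth_pos hc
  have h0 := tendsto_bandwidth c
  have hnn : ∀ n, 0 ≤ bandwidth c n := fun n => by
    rw [bandwidth_eq]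
    exact mul_nonneg hc.le (inv_nonneg.2 (Real.rpow_nonneg (Nat.cast_nonneg n) _))
  have hratio := (hz.tendsto_density hk hF hg hc (ind 1)).div
    ((hz.tendsto_density hk hF hg hc (ind 0)).add (hz.tendsto_density hk hF hg hc (ind 1)))
    (by simp [weightedDensity, ind]; nlinarith)
  have hlim : weightedDensity F g (ind 1) t /
      (weightedDensity F g (ind 0) t + weightedDensity F g (ind 1) t) = F t := by
    simp only [weightedDensity, ind]
    norm_num
    field_simp
    ring
  rw [hlim] at hratio
  filter_upwards [hW, hz.eventually_abs_GHat_sub_lt hk hnn hh h0 0 he,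
    hz.eventually_abs_GHat_sub_lt hk hnn hh h0 1 he, tendsto_fst_inProb.eventually hh,
    tendsto_fst_inProb.eventually (h0.eventually (gt_mem_nhds (sub_pos.2 hδt))),
    hratio.eventually (Metric.ball_mem_nhds _ he)] with p hWp hG0 hG1 hpos hpt hrat
  have hrat : |(bandwidth c p.1)⁻¹ * avg z (kernelTerm (ind 1) k t (bandwidth c p.1)) p.1 p.2 /
      ((bandwidth c p.1)⁻¹ * avg z (kernelTerm (ind 0) k t (bandwidth c p.1)) p.1 p.2 +
        (bandwidth c p.1)⁻¹ * avg z (kernelTerm (ind 1) k t (bandwidth c p.1)) p.1 p.2) -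
      F t| < e := hrat
  generalize hbw : bandwidth c p.1 = h at *
  set zp := fun j => z j p.2
  have hls : ∀ s ∈ Icc (t - δ) (t + δ), h < s := fun s hs => by linarith [hs.1]
  have htm : t ∈ Icc (t - δ) (t + δ) := ⟨by linarith, by linarith⟩
  have hgd := fun s (hs : s ∈ Icc (t - δ) (t + δ)) i =>
    hasDerivAt_gHat (n := p.1) (z := z) (ω := p.2) hk (hls s hs) i
  have hGd := fun s (hs : s ∈ Icc (t - δ) (t + δ)) i =>
    hasDerivAt_GHat (n := p.1) (z := z) (ω := p.2) hk hpos (hls s hs) i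
  have hWs : ∀ s ∈ Icc (t - δ) (t + δ), 0 < gHatSum k h p.1 zp s := by
    intro s hs
    have := (hWp s ⟨by linarith [hs.1], by linarith [hs.2]⟩).1
    rwa [gHatSum, gHat_eq_of_lt (hls s hs), gHat_eq_of_lt (hls s hs)]
  have hgsd : ∀ s ∈ Icc (t - δ) (t + δ), HasDerivAt (gHatSum k h p.1 zp)
      ((h ^ 2)⁻¹ * avg z (kernelTerm (ind 0) (deriv k) s h) p.1 p.2 +
        (h ^ 2)⁻¹ * avg z (kernelTerm (ind 1) (deriv k) s h) p.1 p.2) s := fun s hs =>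
    (hgd s hs 0).add (hgd s hs 1)
  have hmono : MonotoneOn (fun s => gHat k h p.1 zp 1 s / gHatSum k h p.1 zp s)
      (Icc (t - δ) (t + δ)) := by
    have hd := fun s (hs : s ∈ Icc (t - δ) (t + δ)) =>
      (hgd s hs 1).div (hgsd s hs) (hWs s hs).ne'
    refine monotoneOn_of_deriv_nonneg (convex_Icc _ _)
      (fun s hs => (hd s hs).continuousAt.continuousWithinAt)
      (fun s hs => (hd s (interior_subset hs)).differentiableAt.differentiableWithinAt) ?_
    intro s hs
    have hs := interior_subset hs
    refine (div_nonneg ?_ (sq_nonneg _)).trans_eq (hd s hs).deriv.symm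
    have := (hWp s ⟨by linarith [hs.1], by linarith [hs.2]⟩).2
    rw [gHatSum, gHat_eq_of_lt (hls s hs), gHat_eq_of_lt (hls s hs)]
    nlinarith
  have hτ : t + δ ≤ tau k h p.1 zp := by
    have hm : t + δ ∈ Icc (t - δ) (t + δ) := ⟨by linarith, le_rfl⟩
    exact le_csSup (bddAbove_gHatSum_pos hk hpos) ⟨by linarith, hWs _ hm⟩
  have hgG : ∀ i u, 0 ≤ ∫ x in Iic u, weightedDensity F g (ind i) x := fun i u =>
    integral_nonneg fun x => hz.weightedDensity_nonneg i x
  have hgG1 : ∀ u, (∫ x in Iic u, weightedDensity F g (ind 0) x) +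
      (∫ x in Iic u, weightedDensity F g (ind 1) x) ≤ 1 := by
    intro u
    have hint := fun i => hz.integrable_weightedDensity (ind i)
    rw [← integral_add (hint 0).integrableOn (hint 1).integrableOn, ← hz.g_integral]
    have e1 : ∀ x, weightedDensity F g (ind 0) x + weightedDensity F g (ind 1) x = g x := by
      intro x
      simp [weightedDensity, ind]
      ring
    simp_rw [e1]
    exact setIntegral_le_integral hz.g_integrable (ae_of_all _ hz.g_nonneg)
  have hrat' : |gHat k h p.1 zp 1 t / gHatSum k h p.1 zp t - F t| < e := by
    rw [gHatSum, gHat_eq_of_lt (hls t htm), gHat_eq_of_lt (hls t htm)]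
    exact hrat
  refine ⟨hWs t htm, ?_⟩
  -- `C = 3` suffices, as the total mass is within `2e ≤ 2` of a number in `[0, 1]`.
  refine eventually_derivWithin_lowerHull_eq (A := GHatSum k h p.1 zp) (B := GHat k h p.1 zp 1)
    (a := gHatSum k h p.1 zp) (b := gHat k h p.1 zp 1) (C := 3) hδ (half_pos hη) (by linarith) hτ
    (fun s hs => (hGd s hs 0).add (hGd s hs 1)) (fun s hs => hGd s hs 1)
    (fun s hs => (hgsd s hs).continuousAt.continuousWithinAt)
    (fun s hs => (hgd s hs 1).continuousAt.continuousWithinAt) hWs hmono ?_ ?_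
  · intro u hu
    have b0 := abs_lt.1 (hG0 u hu.1)
    have b1 := abs_lt.1 (hG1 u hu.1)
    have c0 := hgG 0 u
    have c1 := hgG 1 u
    have c2 := hgG1 u
    rw [GHatSum, abs_le]
    constructor <;> linarith
  · intro u hu hun
    have hS := hsep u hun
    have b0 := abs_lt.1 (hG0 u hu.1)
    have b1 := abs_lt.1 (hG1 u hu.1)
    have d0 := abs_lt.1 (hG0 t ht.le)
    have d1 := abs_lt.1 (hG1 t ht.le)
    have c0 := hgG 0 u
    have c1 := hgG 1 u
    have c2 := hgG1 u
    have c0' := hgG 0 t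
    have c1' := hgG 1 t
    have c2' := hgG1 t
    have hFt0 := hz.F_nonneg t
    have hFt1 := hz.F_le_one t
    have hr1 := abs_lt.1 hrat'
    rw [GHatSum, GHatSum]
    generalize gHat k h p.1 zp 1 t / gHatSum k h p.1 zp t = R at *
    generalize (∫ x in Iic u, weightedDensity F g (ind 0) x) = x0 at *
    generalize (∫ x in Iic u, weightedDensity F g (ind 1) x) = x1 at *
    generalize (∫ x in Iic t, weightedDensity F g (ind 0) x) = y0 at *
    generalize (∫ x in Iic t, weightedDensity F g (ind 1) x) = y1 at *
    have k1 : |R * ((GHat k h p.1 zp 0 u + GHat k h p.1 zp 1 u - (GHat k h p.1 zp 0 t +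
        GHat k h p.1 zp 1 t)) - ((x0 + x1) - (y0 + y1)))| ≤ 2 * (4 * e) := by
      rw [abs_mul]
      refine mul_le_mul ?_ ?_ (abs_nonneg _) (by norm_num)
      · rw [abs_le]
        constructor <;> linarith
      · rw [abs_le]
        constructor <;> linarith
    have k2 : |(R - F t) * ((x0 + x1) - (y0 + y1))| ≤ e * 1 := by
      rw [abs_mul]
      refine mul_le_mul hrat'.le ?_ (abs_nonneg _) he.le
      rw [abs_le]
      constructor <;> linarith
    rw [abs_le] at k1 k2
    linarith [k1.1, k1.2, k2.1, k2.2]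

end Sampling

/-! ### The density estimators at an interior point -/

section Combination

variable {Ω : Type*} {z : ℕ → Ω → ℝ × Fin 2} {w : ℝ → ℝ} {s h : ℝ} {n : ℕ} {ω : Ω}

theorem avg_kernelTerm_add (a b : Fin 2 → ℝ) :
    avg z (kernelTerm (fun i => a i + b i) w s h) n ω =
      avg z (kernelTerm a w s h) n ω + avg z (kernelTerm b w s h) n ω := by
  simp only [avg, kernelTerm, add_mul, Finset.sum_add_distrib, mul_add]

theorem avg_kernelTerm_const_mul (x : ℝ) (a : Fin 2 → ℝ) :
    avg z (kernelTerm (fun i => x * a i) w s h) n ω = x * avg z (kernelTerm a w s h) n ω := by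
  simp only [avg, kernelTerm, mul_assoc, ← Finset.mul_sum]
  ring

theorem avg_kernelTerm_one : avg z (kernelTerm (fun _ => 1) w s h) n ω =
    avg z (kernelTerm (ind 0) w s h) n ω + avg z (kernelTerm (ind 1) w s h) n ω := by
  rw [← avg_kernelTerm_add]
  congr 3
  ext i
  fin_cases i <;> simp [ind]

theorem avg_kernelTerm_ind_sub (x : ℝ) : avg z (kernelTerm (fun i => ind 1 i - x) w s h) n ω =
    avg z (kernelTerm (ind 1) w s h) n ω - x * avg z (kernelTerm (fun _ => 1) w s h) n ω := by
  rw [sub_eq_add_neg, ← neg_mul, ← avg_kernelTerm_const_mul, ← avg_kernelTerm_add]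
  simp [sub_eq_add_neg]

/-- Subtracting a constant `x` from the ratio does not change its derivative. With `x = F t` the new
numerator estimates a function vanishing at the point, so its value enters only through its bias. -/
theorem fNaive_eq {k : ℝ → ℝ} (hk : ConditionK k) (hs : h < s) (x : ℝ)
    (hA : h⁻¹ * avg z (kernelTerm (fun _ => 1) k s h) n ω ≠ 0) :
    fNaive k h n (fun j => z j ω) s =
      (h ^ 2)⁻¹ * avg z (kernelTerm (fun i => ind 1 i - x) (deriv k) s h) n ω /
        (h⁻¹ * avg z (kernelTerm (fun _ => 1) k s h) n ω) -
      (h ^ 2)⁻¹ * avg z (kernelTerm (fun _ => 1) (deriv k) s h) n ω *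
        (h⁻¹ * avg z (kernelTerm (fun i => ind 1 i - x) k s h) n ω) /
        (h⁻¹ * avg z (kernelTerm (fun _ => 1) k s h) n ω) ^ 2 := by
  rw [fNaive, gHatSum, gHat_eq_of_lt hs, gHat_eq_of_lt hs, (hasDerivAt_gHat hk hs 0).deriv,
    (hasDerivAt_gHat hk hs 1).deriv, ← mul_add, ← mul_add, ← avg_kernelTerm_one,
    ← avg_kernelTerm_one, avg_kernelTerm_ind_sub, avg_kernelTerm_ind_sub]
  have h1 : ∀ a b c d : ℝ, h⁻¹ * a ≠ 0 → (h⁻¹ * a * ((h ^ 2)⁻¹ * b) - (h ^ 2)⁻¹ * c * (h⁻¹ * d)) /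
      (h⁻¹ * a) ^ 2 = (h ^ 2)⁻¹ * (b - x * c) / (h⁻¹ * a) -
      (h ^ 2)⁻¹ * c * (h⁻¹ * (d - x * a)) / (h⁻¹ * a) ^ 2 := by
    intro a b c d ha
    rw [mul_sub h⁻¹, mul_left_comm h⁻¹ x a]
    generalize h⁻¹ * a = y at *
    generalize h⁻¹ = p
    generalize (h ^ 2)⁻¹ = r
    field_simp
    ring
  exact h1 _ _ _ _ hA

end Combination

/-! ### Limit law of the density estimators -/

namespace Sampling

variable {Ω : Type*} [MeasurableSpace Ω] {μ : Measure Ω} [IsProbabilityMeasure μ]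
  {F f f₁ g g₁ g₂ : ℝ → ℝ} {z : ℕ → Ω → ℝ × Fin 2} {cF cg t c : ℝ} {k : ℝ → ℝ}

/-- With probability tending to one, the maximum smoothed likelihood estimator is differentiable
at `t` and its derivative is the naive density estimator. -/
theorem eventually_hasDerivAt_FMS (hz : Sampling μ F g z) (hk : ConditionK k)
    (hF : Jet F f f₁ cF t) (hg : Jet g g₁ g₂ cg t) (hc : 0 < c) (ht : 0 < t) (hf0 : 0 < f t)
    (hg0 : 0 < g t) {r : ℝ} (hr : 0 < r) (hFr : StrictMonoOn F (Icc (t - r) (t + r))) :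
    ∀ᶠ p in inProb μ, HasDerivAt (FMS k (bandwidth c p.1) p.1 (fun j => z j p.2))
      (fNaive k (bandwidth c p.1) p.1 (fun j => z j p.2) t) t := by
  filter_upwards [hz.eventually_FMS_eq hk hF hg hc ht hf0 hg0 hr hFr,
    tendsto_fst_inProb.eventually ((tendsto_bandwidth c).eventually (gt_mem_nhds ht))] with p hp hpt
  have hd := fun i => (hasDerivAt_gHat (n := p.1) (z := z) (ω := p.2) hk
    hpt i).differentiableAt.hasDerivAt
  have h1 := ((hd 1).fun_div ((hd 0).fun_add (hd 1)) hp.1.ne').congr_of_eventuallyEq hp.2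
  refine h1.congr_deriv ?_
  rw [fNaive, gHatSum]
  ring

omit [IsProbabilityMeasure μ] in
/-- The deterministic part of the error of the derivative estimate. -/
theorem tendsto_bias (hz : Sampling μ F g z) (hk : ConditionK k) (hF : Jet F f f₁ cF t)
    (hg : Jet g g₁ g₂ cg t) (hc : 0 < c) (a : Fin 2 → ℝ) :
    Tendsto (fun n => root n ^ 2 * ((bandwidth c n ^ 2)⁻¹ *
      (∫ ω, kernelTerm a (deriv k) t (bandwidth c n) (z 0 ω) ∂μ) -
      ((a 1 - a 0) * f t * g t + (a 0 + (a 1 - a 0) * F t) * g₁ t))) atTop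
      (𝓝 (c ^ 2 * (m2 k / 2 * ((a 1 - a 0) * cF * g t + 3 * ((a 1 - a 0) * f₁ t * g₁ t) +
        3 * ((a 1 - a 0) * f t * g₂ t) + (a 0 + (a 1 - a 0) * F t) * cg)))) := by
  refine ((hk.tendsto_bias_deriv (hz.integrable_weightedDensity a) (hF.weightedDensity hg a)
    (eventually_bandwidth_pos hc) (tendsto_bandwidth c)).const_mul (c ^ 2)).congr' ?_
  filter_upwards [eventually_bandwidth_pos hc, eventually_root_pos] with n hn hr
  have e1 : root n ^ 2 = c ^ 2 * (bandwidth c n ^ 2)⁻¹ := by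
    rw [bandwidth_eq]
    field_simp
  rw [e1, hz.integral_kernelTerm a hk.weight_deriv t hn, mul_assoc (c ^ 2)]
  congr 2
  field_simp

/-- The fluctuation is the centered derivative average with weights `Δ - F t`, divided by `g t`; the
squared weights have density `F (1 - F) g` at `t`. Everything else converges in probability to the
asymptotic mean. -/
theorem convergesInLaw_fNaive (hz : Sampling μ F g z) (hk : ConditionK k)
    (hF : Jet F f f₁ cF t) (hg : Jet g g₁ g₂ cg t) (hc : 0 < c) (ht : 0 < t)
    (hg0 : 0 < g t) {v : NNReal} (hv0 : v ≠ 0)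
    (hv : (v : ℝ) = F t * (1 - F t) / (c ^ 3 * g t) * ∫ u, deriv k u ^ 2) :
    ConvergesInLaw μ (fun n ω => root n ^ 2 *
      (fNaive k (bandwidth c n) n (fun j => z j ω) t - f t))
      (gaussianReal (1 / 2 * c ^ 2 * m2 k * (cF + 2 * ((g₂ t * f t + g₁ t * f₁ t) / g t) -
        2 * (g₁ t ^ 2 * f t / g t ^ 2))) v) := by
  have i0 : ind 1 0 = 0 := by simp [ind]
  have i1 : ind 1 1 = 1 := by simp [ind]
  have hS := hz.convergesInLaw_deriv hk hF hg hc (fun i => ind 1 i - F t) (b := (g t)⁻¹) (v := v) (by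
    rw [hv]
    simp only [weightedDensity, i0, i1]
    field_simp
    ring)
  refine hS.of_sub_tendsto hv0 ?_
  have hA := hz.tendsto_density hk hF hg hc (fun _ => 1)
  have hA' := hz.tendsto_density_deriv hk hF hg hc (fun _ => 1)
  have hW := hz.tendsto_density_deriv hk hF hg hc (fun i => ind 1 i - F t)
  have ha := hz.tendsto_value hk hF hg hc (fun _ => 1)
  have hb := hz.tendsto_value hk hF hg hc (fun i => ind 1 i - F t)
  have he := (hz.tendsto_bias hk hF hg hc (fun i => ind 1 i - F t)).comp
    (tendsto_fst_inProb (μ := μ))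
  have w1 : weightedDensity F g (fun _ => 1) t = g t := by simp [weightedDensity]
  have w2 : weightedDensity F g (fun i => ind 1 i - F t) t = 0 := by
    simp [weightedDensity, i0, i1]
  rw [w1] at hA
  simp only [w1] at ha
  simp only [w2] at hb
  -- The three terms come from replacing the denominator by `g t`, from the value of the numerator,
  -- and from the bias of its derivative.
  have hlim := (((hW.mul ha).div (hA.mul_const (g t)) (by positivity)).neg.sub
    ((hA'.mul hb).div (hA.pow 2) (by positivity))).add (he.div_const (g t))
  refine (hlim.congr' ?_).mono_right (le_of_eq ?_)
  · filter_upwards [hA.eventually (lt_mem_nhds hg0),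
      tendsto_fst_inProb.eventually ((tendsto_bandwidth c).eventually (gt_mem_nhds ht))] with p hp hpt
    rw [fNaive_eq hk hpt (F t) hp.ne']
    simp only [Pi.div_apply, Function.comp, i0, i1]
    generalize (∫ ω, kernelTerm (fun i => ind 1 i - F t) (deriv k) t (bandwidth c p.1) (z 0 ω) ∂μ) = E
    generalize avg z (kernelTerm (fun i => ind 1 i - F t) (deriv k) t (bandwidth c p.1)) p.1 p.2 = W
    generalize (bandwidth c p.1)⁻¹ * avg z (kernelTerm (fun _ => 1) k t (bandwidth c p.1)) p.1 p.2 = A at *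
    generalize (bandwidth c p.1)⁻¹ * avg z (kernelTerm (fun i => ind 1 i - F t) k t (bandwidth c p.1)) p.1 p.2 = B
    generalize (bandwidth c p.1 ^ 2)⁻¹ = y
    have := hp.ne'
    field_simp
    ring
  · congr 1
    simp only [i0, i1]
    field_simp
    ring

end Sampling

/-! ### The regularity of the distribution functions -/

section Regularity

variable {P : Measure ℝ} [IsProbabilityMeasure P] {f : ℝ → ℝ} {M t : ℝ}

theorem IsDensity.cdf_eq_integral (hf : IsDensity P f) (x : ℝ) : cdf P x = ∫ u in Iic x, f u := by
  rw [cdf_eq_real, ← integral_indicator_one measurableSet_Iic, hf.integral_eq,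
    ← integral_indicator measurableSet_Iic]
  refine integral_congr_ae (ae_of_all _ fun u => ?_)
  by_cases hu : u ∈ Iic x <;> simp [hu]

theorem IsDensity.hasDerivAt_cdf (hf : IsDensity P f) {x : ℝ} (hx : ContinuousAt f x) :
    HasDerivAt (cdf P) (f x) x := by
  have e : (cdf P : ℝ → ℝ) = fun y => cdf P x + ∫ u in x..y, f u := by
    ext y
    rw [hf.cdf_eq_integral, hf.cdf_eq_integral, ← intervalIntegral.integral_Iic_sub_Iic
      hf.integrable.integrableOn hf.integrable.integrableOn]
    ring
  rw [e]
  exact (intervalIntegral.integral_hasDerivAt_right hf.integrable.intervalIntegrable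
    (hf.measurable.stronglyMeasurable.stronglyMeasurableAtFilter) hx).const_add _

theorem HasContThirdDerivAt.jet (hf : HasContThirdDerivAt f t) :
    Jet f (deriv f) (iteratedDeriv 2 f) (iteratedDeriv 3 f t) t where
  one := hf.1.mono fun x hx => by
    have := hx 0 (by norm_num)
    rw [iteratedDeriv_zero] at this
    exact this.hasDerivAt
  two := hf.1.mono fun x hx => by
    have := hx 1 (by norm_num)
    rw [iteratedDeriv_succ, ← iteratedDeriv_one]
    exact this.hasDerivAt
  three := by
    have := hf.1.self_of_nhds 2 (by norm_num)
    rw [iteratedDeriv_succ (n := 2)]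
    exact this.hasDerivAt

theorem IsDensity.jet_cdf (hf : IsDensity P f) (h : HasContThirdDerivAt f t) :
    Jet (cdf P) f (deriv f) (iteratedDeriv 2 f t) t where
  one := h.jet.one.mono fun _ hx => hf.hasDerivAt_cdf hx.continuousAt
  two := h.jet.one
  three := h.jet.two.self_of_nhds

theorem ConditionF.cdf_zero (hF : ConditionF P f M) : cdf P 0 = 0 := by
  have h0 : P (Iio 0) = 0 := by
    refine measure_mono_null ?_ P.measure_compl_support
    rw [hF.support_eq]
    exact fun x hx hx' => (not_lt.2 hx'.1) hx
  have h1 : P {0} = 0 := by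
    rw [hF.density.eq_withDensity]
    exact withDensity_absolutelyContinuous _ _ (by simp)
  rw [cdf_eq_real, ← Iio_union_right, measureReal_def, measure_union_null h0 h1]
  simp

theorem ConditionF.cdf_eq_one (hF : ConditionF P f M) {x : ℝ} (hx : M ≤ x) : cdf P x = 1 := by
  have h0 : P (Iic x)ᶜ = 0 := by
    refine measure_mono_null ?_ P.measure_compl_support
    rw [hF.support_eq]
    exact fun y hy hy' => hy (hy'.2.trans hx)
  rw [cdf_eq_real, measureReal_def, (prob_compl_eq_zero_iff measurableSet_Iic).1 h0]
  simp

/-- A smooth point with `q ≠ 0` lies in the interior of the support. -/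
theorem ConditionF.lt_of_q_ne_zero (hF : ConditionF P f M) (ht : 0 < t)
    (h : HasContThirdDerivAt f t) {g : ℝ → ℝ} (hq : q f g t ≠ 0) : t < M := by
  by_contra hM
  rw [not_lt] at hM
  -- `F₀` has reached its maximum `1` on `[M, ∞)`, so its derivative `f` vanishes at continuity
  -- points there. At `t = M` this contradicts the lower bound on `f`; beyond `M` it makes `f`
  -- vanish around `t`, hence `q = 0`.
  have hzero : ∀ x, M ≤ x → ContinuousAt f x → f x = 0 := by
    intro x hx hc
    refine IsLocalMax.hasDerivAt_eq_zero (f := cdf P) (a := x) ?_ (hF.density.hasDerivAt_cdf hc)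
    refine Eventually.of_forall fun y => ?_
    rw [hF.cdf_eq_one hx]
    exact cdf_le_one P y
  rcases hM.eq_or_lt with rfl | hlt
  · obtain ⟨ε, hε, hfe⟩ := hF.away
    have h1 := hfe M ⟨ht.le, le_rfl⟩
    rw [hzero M le_rfl h.jet.continuousAt] at h1
    exact absurd h1 (not_le.2 hε)
  · have hev : f =ᶠ[𝓝 t] fun _ => 0 := by
      filter_upwards [lt_mem_nhds hlt, h.jet.one] with x hx hd
      exact hzero x hx.le hd.continuousAt
    refine hq ?_
    have e2 : iteratedDeriv 2 f t = 0 := by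
      rw [hev.iteratedDeriv_eq 2]
      simp
    rw [q, e2, hev.deriv_eq, hev.self_of_nhds]
    simp

end Regularity

end CurrentStatus

/-! ### The theorem -/

theorem theorem3p6
    {Ω : Type*} [MeasurableSpace Ω] (μ : Measure Ω) [IsProbabilityMeasure μ]
    (P₀ Q : Measure ℝ) [IsProbabilityMeasure P₀] [IsProbabilityMeasure Q]
    (f₀ g : ℝ → ℝ) (M₀ : ℝ)
    (hF : ConditionF P₀ f₀ M₀) (hG : ConditionG Q g M₀)
    (X T : ℕ → Ω → ℝ)
    (hXm : ∀ i, Measurable (X i)) (hTm : ∀ i, Measurable (T i))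
    (hXlaw : ∀ i, μ.map (X i) = P₀) (hTlaw : ∀ i, μ.map (T i) = Q)
    (hX : iIndepFun X μ) (hT : iIndepFun T μ)
    (hXT : IndepFun (fun ω i => X i ω) (fun ω i => T i ω) μ)
    (k : ℝ → ℝ) (hk : ConditionK k)
    (t : ℝ) (ht : 0 < t)
    (hf3 : HasContThirdDerivAt f₀ t) (hg3 : HasContThirdDerivAt g t)
    (hq : q f₀ g t ≠ 0) :
    (∀ c : ℝ, 0 < c →
      -- the derivative defining the MSLE of the density exists with probability tending to one
      Tendsto (fun n : ℕ => μ {ω | ¬ DifferentiableAt ℝ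
          (FMS k (bandwidth c n) n (fun i => observe (X i ω) (T i ω))) t}) atTop (𝓝 0) ∧
      ConvergesInLaw μ
        (fun n ω => (n : ℝ) ^ (2 / 7 : ℝ) *
          (fMS k (bandwidth c n) n (fun i => observe (X i ω) (T i ω)) t - f₀ t))
        (gaussianReal (asympMean k f₀ g t c) (asympVar k (cdf P₀) g t c).toNNReal) ∧
      ConvergesInLaw μ
        (fun n ω => (n : ℝ) ^ (2 / 7 : ℝ) *
          (fNaive k (bandwidth c n) n (fun i => observe (X i ω) (T i ω)) t - f₀ t))
        (gaussianReal (asympMean k f₀ g t c) (asympVar k (cdf P₀) g t c).toNNReal)) ∧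
    0 < cOpt k (cdf P₀) f₀ g t ∧
    ∀ c : ℝ, 0 < c → c ≠ cOpt k (cdf P₀) f₀ g t →
      aMSE k (cdf P₀) f₀ g t (cOpt k (cdf P₀) f₀ g t) < aMSE k (cdf P₀) f₀ g t c := by
  obtain ⟨εf, hεf, hfa⟩ := hF.away
  obtain ⟨εg, hεg, hga⟩ := hG.away
  have htM := hF.lt_of_q_ne_zero ht hf3 hq
  have hmem : t ∈ Icc 0 M₀ := ⟨ht.le, htM.le⟩
  have hf0 : 0 < f₀ t := hεf.trans_le (hfa t hmem)
  have hg0 : 0 < g t := hεg.trans_le (hga t hmem)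
  have hF0 : 0 < cdf P₀ t := by
    rw [← hF.cdf_zero]
    exact hF.strictMono ⟨le_rfl, hmem.1.trans hmem.2⟩ hmem ht
  have hF1 : cdf P₀ t < 1 := by
    rw [← hF.cdf_eq_one le_rfl]
    exact hF.strictMono hmem ⟨hmem.1.trans hmem.2, le_rfl⟩ htM
  have hz := sampling_observe hG hXm hTm hXlaw hTlaw hX hT hXT
  have hjF := hF.density.jet_cdf hf3
  have hjg := hg3.jet
  have hr : 0 < min t (M₀ - t) := lt_min ht (sub_pos.2 htM)
  have hFr : StrictMonoOn (cdf P₀) (Icc (t - min t (M₀ - t)) (t + min t (M₀ - t))) :=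
    hF.strictMono.mono (Icc_subset_Icc (by linarith [min_le_left t (M₀ - t)])
      (by linarith [min_le_right t (M₀ - t)]))
  refine ⟨fun c hc => ?_, aMSE_minimizer hF0 hF1 hg0 hk.integral_deriv_sq_pos hk.m2_pos hq⟩
  have hd := hz.eventually_hasDerivAt_FMS hk hjF hjg hc ht hf0 hg0 hr hFr
  have hvar : 0 < asympVar k (cdf P₀) g t c :=
    mul_pos (div_pos (mul_pos hF0 (sub_pos.2 hF1)) (by positivity)) hk.integral_deriv_sq_pos
  have hnaive : ConvergesInLaw μ
      (fun n ω => (n : ℝ) ^ (2 / 7 : ℝ) *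
        (fNaive k (bandwidth c n) n (fun i => observe (X i ω) (T i ω)) t - f₀ t))
      (gaussianReal (asympMean k f₀ g t c) (asympVar k (cdf P₀) g t c).toNNReal) := by
    simp_rw [root_sq]
    exact hz.convergesInLaw_fNaive hk hjF hjg hc ht hg0 (Real.toNNReal_pos.2 hvar).ne'
      (Real.coe_toNNReal _ hvar.le)
  refine ⟨eventually_inProb.1 (hd.mono fun p hp => hp.differentiableAt), ?_, hnaive⟩
  refine hnaive.congr_inProb (hd.mono fun p hp => ?_)
  rw [fMS, hp.deriv]
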